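/- **Theorem 2 (Exact).** Let $S=S[1]\cdots S[n]$ be a stream of positive integers. For a midpoint $m\in\{1,\dots,n\}$ let $\ell(m)$ be the largest $\ell$ with $\ell\le m\le n-\ell$ and $S[m-i+1]=S[m+i]$ for all $1\le i\le \ell$ (if there is no such $\ell\geq 1$, then $\ell(m)=0$); that is, palindromes are even and their length is measured from the midpoint. Let $\ell_{\max}=\max_{1\le m\le n}\ell(m)$. For every constant $a$ there are a randomized two-pass streaming algorithm (a single word-RAM program for each pass; the registers are kept between the passes, the stream can be read only from left to right, once in each pass, and the output is write-only and not counted as space) and constants $b,C$ such that the following holds for every $n$, every prime $p$ with $n^4\le p\le n^5$, and every stream $S$ of length $n$ with symbols in $\{1,\dots,n^a\}$. The algorithm is given $n$, $p$ and a number $r$ drawn uniformly at random from $\{1,\dots,p\}$. 1. (Resources) For every value of $r$, the algorithm halts after at most $C\,n$ steps in total over the two passes, and it uses at most $C\lfloor\sqrt n\rfloor$ registers, each of which holds a number less than $n^b$, i.e. $O(\log n)$ bits. So it runs in $O(n)$ time and $O(\sqrt n)$ space. 2. (Correctness) With probability at least $1-1/n$ over $r$, both of the following hold: * the first pass accomplishes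 the task of ApproxSqrt with $\varepsilon=\tfrac12$: it reports, for every midpoint $m\in\{1,\dots,n\}$, the pair $(m,\tilde\ell(m))$ with an estimate $\tilde\ell(m)\in\mathbb N$ such that $\ell(m)-\tfrac12\sqrt n<\tilde\ell(m)\le\ell(m)$, and nothing else; * after the second pass the algorithm has reported $\ell_{\max}$ together with all the midpoints $m\in\{1,\dots,n\}$ with $\ell(m)=\ell_{\max}$, and no others: the pairs reported in the second pass are exactly the pairs $(m,\ell_{\max})$ with $\ell(m)=\ell_{\max}$. -/

import Mathlib

namespace StreamPal

/-! ### Palindromes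

A stream of length `n` is given by its symbols `S 1, …, S n` (the values of `S` elsewhere are
never used).  Palindromes are even palindromes; the length of a palindrome is the number of its
symbols on either side of its midpoint. -/

/-- `S[1..n]` contains an (even) palindrome of length `l` with midpoint `m`:
`m ∈ {l, …, n - l}` and `S[m - i + 1] = S[m + i]` for `1 ≤ i ≤ l`. -/
def HasPalindrome (n : ℕ) (S : ℕ → ℕ) (m l : ℕ) : Prop :=
  l ≤ m ∧ m + l ≤ n ∧ ∀ i, 1 ≤ i → i ≤ l → S (m - i + 1) = S (m + i)

/-- `ℓ(m)`: the length of the maximal palindrome `P[m]` of `S[1..n]` with midpoint `m`. -/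
noncomputable def palLength (n : ℕ) (S : ℕ → ℕ) (m : ℕ) : ℕ :=
  sSup {l | HasPalindrome n S m l}

/-- `ℓ_max`: the length of a longest palindrome of `S[1..n]`. -/
noncomputable def maxPalLength (n : ℕ) (S : ℕ → ℕ) : ℕ :=
  (Finset.Icc 1 n).sup (palLength n S)

/-! ### Two-pass streaming algorithms on a word RAM -/

/-- The binary machine operations. Subtraction truncates at zero, and comparisons return
`0` or `1`. -/
inductive BinOp where
  | add
  | sub
  | mul
  | div
  | mod
  | lt
  | eq

/-- The value of a binary machine operation. -/
def BinOp.eval : BinOp → ℕ → ℕ → ℕ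
  | .add, x, y => x + y
  | .sub, x, y => x - y
  | .mul, x, y => x * y
  | .div, x, y => x / y
  | .mod, x, y => x % y
  | .lt, x, y => if x < y then 1 else 0
  | .eq, x, y => if x = y then 1 else 0

/-- Programs of the machine. `R[a]` denotes the content of register `a`. -/
inductive Cmd where
  /-- no operation -/
  | skip
  /-- `R[d] := k` -/
  | const (d k : ℕ)
  /-- `R[d] := R[a] o R[b]` -/
  | op (o : BinOp) (d a b : ℕ)
  /-- `R[d] := R[R[a]]` -/
  | load (d a : ℕ)
  /-- `R[R[a]] := R[s]` -/
  | store (a s : ℕ)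
  /-- `R[d] :=` the next symbol of the stream -/
  | read (d : ℕ)
  /-- write the pair `(R[a], R[b])` to the output, which cannot be read back -/
  | report (a b : ℕ)
  /-- first `c₁`, then `c₂` -/
  | seq (c₁ c₂ : Cmd)
  /-- if `R[a] ≠ 0` then `c₁` else `c₂` -/
  | ite (a : ℕ) (c₁ c₂ : Cmd)
  /-- while `R[a] ≠ 0` do `c` -/
  | loop (a : ℕ) (c : Cmd)

/-- A machine state: the registers, the number of symbols of the stream that the current pass
has read, and the pairs that the current pass has reported so far. -/
structure State where
  mem : ℕ → ℕ
  pos : ℕ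
  out : List (ℕ × ℕ)

/-- Write the value `v` to register `d`. -/
def State.write (σ : State) (d v : ℕ) : State :=
  { σ with mem := Function.update σ.mem d v }

/-- `Exec M W n S c σ t τ`: on the machine with the registers `0, …, M - 1`, each of which holds
a number less than `W`, the program `c`, started in the state `σ` on the stream `S[1..n]`, halts
in the state `τ` after exactly `t` steps. A program that uses a register outside this range,
computes a value that does not fit into a register, or reads beyond the end of the stream does
not halt properly and has no final state. -/
inductive Exec (M W n : ℕ) (S : ℕ → ℕ) : Cmd → State → ℕ → State → Prop where
  | skip (σ : State) : Exec M W n S .skip σ 1 σ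
  | const (σ : State) (d k : ℕ) (hd : d < M) (hk : k < W) :
      Exec M W n S (.const d k) σ 1 (σ.write d k)
  | op (σ : State) (o : BinOp) (d a b : ℕ) (hd : d < M) (ha : a < M) (hb : b < M)
      (hv : o.eval (σ.mem a) (σ.mem b) < W) :
      Exec M W n S (.op o d a b) σ 1 (σ.write d (o.eval (σ.mem a) (σ.mem b)))
  | load (σ : State) (d a : ℕ) (hd : d < M) (ha : a < M) (haa : σ.mem a < M)
      (hv : σ.mem (σ.mem a) < W) :
      Exec M W n S (.load d a) σ 1 (σ.write d (σ.mem (σ.mem a)))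
  | store (σ : State) (a s : ℕ) (ha : a < M) (hs : s < M) (haa : σ.mem a < M)
      (hv : σ.mem s < W) :
      Exec M W n S (.store a s) σ 1 (σ.write (σ.mem a) (σ.mem s))
  | read (σ : State) (d : ℕ) (hd : d < M) (hpos : σ.pos < n) (hv : S (σ.pos + 1) < W) :
      Exec M W n S (.read d) σ 1 { σ.write d (S (σ.pos + 1)) with pos := σ.pos + 1 }
  | report (σ : State) (a b : ℕ) (ha : a < M) (hb : b < M) :
      Exec M W n S (.report a b) σ 1 { σ with out := σ.out ++ [(σ.mem a, σ.mem b)] }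
  | seq (c₁ c₂ : Cmd) (σ₁ σ₂ σ₃ : State) (t₁ t₂ : ℕ)
      (h₁ : Exec M W n S c₁ σ₁ t₁ σ₂) (h₂ : Exec M W n S c₂ σ₂ t₂ σ₃) :
      Exec M W n S (.seq c₁ c₂) σ₁ (t₁ + t₂) σ₃
  | iteTrue (a : ℕ) (c₁ c₂ : Cmd) (σ τ : State) (t : ℕ) (ha : a < M) (h : σ.mem a ≠ 0)
      (h₁ : Exec M W n S c₁ σ t τ) :
      Exec M W n S (.ite a c₁ c₂) σ (t + 1) τ
  | iteFalse (a : ℕ) (c₁ c₂ : Cmd) (σ τ : State) (t : ℕ) (ha : a < M) (h : σ.mem a = 0)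
      (h₂ : Exec M W n S c₂ σ t τ) :
      Exec M W n S (.ite a c₁ c₂) σ (t + 1) τ
  | loopDone (a : ℕ) (c : Cmd) (σ : State) (ha : a < M) (h : σ.mem a = 0) :
      Exec M W n S (.loop a c) σ 1 σ
  | loopStep (a : ℕ) (c : Cmd) (σ₁ σ₂ σ₃ : State) (t₁ t₂ : ℕ) (ha : a < M)
      (h : σ₁.mem a ≠ 0) (h₁ : Exec M W n S c σ₁ t₁ σ₂)
      (h₂ : Exec M W n S (.loop a c) σ₂ t₂ σ₃) :
      Exec M W n S (.loop a c) σ₁ (t₁ + t₂ + 1) σ₃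

/-- A two-pass streaming algorithm: one program for each pass. -/
structure TwoPassAlgorithm where
  first : Cmd
  second : Cmd

/-- The initial state of an algorithm that knows the length `n` of the stream, the prime modulus
`p`, and the random number `r`; they stand in the registers `0`, `1`, `2`. -/
def initState (n p r : ℕ) : State where
  mem := fun a => if a = 0 then n else if a = 1 then p else if a = 2 then r else 0
  pos := 0
  out := []

/-- `A.Runs M W n S p r t out₁ out₂`: on the machine with `M` registers for numbers less than `W`,
the algorithm `A` with modulus `p` and random number `r` halts on the stream `S[1..n]` after `t`
steps in total, having reported `out₁` in its first pass and `out₂` in its second pass. Between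
the passes the registers are kept and the stream is rewound. -/
def TwoPassAlgorithm.Runs (A : TwoPassAlgorithm) (M W n : ℕ) (S : ℕ → ℕ) (p r t : ℕ)
    (out₁ out₂ : List (ℕ × ℕ)) : Prop :=
  ∃ (σ₁ σ₂ : State) (t₁ t₂ : ℕ),
    Exec M W n S A.first (initState n p r) t₁ σ₁ ∧
    Exec M W n S A.second { mem := σ₁.mem, pos := 0, out := [] } t₂ σ₂ ∧
    t = t₁ + t₂ ∧ out₁ = σ₁.out ∧ out₂ = σ₂.out

/-! ### What the passes have to report -/

/-- The task of `ApproxSqrt(S, ε)`: for every maximal palindrome `P[m]`, report the midpoint `m`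
together with an estimate `est m` such that `ℓ(m) - ε √n < est m ≤ ℓ(m)`. -/
def IsApproxSqrtReport (n : ℕ) (S : ℕ → ℕ) (ε : ℝ) (out : List (ℕ × ℕ)) : Prop :=
  ∃ est : ℕ → ℕ,
    (∀ m, 1 ≤ m → m ≤ n →
      (palLength n S m : ℝ) - ε * √(n : ℝ) < est m ∧ est m ≤ palLength n S m) ∧
    ∀ m l, (m, l) ∈ out ↔ (1 ≤ m ∧ m ≤ n) ∧ l = est m

/-- The task of `Exact(S)`: report `ℓ_max` together with the midpoint `m`, for exactly those `m`
for which `P[m]` has length `ℓ_max`. -/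
def IsExactReport (n : ℕ) (S : ℕ → ℕ) (out : List (ℕ × ℕ)) : Prop :=
  ∀ m l, (m, l) ∈ out ↔
    (1 ≤ m ∧ m ≤ n) ∧ palLength n S m = maxPalLength n S ∧ l = maxPalLength n S

end StreamPal

namespace StreamPal

/-! ### Combinatorics of palindromes -/

section Palindromes

variable {n : ℕ} {S : ℕ → ℕ}

/-! Cut the stream into blocks of length `s`, about `√n / 2`, and call the multiples of `s`
checkpoints. Fingerprints of prefixes, read in both directions, decide in constant time whether the
string between two positions is a palindrome. They are kept at all checkpoints and, in a cyclic
buffer, for 48 blocks, which costs `O(√n)` registers.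

First pass. A midpoint is tested only for palindromes whose left end is a checkpoint; "alive at
level `i`" means left end `(i - 1) * s`. Aliveness is monotone in the level, so the highest dead
level determines the length up to an error below `s` (`estimate_spec`). The right end moves by `s`
from one level to the next, so the block `j` reaches the level `2 * j + 1 - k` after the block `k`.
The live midpoints are too many to be listed, but those of the block `j` that are alive at the level
`j - 1` form an arithmetic progression (`alive_gap_eq`): three overlapping palindromes compose to a
reflection at the alternating sum of their midpoints, and unequal gaps would thereby create a live
midpoint inside a gap. If the first and the last member are alive at a lower level, so are all
others (`alive_between`). Hence three numbers per block suffice, and only the ends are tested. A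
test deletes a midpoint or helps to finish the stage, so the total time is `O(n + K ^ 2) = O(n)`.

Second pass. The first pass also records in `best i` the longest palindrome found that starts at the
checkpoint `i`, in `E` the maximum of these, and in `L` the exact maximum if that is below `6 * s`.
If `L < 6 * s`, a window of recent blocks contains all relevant left ends, and the midpoints are
reported as their palindromes end. Otherwise every palindrome of length at least `E` starts in a
block with `best i > E - s`. These blocks are sparse: of three such palindromes close to each other,
the middle one can be extended (`HasPalindrome.extend`), which would contradict the bound on all
lengths (`count_window_le`). If only these blocks are buffered, the 48 slots reach back far enough
(`valid_of_le`). The length `L` then starts at `E` and grows in unit steps, because removing the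
outer pair of a palindrome leaves one that ended a position earlier. The same extension argument
keeps the list of midpoints for the current `L` short (`ListOk.cnt_lt`).

Probability. Equality of fingerprints says that the modulus divides the value at `r` of a polynomial
of degree at most `n`. The modulus is `p ^ (a + 1)`, since symbols up to `n ^ a` could collide
modulo `p`. Each of at most `n ^ 2` pairs (midpoint, length) excludes at most `n` values of `r`, so
the error is at most `n ^ 3 / p ≤ 1 / n`.

Machine. The program is written in a small structured language with a verified compiler and verified
by preconditions. As the resource bounds must hold for every `r`, the invariants keep the size and
time bounds apart from the assertions that assume `Good`. -/

theorem HasPalindrome.eq_reflect {m l : ℕ} (h : HasPalindrome n S m l) {u : ℕ}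
    (h₁ : m < u + l) (h₂ : u ≤ m + l) : S u = S (2 * m + 1 - u) := by
  obtain ⟨hl, -, h⟩ := h
  rcases le_or_gt u m with hu | hu
  · have := h (m + 1 - u) (by omega) (by omega)
    rwa [show m - (m + 1 - u) + 1 = u by omega, show m + (m + 1 - u) = 2 * m + 1 - u by omega]
      at this
  · have := h (u - m) (by omega) (by omega)
    rw [show m - (u - m) + 1 = 2 * m + 1 - u by omega, show m + (u - m) = u by omega] at this
    exact this.symm

theorem HasPalindrome.of_reflect {m l : ℕ} (hl : l ≤ m) (hn : m + l ≤ n)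
    (h : ∀ u, m < u + l → u ≤ m → S u = S (2 * m + 1 - u)) : HasPalindrome n S m l := by
  refine ⟨hl, hn, fun i hi hil => ?_⟩
  have := h (m - i + 1) (by omega) (by omega)
  rwa [show 2 * m + 1 - (m - i + 1) = m + i by omega] at this

theorem HasPalindrome.mono {m l l' : ℕ} (h : HasPalindrome n S m l) (hl : l' ≤ l) :
    HasPalindrome n S m l' :=
  ⟨hl.trans h.1, by have := h.2.1; omega, fun i hi hil => h.2.2 i hi (hil.trans hl)⟩

theorem hasPalindrome_zero {m : ℕ} (hm : m ≤ n) : HasPalindrome n S m 0 :=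
  ⟨Nat.zero_le _, by simpa using hm, fun i hi hil => by omega⟩

theorem hasPalindrome_iff_le_palLength {m l : ℕ} (hm : m ≤ n) :
    HasPalindrome n S m l ↔ l ≤ palLength n S m := by
  have hb : BddAbove {l | HasPalindrome n S m l} := ⟨m, fun l h => h.1⟩
  refine ⟨fun h => le_csSup hb h, fun h => ?_⟩
  have : HasPalindrome n S m (palLength n S m) :=
    Nat.sSup_mem (s := {l | HasPalindrome n S m l}) ⟨0, hasPalindrome_zero hm⟩ hb
  exact this.mono h

theorem maxPalLength_eq {Λ m : ℕ} (hm1 : 1 ≤ m) (h : HasPalindrome n S m Λ)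
    (hmax : ∀ m l, HasPalindrome n S m l → l ≤ Λ) : maxPalLength n S = Λ := by
  have hmn : m ≤ n := by have := h.2.1; omega
  apply le_antisymm
  · refine Finset.sup_le fun m' hm' => ?_
    rw [Finset.mem_Icc] at hm'
    exact hmax m' _ ((hasPalindrome_iff_le_palLength hm'.2).2 le_rfl)
  · exact ((hasPalindrome_iff_le_palLength hmn).1 h).trans
      (Finset.le_sup (f := palLength n S) (Finset.mem_Icc.2 ⟨hm1, hmn⟩))

/-- Mirroring the midpoint `z` at the midpoint `y`. -/
theorem HasPalindrome.mirror {c y z : ℕ} (hy : HasPalindrome n S y (y - c))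
    (hz : HasPalindrome n S z (z - c)) (hyz : y < z) (hc : c + (z - y) ≤ y) :
    HasPalindrome n S (y - (z - y)) (y - (z - y) - c) := by
  have := hy.2.1
  refine .of_reflect (by omega) (by omega) fun u h₁ h₂ => ?_
  -- The reflections at `y`, `z`, `y` compose to the reflection at `y - z + y`; all intermediate
  -- positions stay inside the palindromes used.
  rw [hy.eq_reflect (u := u) (by omega) (by omega),
    hy.eq_reflect (u := 2 * (y - (z - y)) + 1 - u) (by omega) (by omega),
    hz.eq_reflect (u := 2 * y + 1 - u) (by omega) (by omega)]
  congr 1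
  omega

/-- Shifting the midpoint `z` down by the distance of two smaller midpoints `x < y`. -/
theorem HasPalindrome.shift {c x y z : ℕ} (hx : HasPalindrome n S x (x - c))
    (hy : HasPalindrome n S y (y - c)) (hz : HasPalindrome n S z (z - c)) (hcx : c ≤ x)
    (hxy : x < y) (hyz : y < z) (hd : z + c ≤ x + y) :
    HasPalindrome n S (z - (y - x)) (z - (y - x) - c) := by
  have := hz.2.1
  refine .of_reflect (by omega) (by omega) fun u h₁ h₂ => ?_
  -- As for mirroring, now with the alternating sum `x - y + z`.
  rw [hz.eq_reflect (u := 2 * (z - (y - x)) + 1 - u) (by omega) (by omega),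
    hx.eq_reflect (u := u) (by omega) (by omega),
    hy.eq_reflect (u := 2 * x + 1 - u) (by omega) (by omega)]
  congr 1
  omega

/-- If all the midpoints of an arithmetic progression have palindromes that begin after `c`, and
the palindromes of the first and the last one even begin after `c'`, then so do all of them. -/
theorem HasPalindrome.between {c c' f d t : ℕ} (hc : c' ≤ c) (hcf : c + d ≤ f)
    (h : ∀ q ≤ t, HasPalindrome n S (f + q * d) (f + q * d - c))
    (h₀ : HasPalindrome n S f (f - c')) (h₁ : HasPalindrome n S (f + t * d) (f + t * d - c'))
    {q : ℕ} (hq : q ≤ t) : HasPalindrome n S (f + q * d) (f + q * d - c') := by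
  rcases Nat.eq_zero_or_pos t with rfl | ht
  · obtain rfl : q = 0 := by omega
    simpa using h₀
  rcases Nat.eq_zero_or_pos d with rfl | hd
  · simpa using h₀
  have hz := h t le_rfl
  have hz' := h (t - 1) (by omega)
  have e₁ : (t - 1) * d + d = t * d := by
    obtain ⟨t, rfl⟩ := Nat.exists_eq_add_of_le' ht
    simp [Nat.add_mul]
  have e₂ : q * d ≤ t * d := Nat.mul_le_mul_right d hq
  set T := t * d with hT
  set T' := (t - 1) * d
  have hn := h₁.2.1
  -- The period `2 * d`. To the right of `c` it is the product of the reflections at the last two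
  -- midpoints. To the left of `c` a shift by `2 * T` moves the question to a larger `u`, whence the
  -- induction on the distance to the right.
  have key : ∀ w u, c + 2 * T - u = w → c' < u → u ≤ c + 2 * T → S u = S (u + 2 * d) := by
    intro w
    induction w using Nat.strong_induction_on with
    | _ w ih =>
      intro u hw hu₁ hu₂
      rcases Nat.lt_or_ge c u with hu | hu
      · rw [hz'.eq_reflect (u := u) (by omega) (by omega),
          hz.eq_reflect (u := 2 * (f + T') + 1 - u) (by omega) (by omega)]
        congr 1
        omega
      -- Only the two outer palindromes reach beyond `c`; their reflections compose to the shift by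
      -- `2 * T`.
      · have a : ∀ v, c' < v → v ≤ c + 2 * d → v ≤ 2 * f - c' → S v = S (v + 2 * T) := by
          intro v hv₁ hv₂ hv₃
          rw [h₀.eq_reflect (u := v) (by omega) (by omega),
            h₁.eq_reflect (u := 2 * f + 1 - v) (by omega) (by omega)]
          congr 1
          omega
        rw [a u hu₁ (by omega) (by omega), a (u + 2 * d) (by omega) (by omega) (by omega),
          ih (c + 2 * T - (u + 2 * T)) (by omega) (u + 2 * T) rfl (by omega) (by omega)]
        congr 1
        omega
  have iter : ∀ e u, c' < u → u ≤ c → e ≤ t → S u = S (u + 2 * (e * d)) := by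
    intro e
    induction e with
    | zero => simp
    | succ e ih =>
      intro u hu₁ hu₂ he
      have : (e + 1) * d ≤ T := Nat.mul_le_mul_right d he
      rw [Nat.add_mul, one_mul] at this ⊢
      rw [ih u hu₁ hu₂ (by omega), key _ (u + 2 * (e * d)) rfl (by omega) (by omega)]
      congr 1
      omega
  refine .of_reflect (by omega) (by omega) fun u hu₁ hu₂ => ?_
  rcases Nat.lt_or_ge c u with hu | hu
  · exact (h q hq).eq_reflect (by omega) (by omega)
  · have e₃ : (t - q) * d + q * d = T := by rw [← Nat.add_mul, Nat.sub_add_cancel hq]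
    -- The last midpoint sends the mirror image of `u` to `u + 2 * (t - q) * d`, which differs from
    -- `u` by a multiple of the period.
    rw [h₁.eq_reflect (u := 2 * (f + q * d) + 1 - u) (by omega) (by omega),
      iter (t - q) u (by omega) hu (by omega)]
    congr 1
    omega

/-- The middle one of three close palindromes is longer than the other two. -/
theorem HasPalindrome.extend {m₁ m₂ m₃ l e : ℕ} (h₁ : HasPalindrome n S m₁ l)
    (h₂ : HasPalindrome n S m₂ l) (h₃ : HasPalindrome n S m₃ l) (he₁ : m₁ + e ≤ m₂)
    (he₂ : m₂ + e ≤ m₃) (hl : m₃ ≤ m₁ + l) : HasPalindrome n S m₂ (l + e) := by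
  have a₁ := h₁.1
  have a₃ := h₃.2.1
  refine .of_reflect (by omega) (by omega) fun v hv₁ hv₂ => ?_
  rcases Nat.lt_or_ge m₂ (v + l) with hv | hv
  · exact h₂.eq_reflect hv (by omega)
  obtain ⟨k, rfl⟩ : ∃ k, v = m₂ + 1 - k := ⟨m₂ + 1 - v, by omega⟩
  -- The position beyond the left end of the middle palindrome is reflected at `m₁`, `m₃`, `m₂`; its
  -- mirror image at `m₂` is reflected at `m₃` and `m₁` (the two reflections at `m₂` in between
  -- cancel). Both arrive at the same position.
  rw [h₁.eq_reflect (u := m₂ + 1 - k) (by omega) (by omega),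
    h₃.eq_reflect (u := 2 * m₁ + 1 - (m₂ + 1 - k)) (by omega) (by omega),
    h₂.eq_reflect (u := 2 * m₃ + 1 - (2 * m₁ + 1 - (m₂ + 1 - k))) (by omega) (by omega),
    h₃.eq_reflect (u := 2 * m₂ + 1 - (m₂ + 1 - k)) (by omega) (by omega),
    h₂.eq_reflect (u := 2 * m₃ + 1 - (2 * m₂ + 1 - (m₂ + 1 - k))) (by omega) (by omega),
    h₂.eq_reflect (u := 2 * m₂ + 1 - (2 * m₃ + 1 - (2 * m₂ + 1 - (m₂ + 1 - k))))
      (by omega) (by omega),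
    h₁.eq_reflect (u := 2 * m₂ + 1 - (2 * m₂ + 1 - (2 * m₃ + 1 - (2 * m₂ + 1 - (m₂ + 1 - k)))))
      (by omega) (by omega)]
  congr 1
  omega

end Palindromes

/-! ### Blocks, levels and estimates -/

/-- The index of the block `((i - 1) * s, i * s]` that contains the position `x`. -/
def blk (s x : ℕ) : ℕ := (x + s - 1) / s

theorem blk_eq_iff {s x i : ℕ} (hs : 1 ≤ s) : blk s x = i ↔ x ≤ i * s ∧ i * s < x + s := by
  unfold blk
  rw [Nat.div_eq_iff (by omega)]
  omega

theorem le_blk_mul {s x : ℕ} (hs : 1 ≤ s) : x ≤ blk s x * s := ((blk_eq_iff hs).1 rfl).1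

theorem blk_mul_lt {s x : ℕ} (hs : 1 ≤ s) : blk s x * s < x + s := ((blk_eq_iff hs).1 rfl).2

theorem blk_le_iff {s x i : ℕ} (hs : 1 ≤ s) : blk s x ≤ i ↔ x ≤ i * s := by
  constructor
  · intro h
    exact (le_blk_mul hs).trans (Nat.mul_le_mul_right s h)
  · intro h
    have := blk_mul_lt (x := x) hs
    by_contra! hlt
    have := Nat.mul_le_mul_right s (show i + 1 ≤ blk s x from hlt)
    rw [Nat.add_mul] at this
    omega

theorem pred_blk_mul_lt {s m : ℕ} (hs : 1 ≤ s) (hm : 1 ≤ m) : (blk s m - 1) * s < m := by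
  rw [Nat.sub_mul, one_mul]
  have := blk_mul_lt (x := m) hs
  omega

section Levels

variable (n : ℕ) (S : ℕ → ℕ) (s : ℕ)

/-- The midpoint `m` is alive at level `i` if there is a palindrome with midpoint `m` whose left
end is the position `(i - 1) * s`. -/
def Alive (i m : ℕ) : Prop := 1 ≤ i ∧ HasPalindrome n S m (m - (i - 1) * s)

open Classical in
/-- The highest level, not above the block of `m`, at which the midpoint `m` is not alive. -/
noncomputable def level (m : ℕ) : ℕ := Nat.findGreatest (fun i => ¬ Alive n S s i m) (blk s m)

/-- The estimate of the length of the longest palindrome with midpoint `m`. -/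
noncomputable def estimate (m : ℕ) : ℕ := m - level n S s m * s

variable {n S s}

theorem Alive.mono {i i' m : ℕ} (h : Alive n S s i m) (hi : i ≤ i') : Alive n S s i' m :=
  ⟨h.1.trans hi, h.2.mono (Nat.sub_le_sub_left (Nat.mul_le_mul_right s (by omega)) m)⟩

theorem level_le (m : ℕ) : level n S s m ≤ blk s m := by
  classical
  exact Nat.findGreatest_le _

/-- True also for the default value of `Nat.findGreatest`: the level `0` is never alive, because
`Alive` includes `1 ≤ i`. -/
theorem not_alive_level (m : ℕ) : ¬ Alive n S s (level n S s m) m := by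
  classical
  exact Nat.findGreatest_spec (P := fun i => ¬ Alive n S s i m) (Nat.zero_le _)
    fun h => absurd h.1 (by omega)

theorem level_lt_iff {i m : ℕ} (hi : i ≤ blk s m) : level n S s m < i ↔ Alive n S s i m := by
  classical
  constructor
  · intro h
    by_contra hna
    have := Nat.le_findGreatest (P := fun i => ¬ Alive n S s i m) hi hna
    unfold level at h
    omega
  · intro h
    by_contra! hle
    exact not_alive_level m (h.mono hle)

/-- The next level above `level` is alive and provides the palindrome; `level` itself is dead, which
excludes palindromes longer by `s`. If even the block of `m` is a dead level, the truncated
difference gives the estimate `0`. -/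
theorem estimate_spec (hs : 1 ≤ s) {m : ℕ} (hm : m ≤ n) :
    HasPalindrome n S m (estimate n S s m) ∧
      ∀ l, HasPalindrome n S m l → l < estimate n S s m + s := by
  have hb := le_blk_mul (x := m) hs
  have hl := level_le (n := n) (S := S) (s := s) m
  unfold estimate
  constructor
  · rcases hl.eq_or_lt with h | h
    · rw [h, Nat.sub_eq_zero_of_le hb]
      exact hasPalindrome_zero hm
    · have := (level_lt_iff (n := n) (S := S) h).1 (Nat.lt_succ_self _)
      simpa using this.2
  · intro l h
    by_contra! hlt
    refine not_alive_level (n := n) (S := S) (s := s) m ⟨?_, h.mono ?_⟩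
    · by_contra h0
      have h0 : level n S s m = 0 := by omega
      rw [h0] at hlt
      have := h.1
      omega
    · rw [Nat.sub_mul, one_mul]
      omega

/-- If the second gap were smaller, the mirror image of `z` at `y` would be alive between `x` and
`y`; if it were larger, `z` shifted down by `y - x` would be alive between `y` and `z`. There is
room for the reflections because the palindromes start a whole block before the block of the
midpoints. -/
theorem alive_gap_eq (hs : 1 ≤ s) {j x y z : ℕ} (hx : Alive n S s (j - 1) x)
    (hy : Alive n S s (j - 1) y) (hz : Alive n S s (j - 1) z) (hjx : (j - 1) * s < x)
    (hxy : x < y) (hyz : y < z) (hzj : z ≤ j * s)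
    (h₁ : ∀ m, x < m → m < y → ¬ Alive n S s (j - 1) m)
    (h₂ : ∀ m, y < m → m < z → ¬ Alive n S s (j - 1) m) : z - y = y - x := by
  have e₁ : (j - 1) * s = j * s - s := by rw [Nat.sub_mul, one_mul]
  have e₂ : (j - 1 - 1) * s = j * s - s - s := by simp [Nat.sub_mul]
  have hj := hx.1
  have e₃ : 2 * s ≤ j * s := Nat.mul_le_mul_right s (by omega)
  rcases lt_trichotomy (z - y) (y - x) with h | h | h
  · exact absurd ⟨hj, hy.2.mirror hz.2 hyz (by omega)⟩ (h₁ (y - (z - y)) (by omega) (by omega))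
  · exact h
  · exact absurd ⟨hj, hx.2.shift hy.2 hz.2 (by omega) hxy hyz (by omega)⟩
      (h₂ (z - (y - x)) (by omega) (by omega))

/-- Survival of the two ends makes testing the interior superfluous: `HasPalindrome.between` for two
neighbouring checkpoints. -/
theorem alive_between {i j f d t : ℕ} (hij : i + 1 < j) (hd : d < s) (hf : (j - 1) * s < f)
    (h : ∀ q ≤ t, Alive n S s (i + 1) (f + q * d)) (h₀ : Alive n S s i f)
    (h₁ : Alive n S s i (f + t * d)) {q : ℕ} (hq : q ≤ t) : Alive n S s i (f + q * d) := by
  have hi := h₀.1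
  have e₁ : (i + 1) * s ≤ (j - 1) * s := Nat.mul_le_mul_right s (by omega)
  have e₂ : (i + 1) * s = i * s + s := by rw [Nat.add_mul, one_mul]
  refine ⟨hi, HasPalindrome.between (c := i * s) (c' := (i - 1) * s)
    (Nat.mul_le_mul_right s (by omega)) (by omega) (fun q hq => ?_) h₀.2 h₁.2 hq⟩
  simpa using (h q hq).2

end Levels

/-! ### Counting blocks that may contain the left end of a longest palindrome -/

section Counting

variable {n : ℕ} {S : ℕ → ℕ} {s : ℕ}

/-- Seven needed blocks in a window contain three at pairwise index distance at least 3. Their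
palindromes of length `ρ` have midpoints more than `2 * s` apart, yet all within `ρ`, so
`HasPalindrome.extend` lengthens the middle one by `2 * s`, contrary to `hmax`. -/
theorem count_window_le {need : ℕ → Prop} [DecidablePred need] {ρ w : ℕ}
    (hneed : ∀ i, need i → ∃ m, HasPalindrome n S m ρ ∧ i * s + ρ ≤ m ∧ m < i * s + ρ + s)
    (hmax : ∀ m, ¬ HasPalindrome n S m (ρ + 2 * s)) (hw : w * s + s ≤ ρ + 1) (i : ℕ) :
    Nat.count need (i + w) ≤ Nat.count need i + 6 := by
  rw [Nat.count_add]
  by_contra! hlt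
  rw [Nat.count_eq_card_filter_range (fun k => need (i + k))] at hlt
  set A := {x ∈ Finset.range w | need (i + x)} with hA
  have hne : A.Nonempty := Finset.card_pos.1 (by omega)
  have h₁ := A.min'_mem hne
  have h₃ := A.max'_mem hne
  obtain ⟨y, hy, hy₁, hy₂⟩ : ∃ y ∈ A, A.min' hne + 3 ≤ y ∧ y + 3 ≤ A.max' hne := by
    -- Otherwise all elements lie among the three smallest or the three largest possible indices.
    by_contra! hcon
    have hsub : A ⊆ Finset.Ico (A.min' hne) (A.min' hne + 3) ∪
        Finset.Ico (A.max' hne + 1 - 3) (A.max' hne + 1) := by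
      intro y hy
      have a := A.min'_le y hy
      have b := A.le_max' y hy
      have c := hcon y hy
      rw [Finset.mem_union, Finset.mem_Ico, Finset.mem_Ico]
      omega
    have := (Finset.card_le_card hsub).trans (Finset.card_union_le _ _)
    rw [Nat.card_Ico, Nat.card_Ico] at this
    omega
  set x := A.min' hne
  set z := A.max' hne
  simp only [hA, Finset.mem_filter, Finset.mem_range] at h₁ h₃ hy
  obtain ⟨m₁, p₁, a₁, b₁⟩ := hneed _ h₁.2
  obtain ⟨m₂, p₂, a₂, b₂⟩ := hneed _ hy.2
  obtain ⟨m₃, p₃, a₃, b₃⟩ := hneed _ h₃.2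
  have e₁ := Nat.mul_le_mul_right s hy₁
  have e₂ := Nat.mul_le_mul_right s hy₂
  have e₃ := Nat.mul_le_mul_right s (show z + 1 ≤ w by omega)
  simp only [Nat.add_mul, one_mul] at e₁ e₂ e₃ a₁ a₂ a₃ b₁ b₂ b₃
  exact hmax m₂ (p₁.extend p₂ p₃ (by omega) (by omega) (by omega))

theorem count_windows_le {need : ℕ → Prop} [DecidablePred need] {w : ℕ}
    (h : ∀ i, Nat.count need (i + w) ≤ Nat.count need i + 6) (u i : ℕ) :
    Nat.count need (i + u * w) ≤ Nat.count need i + 6 * u := by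
  induction u with
  | zero => simp
  | succ u ih =>
    have := h (i + u * w)
    rw [show i + (u + 1) * w = i + u * w + w by ring]
    omega

end Counting

/-! ### Fingerprints -/

section Fingerprints

variable (S : ℕ → ℕ) (r Q : ℕ)

/-- The fingerprint of `S[1..y]` with the last symbol as the constant coefficient. -/
def fpF : ℕ → ℕ
  | 0 => 0
  | y + 1 => (fpF y * r + S (y + 1)) % Q

/-- The powers of the random number. -/
def fpR : ℕ → ℕ
  | 0 => 1
  | y + 1 => fpR y * r % Q

/-- The fingerprint of `S[1..y]` with the first symbol as the constant coefficient. -/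
def fpG : ℕ → ℕ
  | 0 => 0
  | y + 1 => (fpG y + S (y + 1) * fpR r Q y) % Q

/-- The fingerprint test whether `S[x + 1..y]` is a palindrome. -/
def FpMatch (x y : ℕ) : Prop :=
  (fpF S r Q y * fpR r Q x + fpG S r Q x) % Q = (fpF S r Q x * fpR r Q y + fpG S r Q y) % Q

/-- The fingerprint test does not accept any even string that is not a palindrome. -/
def Good (n : ℕ) : Prop :=
  ∀ m l, l ≤ m → m + l ≤ n → FpMatch S r Q (m - l) (m + l) → HasPalindrome n S m l

variable {S r Q}

theorem FpMatch.symm {x y : ℕ} (h : FpMatch S r Q x y) : FpMatch S r Q y x := Eq.symm h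

theorem fpR_cast (y : ℕ) : (fpR r Q y : ZMod Q) = r ^ y := by
  induction y with
  | zero => simp [fpR]
  | succ y ih => simp [fpR, ih, pow_succ]

theorem fpG_cast {x y : ℕ} (h : x ≤ y) : (fpG S r Q y : ZMod Q) =
    fpG S r Q x + ∑ j ∈ Finset.Ico x y, (S (j + 1) : ZMod Q) * r ^ j := by
  induction y, h using Nat.le_induction with
  | base => simp
  | succ y hxy ih =>
    rw [Finset.sum_Ico_succ_top hxy, ← add_assoc, ← ih]
    simp [fpG, fpR_cast]

/-- Multiplying by `r ^ x` replaces the division by a power of `r`, which need not be invertible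
modulo `Q`. -/
theorem fpF_cast {x y : ℕ} (h : x ≤ y) : (fpF S r Q y : ZMod Q) * r ^ x =
    fpF S r Q x * r ^ y + ∑ j ∈ Finset.Ico x y, (S (j + 1) : ZMod Q) * r ^ (x + y - 1 - j) := by
  induction y, h using Nat.le_induction with
  | base => simp
  | succ y hxy ih =>
    have : ∑ j ∈ Finset.Ico x y, (S (j + 1) : ZMod Q) * r ^ (x + (y + 1) - 1 - j) =
        (∑ j ∈ Finset.Ico x y, (S (j + 1) : ZMod Q) * r ^ (x + y - 1 - j)) * r := by
      rw [Finset.sum_mul]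
      refine Finset.sum_congr rfl fun j hj => ?_
      rw [Finset.mem_Ico] at hj
      rw [show x + (y + 1) - 1 - j = x + y - 1 - j + 1 by omega, pow_succ, mul_assoc]
    rw [Finset.sum_Ico_succ_top hxy, this, show x + (y + 1) - 1 - y = x by omega]
    simp only [fpF, ZMod.natCast_mod, Nat.cast_add, Nat.cast_mul]
    linear_combination (r : ZMod Q) * ih

theorem sum_reflect_Ico {M : Type*} [AddCommMonoid M] (f : ℕ → M) (x y : ℕ) :
    ∑ j ∈ Finset.Ico x y, f (x + y - 1 - j) = ∑ j ∈ Finset.Ico x y, f j := by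
  refine Finset.sum_nbij' (fun j => x + y - 1 - j) (fun j => x + y - 1 - j) ?_ ?_ ?_ ?_ ?_ <;>
    intro j hj <;> simp only [Finset.mem_Ico] at hj ⊢ <;> omega

open Polynomial in
/-- The polynomial that vanishes if `S[x + 1..y]` is a palindrome. -/
noncomputable def palPoly (S : ℕ → ℕ) (x y : ℕ) : ℤ[X] :=
  ∑ j ∈ Finset.Ico x y, C ((S (x + y - j) : ℤ) - S (j + 1)) * X ^ j

theorem natDegree_palPoly_le (x y : ℕ) : (palPoly S x y).natDegree ≤ y := by
  refine Polynomial.natDegree_sum_le_of_forall_le _ _ fun j hj => ?_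
  rw [Finset.mem_Ico] at hj
  exact (Polynomial.natDegree_C_mul_X_pow_le _ _).trans hj.2.le

theorem coeff_palPoly {x y j : ℕ} (h₁ : x ≤ j) (h₂ : j < y) :
    (palPoly S x y).coeff j = (S (x + y - j) : ℤ) - S (j + 1) := by
  rw [palPoly, Polynomial.finsetSum_coeff]
  simp only [Polynomial.coeff_C_mul, Polynomial.coeff_X_pow, mul_ite, mul_one, mul_zero]
  rw [Finset.sum_ite_eq, if_pos (Finset.mem_Ico.2 ⟨h₁, h₂⟩)]

/-- The difference of the two sides of the test is the backward reading of `S[x + 1..y]` minus the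
forward reading, both weighted with `r ^ x, …, r ^ (y - 1)`. -/
theorem fpMatch_iff {x y : ℕ} (h : x ≤ y) :
    FpMatch S r Q x y ↔ (Q : ℤ) ∣ (palPoly S x y).eval (r : ℤ) := by
  have e : (((palPoly S x y).eval (r : ℤ) : ℤ) : ZMod Q) =
      ∑ j ∈ Finset.Ico x y, (S (j + 1) : ZMod Q) * r ^ (x + y - 1 - j) -
        ∑ j ∈ Finset.Ico x y, (S (j + 1) : ZMod Q) * r ^ j := by
    rw [← sum_reflect_Ico (fun j => (S (j + 1) : ZMod Q) * r ^ (x + y - 1 - j)),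
      ← Finset.sum_sub_distrib, palPoly, Polynomial.eval_finsetSum, Int.cast_sum]
    refine Finset.sum_congr rfl fun j hj => ?_
    rw [Finset.mem_Ico] at hj
    rw [show x + y - 1 - j + 1 = x + y - j by omega,
      show x + y - 1 - (x + y - 1 - j) = j by omega]
    simp
    ring
  rw [← ZMod.intCast_zmod_eq_zero_iff_dvd, e, FpMatch]
  change Nat.ModEq _ _ _ ↔ _
  rw [← ZMod.natCast_eq_natCast_iff]
  simp only [Nat.cast_add, Nat.cast_mul, fpR_cast, fpF_cast h, fpG_cast h]
  constructor <;> intro h <;> linear_combination h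

/-- The test errs on one side only: a palindrome makes the polynomial zero, whatever `r` and `Q`
are. -/
theorem HasPalindrome.fpMatch {n m l : ℕ} (h : HasPalindrome n S m l) :
    FpMatch S r Q (m - l) (m + l) := by
  have hl := h.1
  rw [fpMatch_iff (by omega), palPoly]
  rw [Finset.sum_eq_zero fun j hj => ?_]
  · simp
  rw [Finset.mem_Ico] at hj
  rw [h.eq_reflect (u := j + 1) (by omega) (by omega),
    show m - l + (m + l) - j = 2 * m + 1 - (j + 1) by omega]
  simp

end Fingerprints

/-! ### The probability that the fingerprints are reliable -/

open Polynomial in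
-- The numbers from `1` to `p` represent each residue class once, and modulo `p` the polynomial is
-- nonzero, so it has at most as many roots as its degree.
theorem card_dvd_eval_le_of_not_dvd {p : ℕ} [Fact p.Prime] {d : ℕ} (P : ℤ[X])
    (hd : P.natDegree ≤ d) (hP : ∃ k, ¬ (p : ℤ) ∣ P.coeff k) :
    ((Finset.Icc 1 p).filter fun r : ℕ => (p : ℤ) ∣ P.eval (r : ℤ)).card ≤ d := by
  classical
  set P' : (ZMod p)[X] := P.map (Int.castRingHom (ZMod p)) with hP'
  have hne : P' ≠ 0 := by
    obtain ⟨k, hk⟩ := hP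
    intro h
    have := congrArg (fun R => R.coeff k) h
    simp only [hP', coeff_map, coeff_zero, eq_intCast] at this
    exact hk ((ZMod.intCast_zmod_eq_zero_iff_dvd _ _).1 this)
  calc _ ≤ P'.roots.toFinset.card := by
        refine Finset.card_le_card_of_injOn (fun r => (r : ZMod p)) ?_ ?_
        · intro r hr
          simp only [Finset.coe_filter, Set.mem_ofPred_eq] at hr
          simp only [Finset.mem_coe, Multiset.mem_toFinset, mem_roots hne, IsRoot.def]
          have := (ZMod.intCast_zmod_eq_zero_iff_dvd _ p).2 hr.2
          rw [hP', ← this, eval_map]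
          simpa using eval₂_at_apply (p := P) (Int.castRingHom (ZMod p)) (r : ℤ)
        · intro r hr r' hr' h
          simp only [Finset.coe_filter, Set.mem_ofPred_eq, Finset.mem_Icc] at hr hr'
          have h := (ZMod.natCast_eq_natCast_iff' _ _ _).1 h
          -- The value `p` represents the class of `0`, hence the separate cases.
          rcases hr.1.2.eq_or_lt with h₁ | h₁ <;> rcases hr'.1.2.eq_or_lt with h₂ | h₂
          · omega
          · rw [h₁, Nat.mod_self, Nat.mod_eq_of_lt h₂] at h
            omega
          · rw [h₂, Nat.mod_self, Nat.mod_eq_of_lt h₁] at h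
            omega
          · rwa [Nat.mod_eq_of_lt h₁, Nat.mod_eq_of_lt h₂] at h
    _ ≤ _ := (Multiset.toFinset_card_le _).trans
        ((P'.card_roots').trans (natDegree_map_le.trans hd))

open Polynomial in
-- Modulo a prime power a polynomial may have many roots, but only `r` up to `p` is sampled. Either
-- some coefficient survives modulo `p` and the field case applies, or a factor `p` can be cancelled
-- from the polynomial and from the modulus.
theorem card_dvd_eval_le {p : ℕ} (hp : p.Prime) {d : ℕ} (a : ℕ) (P : ℤ[X]) (hd : P.natDegree ≤ d)
    (hP : ∃ k, ¬ (p ^ (a + 1) : ℤ) ∣ P.coeff k) :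
    ((Finset.Icc 1 p).filter fun r : ℕ => (p ^ (a + 1) : ℤ) ∣ P.eval (r : ℤ)).card ≤ d := by
  have : Fact p.Prime := ⟨hp⟩
  have hp0 : (p : ℤ) ≠ 0 := by exact_mod_cast hp.ne_zero
  induction a generalizing P with
  | zero =>
    obtain ⟨k, hk⟩ := hP
    simpa using card_dvd_eval_le_of_not_dvd P hd ⟨k, by simpa using hk⟩
  | succ a ih =>
    by_cases h : ∃ k, ¬ (p : ℤ) ∣ P.coeff k
    · refine (Finset.card_le_card fun r hr => ?_).trans (card_dvd_eval_le_of_not_dvd P hd h)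
      rw [Finset.mem_filter] at hr ⊢
      refine ⟨hr.1, (dvd_pow_self _ (by omega)).trans hr.2⟩
    · push Not at h
      obtain ⟨P, rfl⟩ := (C_dvd_iff_dvd_coeff _ _).2 h
      rw [natDegree_C_mul hp0] at hd
      obtain ⟨k, hk⟩ := hP
      refine le_of_eq_of_le ?_ (ih P hd ⟨k, fun hk' => hk ?_⟩)
      · congr 1
        refine Finset.filter_congr fun r _ => ?_
        rw [eval_mul, eval_C, pow_succ' _ (a + 1)]
        exact mul_dvd_mul_iff_left hp0
      · rw [coeff_C_mul, pow_succ']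
        exact mul_dvd_mul_left _ hk'

/-- The fingerprints are reliable with high probability. -/
theorem one_sub_le_uniformOn_good {n p a : ℕ} {S : ℕ → ℕ} (hn : 1 ≤ n) (hp : p.Prime)
    (hnp : n ^ 4 ≤ p) (hS : ∀ i, 1 ≤ i → i ≤ n → 1 ≤ S i ∧ S i ≤ n ^ a)
    {A : Set ℕ} (hA : ∀ r, 1 ≤ r → r ≤ p → Good S r (p ^ (a + 1)) n → r ∈ A) :
    1 - 1 / (n : ℝ) ≤ (ProbabilityTheory.uniformOn (Set.Icc 1 p)).real A := by
  classical
  have hna : n ^ a < p ^ (a + 1) :=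
    (Nat.pow_le_pow_left ((Nat.le_self_pow (by norm_num) n).trans hnp) a).trans_lt
      (Nat.pow_lt_pow_right hp.one_lt (Nat.lt_succ_self a))
  set Q := p ^ (a + 1) with hQ
  set I := Finset.Icc 1 n ×ˢ Finset.Icc 1 n
  let bad (ml : ℕ × ℕ) : Finset ℕ := (Finset.Icc 1 p).filter fun r =>
    (ml.2 ≤ ml.1 ∧ ml.1 + ml.2 ≤ n ∧ ¬ HasPalindrome n S ml.1 ml.2) ∧
      FpMatch S r Q (ml.1 - ml.2) (ml.1 + ml.2)
  have hbad : ∀ ml, (bad ml).card ≤ n := by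
    rintro ⟨m, l⟩
    by_cases h : l ≤ m ∧ m + l ≤ n ∧ ¬ HasPalindrome n S m l
    · obtain ⟨h₁, h₂, h₃⟩ := h
      -- A difference of two symbols is smaller than `Q` in absolute value, so divisibility by `Q`
      -- forces equality; if that held for all coefficients, the string would be a palindrome.
      have hk : ∃ k, ¬ (p ^ (a + 1) : ℤ) ∣ (palPoly S (m - l) (m + l)).coeff k := by
        by_contra! hcon
        refine h₃ (.of_reflect h₁ h₂ fun u hu₁ hu₂ => ?_)
        have := hcon (u - 1)
        rw [coeff_palPoly (by omega) (by omega), show u - 1 + 1 = u by omega,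
          show m - l + (m + l) - (u - 1) = 2 * m + 1 - u by omega] at this
        have b₁ := hS u (by omega) (by omega)
        have b₂ := hS (2 * m + 1 - u) (by omega) (by omega)
        have := Int.eq_zero_of_abs_lt_dvd this (by
          have : (p ^ (a + 1) : ℤ) = (Q : ℤ) := by simp [hQ]
          rw [this, abs_lt]
          omega)
        omega
      refine le_trans ?_ (card_dvd_eval_le hp a _ ((natDegree_palPoly_le _ _).trans h₂) hk)
      refine Finset.card_le_card fun r hr => ?_
      rw [Finset.mem_filter] at hr ⊢
      have := (fpMatch_iff (by omega)).1 hr.2.2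
      exact ⟨hr.1, by simpa [hQ] using this⟩
    · have : bad (m, l) = ∅ := Finset.filter_eq_empty_iff.2 fun r _ hr => h hr.1
      simp [this]
  have hsub : (Finset.Icc 1 p) \ (Finset.Icc 1 p).filter (fun r => Good S r Q n) ⊆
      I.biUnion bad := by
    intro r hr
    rw [Finset.mem_sdiff, Finset.mem_filter] at hr
    obtain ⟨hr₁, hr₂⟩ := hr
    have hg : ¬ Good S r Q n := fun h => hr₂ ⟨hr₁, h⟩
    unfold Good at hg
    push Not at hg
    obtain ⟨m, l, h₁, h₂, h₃, h₄⟩ := hg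
    have hl : 1 ≤ l := by
      by_contra h
      obtain rfl : l = 0 := by omega
      exact h₄ (hasPalindrome_zero (by omega))
    rw [Finset.mem_biUnion]
    refine ⟨(m, l), ?_, Finset.mem_filter.2 ⟨hr₁, ⟨h₁, h₂, h₄⟩, h₃⟩⟩
    simp only [I, Finset.mem_product, Finset.mem_Icc]
    omega
  -- Union bound: `n ^ 2` pairs of midpoint and length, with at most `n` bad `r` each.
  have hcard : p ≤ ((Finset.Icc 1 p).filter (fun r => Good S r Q n)).card + n ^ 3 := by
    have h₁ := (Finset.card_le_card hsub).trans
      (Finset.card_biUnion_le_card_mul _ _ n fun ml _ => hbad ml)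
    have h₂ := Finset.card_sdiff_add_card_eq_card
      (Finset.filter_subset (fun r => Good S r Q n) (Finset.Icc 1 p))
    simp only [I, Finset.card_product, Nat.card_Icc, Nat.add_sub_cancel] at h₁ h₂
    rw [show n ^ 3 = n * n * n by ring]
    omega
  set G := (Finset.Icc 1 p).filter (fun r => Good S r Q n)
  have hGA : (G : Set ℕ) ⊆ A := fun r hr => by
    rw [Finset.mem_coe, Finset.mem_filter, Finset.mem_Icc] at hr
    exact hA r hr.1.1 hr.1.2 hr.2
  have hprob : MeasureTheory.IsProbabilityMeasure (ProbabilityTheory.uniformOn (Set.Icc 1 p)) :=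
    ProbabilityTheory.isProbabilityMeasure_uniformOn (Set.finite_Icc 1 p)
      ⟨1, le_rfl, hp.one_lt.le⟩
  refine le_trans ?_ (MeasureTheory.measureReal_mono hGA)
  rw [MeasureTheory.measureReal_def, ← Finset.coe_Icc, ProbabilityTheory.uniformOn_apply_finset,
    Finset.inter_eq_right.2 (Finset.filter_subset _ _)]
  simp only [Nat.card_Icc, Nat.add_sub_cancel, ENNReal.toReal_div, ENNReal.toReal_natCast]
  have hn0 : (0 : ℝ) < n := by exact_mod_cast hn
  have hp0 : (0 : ℝ) < p := by exact_mod_cast hp.pos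
  have h₁ : (p : ℝ) ≤ G.card + n ^ 3 := by exact_mod_cast hcard
  have h₂ : (n : ℝ) ^ 4 ≤ p := by exact_mod_cast hnp
  rw [le_div_iff₀ hp0, sub_mul, one_mul]
  have h₃ : (n : ℝ) ^ 3 ≤ 1 / n * p := by
    rw [div_mul_eq_mul_div, one_mul, le_div_iff₀ hn0]
    linarith [pow_succ (n : ℝ) 3]
  linarith

/-! ### A small structured language on top of the machine -/

/-- The scalar variables; the first three hold the input. -/
inductive Var where
  | n | p | r | s | Q | K | y | F | G | R | c | L | lim | E | rank | small | cnt | k | t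
  | x | b | sl | o | f₁ | g₁ | r₁ | f₂ | g₂ | r₂ | res
  | j | ip | m | e | bst | af | ad | ac | go
  deriving DecidableEq

/-- The array variables. -/
inductive Arr where
  | chkF | chkG | chkR | bufF | bufG | bufR | slot | best | afst | adif | acnt | list
  deriving DecidableEq

/-- The states of the structured language. -/
structure St where
  (n p r s Q K y F G R c L lim E rank small cnt k t : ℕ)
  (x b sl o f₁ g₁ r₁ f₂ g₂ r₂ res : ℕ)
  (j ip m e bst af ad ac go : ℕ)
  (chkF chkG chkR bufF bufG bufR slot best afst adif acnt list : ℕ → ℕ)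
  pos : ℕ
  out : List (ℕ × ℕ)
  /-- an upper bound on the number of steps, in units of 100 -/
  time : ℕ

namespace St

def get (σ : St) : Var → ℕ
  | .n => σ.n | .p => σ.p | .r => σ.r | .s => σ.s | .Q => σ.Q | .K => σ.K | .y => σ.y
  | .F => σ.F | .G => σ.G | .R => σ.R | .c => σ.c | .L => σ.L | .lim => σ.lim | .E => σ.E
  | .rank => σ.rank | .small => σ.small | .cnt => σ.cnt | .k => σ.k | .t => σ.t
  | .x => σ.x | .b => σ.b | .sl => σ.sl | .o => σ.o | .f₁ => σ.f₁ | .g₁ => σ.g₁ | .r₁ => σ.r₁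
  | .f₂ => σ.f₂ | .g₂ => σ.g₂ | .r₂ => σ.r₂ | .res => σ.res
  | .j => σ.j | .ip => σ.ip | .m => σ.m | .e => σ.e | .bst => σ.bst | .af => σ.af | .ad => σ.ad
  | .ac => σ.ac | .go => σ.go

def set (σ : St) (v : Var) (w : ℕ) : St := match v with
  | .n => { σ with n := w } | .p => { σ with p := w } | .r => { σ with r := w }
  | .s => { σ with s := w } | .Q => { σ with Q := w } | .K => { σ with K := w }
  | .y => { σ with y := w } | .F => { σ with F := w } | .G => { σ with G := w }
  | .R => { σ with R := w } | .c => { σ with c := w } | .L => { σ with L := w }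
  | .lim => { σ with lim := w } | .E => { σ with E := w } | .rank => { σ with rank := w }
  | .small => { σ with small := w } | .cnt => { σ with cnt := w } | .k => { σ with k := w }
  | .t => { σ with t := w } | .x => { σ with x := w } | .b => { σ with b := w }
  | .sl => { σ with sl := w } | .o => { σ with o := w } | .f₁ => { σ with f₁ := w }
  | .g₁ => { σ with g₁ := w } | .r₁ => { σ with r₁ := w } | .f₂ => { σ with f₂ := w }
  | .g₂ => { σ with g₂ := w } | .r₂ => { σ with r₂ := w } | .res => { σ with res := w }
  | .j => { σ with j := w } | .ip => { σ with ip := w } | .m => { σ with m := w }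
  | .e => { σ with e := w } | .bst => { σ with bst := w } | .af => { σ with af := w }
  | .ad => { σ with ad := w } | .ac => { σ with ac := w } | .go => { σ with go := w }

def geta (σ : St) : Arr → ℕ → ℕ
  | .chkF => σ.chkF | .chkG => σ.chkG | .chkR => σ.chkR
  | .bufF => σ.bufF | .bufG => σ.bufG | .bufR => σ.bufR
  | .slot => σ.slot | .best => σ.best | .afst => σ.afst | .adif => σ.adif | .acnt => σ.acnt
  | .list => σ.list

def seta (σ : St) (f : Arr) (i w : ℕ) : St := match f with
  | .chkF => { σ with chkF := Function.update σ.chkF i w }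
  | .chkG => { σ with chkG := Function.update σ.chkG i w }
  | .chkR => { σ with chkR := Function.update σ.chkR i w }
  | .bufF => { σ with bufF := Function.update σ.bufF i w }
  | .bufG => { σ with bufG := Function.update σ.bufG i w }
  | .bufR => { σ with bufR := Function.update σ.bufR i w }
  | .slot => { σ with slot := Function.update σ.slot i w }
  | .best => { σ with best := Function.update σ.best i w }
  | .afst => { σ with afst := Function.update σ.afst i w }
  | .adif => { σ with adif := Function.update σ.adif i w }
  | .acnt => { σ with acnt := Function.update σ.acnt i w }
  | .list => { σ with list := Function.update σ.list i w }

def tick (σ : St) : St := { σ with time := σ.time + 1 }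

theorem get_set (σ : St) (v v' : Var) (w : ℕ) :
    (σ.set v w).get v' = if v' = v then w else σ.get v' := by
  cases v <;> cases v' <;> rfl

theorem geta_set (σ : St) (v : Var) (w : ℕ) (f : Arr) : (σ.set v w).geta f = σ.geta f := by
  cases v <;> cases f <;> rfl

theorem get_seta (σ : St) (f : Arr) (i w : ℕ) (v : Var) : (σ.seta f i w).get v = σ.get v := by
  cases f <;> cases v <;> rfl

theorem geta_seta (σ : St) (f f' : Arr) (i i' w : ℕ) :
    (σ.seta f i w).geta f' i' = if f' = f ∧ i' = i then w else σ.geta f' i' := by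
  cases f <;> cases f' <;> simp [seta, geta, Function.update_apply]

theorem pos_set (σ : St) (v : Var) (w : ℕ) : (σ.set v w).pos = σ.pos := by cases v <;> rfl
theorem out_set (σ : St) (v : Var) (w : ℕ) : (σ.set v w).out = σ.out := by cases v <;> rfl
theorem time_set (σ : St) (v : Var) (w : ℕ) : (σ.set v w).time = σ.time := by cases v <;> rfl
theorem pos_seta (σ : St) (f : Arr) (i w : ℕ) : (σ.seta f i w).pos = σ.pos := by cases f <;> rfl
theorem out_seta (σ : St) (f : Arr) (i w : ℕ) : (σ.seta f i w).out = σ.out := by cases f <;> rfl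
theorem time_seta (σ : St) (f : Arr) (i w : ℕ) : (σ.seta f i w).time = σ.time := by
  cases f <;> rfl

end St

/-- The register of a scalar variable. -/
def Var.reg (v : Var) : ℕ := v.ctorIdx

theorem Var.reg_lt (v : Var) : v.reg < 48 := by cases v <;> decide

theorem Var.reg_inj {v v' : Var} (h : v.reg = v'.reg) : v = v' := by
  cases v <;> cases v' <;> first | rfl | exact absurd h (by decide)

/-- The offset of an array variable. -/
def Arr.off (f : Arr) : ℕ := f.ctorIdx

theorem Arr.off_lt (f : Arr) : f.off < 16 := by cases f <;> decide

theorem Arr.off_inj {f f' : Arr} (h : f.off = f'.off) : f = f' := by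
  cases f <;> cases f' <;> first | rfl | exact absurd h (by decide)

/-- Expressions without array accesses. -/
inductive Expr where
  | lit (k : ℕ)
  | var (v : Var)
  | bin (o : BinOp) (a b : Expr)

namespace Expr

instance : Add Expr := ⟨.bin .add⟩
instance : Sub Expr := ⟨.bin .sub⟩
instance : Mul Expr := ⟨.bin .mul⟩
instance : Div Expr := ⟨.bin .div⟩
instance : Mod Expr := ⟨.bin .mod⟩
instance (k : ℕ) : OfNat Expr k := ⟨.lit k⟩

def lt (a b : Expr) : Expr := .bin .lt a b
def eq (a b : Expr) : Expr := .bin .eq a b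

def eval (σ : St) : Expr → ℕ
  | lit k => k
  | var v => σ.get v
  | bin o a b => o.eval (a.eval σ) (b.eval σ)

theorem eval_rules :
    (∀ σ (a b : Expr), (a + b).eval σ = a.eval σ + b.eval σ) ∧
    (∀ σ (a b : Expr), (a - b).eval σ = a.eval σ - b.eval σ) ∧
    (∀ σ (a b : Expr), (a * b).eval σ = a.eval σ * b.eval σ) ∧
    (∀ σ (a b : Expr), (a / b).eval σ = a.eval σ / b.eval σ) ∧
    (∀ σ (a b : Expr), (a % b).eval σ = a.eval σ % b.eval σ) ∧
    (∀ σ a b, (lt a b).eval σ = if a.eval σ < b.eval σ then 1 else 0) ∧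
    (∀ σ a b, (eq a b).eval σ = if a.eval σ = b.eval σ then 1 else 0) ∧
    (∀ σ v, (var v).eval σ = σ.get v) ∧
    (∀ σ k, (lit k).eval σ = k) ∧
    ∀ σ (k : ℕ), (no_index (OfNat.ofNat k) : Expr).eval σ = k :=
  ⟨fun _ _ _ => rfl, fun _ _ _ => rfl, fun _ _ _ => rfl, fun _ _ _ => rfl, fun _ _ _ => rfl,
    fun _ _ _ => rfl, fun _ _ _ => rfl, fun _ _ => rfl, fun _ _ => rfl, fun _ _ => rfl⟩

/-- The number of leaves. -/
def leaves : Expr → ℕ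
  | lit _ => 1
  | var _ => 1
  | bin _ a b => a.leaves + b.leaves

/-- The number of temporary registers needed. -/
def temps : Expr → ℕ
  | lit _ => 1
  | var _ => 1
  | bin _ a b => max a.temps (b.temps + 1)

/-- An expression is admissible if it is small and has small literals only. -/
def Lits : Expr → Bool
  | lit k => k ≤ 100
  | var _ => true
  | bin _ a b => a.Lits && b.Lits

def Ok (e : Expr) : Bool := e.leaves ≤ 12 && e.temps ≤ 10 && e.Lits

/-- Compilation of an expression; the value is put into the temporary register `48 + d`. -/
def comp : Expr → ℕ → Cmd
  | lit k, d => .const (48 + d) k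
  | var v, d => .seq (.const (48 + d) 0) (.op .add (48 + d) v.reg (48 + d))
  | bin o a b, d => .seq (a.comp d) (.seq (b.comp (d + 1)) (.op o (48 + d) (48 + d) (49 + d)))

end Expr

/-- Statements. -/
inductive Stmt where
  | skip
  | assign (v : Var) (e : Expr)
  | aget (v : Var) (f : Arr) (i : Expr)
  | aset (f : Arr) (i e : Expr)
  | read (v : Var)
  | report (e₁ e₂ : Expr)
  | seq (a b : Stmt)
  | ite (e : Expr) (a b : Stmt)
  | loop (e : Expr) (a : Stmt)

/-- `R[48 + d] :=` the address of the array element with the index `R[48 + d]`. -/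
def addrCmd (f : Arr) (d : ℕ) : Cmd :=
  .seq (.const (49 + d) 16) (.seq (.op .mul (48 + d) (48 + d) (49 + d))
    (.seq (.const (49 + d) (64 + f.off)) (.op .add (48 + d) (48 + d) (49 + d))))

/-- `v := R[48]`. -/
def moveCmd (v : Var) : Cmd := .seq (.const 49 0) (.op .add v.reg 48 49)

def Stmt.comp : Stmt → Cmd
  | skip => .skip
  | assign v e => .seq (e.comp 0) (moveCmd v)
  | aget v f i => .seq (i.comp 0) (.seq (addrCmd f 0) (.seq (.load 48 48) (moveCmd v)))
  | aset f i e => .seq (i.comp 0) (.seq (addrCmd f 0) (.seq (e.comp 1) (.store 48 49)))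
  | read v => .read v.reg
  | report e₁ e₂ => .seq (e₁.comp 0) (.seq (e₂.comp 1) (.report 48 49))
  | seq a b => .seq a.comp b.comp
  | ite e a b => .seq (e.comp 0) (.ite 48 a.comp b.comp)
  | loop e a => .seq (e.comp 0) (.loop 48 (.seq a.comp (e.comp 0)))

/-- All expressions in the statement are admissible. -/
def Stmt.Ok : Stmt → Bool
  | skip => true
  | assign _ e => e.Ok
  | aget _ _ i => i.Ok
  | aset _ i e => i.Ok && e.Ok
  | read _ => true
  | report e₁ e₂ => e₁.Ok && e₂.Ok
  | seq a b => a.Ok && b.Ok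
  | ite e a b => e.Ok && a.Ok && b.Ok
  | loop e a => e.Ok && a.Ok

/-- The bounds that an execution respects: `n` is the length of the stream `S`, all variables and
array elements are less than `X`, and all array indices are less than `N`. -/
structure Env where
  n : ℕ
  X : ℕ
  N : ℕ
  S : ℕ → ℕ

/-- The machine state `μ` represents the state `σ`. -/
structure Sim (V : Env) (μ : State) (σ : St) : Prop where
  var : ∀ v : Var, μ.mem v.reg = σ.get v
  arr : ∀ (f : Arr) (i : ℕ), i < V.N → μ.mem (64 + 16 * i + f.off) = σ.geta f i
  var_lt : ∀ v : Var, σ.get v < V.X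
  arr_lt : ∀ (f : Arr) (i : ℕ), i < V.N → σ.geta f i < V.X
  pos : μ.pos = σ.pos
  out : μ.out = σ.out

/-- A machine that is large enough. -/
structure Fits (V : Env) (M W : ℕ) : Prop where
  mem : 64 + 16 * V.N ≤ M
  addr : 64 + 16 * V.N ≤ W
  hundred : 100 < V.X
  word : V.X ^ 12 ≤ W

/-- The statement `s`, started in `σ`, halts in a state that satisfies `P`. -/
def Run (V : Env) (s : Stmt) (σ : St) (P : St → Prop) : Prop :=
  s.Ok → ∀ M W, Fits V M W → ∀ μ, Sim V μ σ → ∃ t μ' σ', Exec M W V.n V.S s.comp μ t μ' ∧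
    Sim V μ' σ' ∧ t + 100 * σ.time ≤ 100 * σ'.time ∧ P σ'

theorem Expr.leaves_pos (e : Expr) : 0 < e.leaves := by
  induction e <;> simp only [leaves] <;> omega

/-- Each leaf is below `X`, and a product of bounds, one per leaf, dominates every operation. This
explains the word size `X ^ 12` for expressions with at most 12 leaves. -/
theorem Expr.eval_lt_pow {V : Env} {σ : St} (hX : 100 < V.X) (hσ : ∀ v, σ.get v < V.X)
    (e : Expr) (he : e.Lits) : e.eval σ < V.X ^ e.leaves := by
  induction e with
  | lit k =>
    simp only [Lits, decide_eq_true_eq] at he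
    simp only [eval, leaves, pow_one]
    omega
  | var v => simp [eval, leaves, hσ v]
  | bin o a b iha ihb =>
    simp only [Lits, Bool.and_eq_true] at he
    have ha := iha he.1
    have hb := ihb he.2
    simp only [eval, leaves, pow_add]
    have h₁ : 1 < V.X ^ a.leaves := Nat.one_lt_pow a.leaves_pos.ne' (by omega)
    have h₂ : 1 < V.X ^ b.leaves := Nat.one_lt_pow b.leaves_pos.ne' (by omega)
    generalize V.X ^ a.leaves = A at *
    generalize V.X ^ b.leaves = B at *
    generalize a.eval σ = u at *
    generalize b.eval σ = v at *
    have hAB : A ≤ A * B := Nat.le_mul_of_pos_right _ (by omega)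
    cases o <;> simp only [BinOp.eval]
    · nlinarith
    · omega
    · exact Nat.mul_lt_mul'' ha hb
    · exact (Nat.div_le_self _ _).trans_lt (by omega)
    · exact (Nat.mod_le _ _).trans_lt (by omega)
    · split_ifs <;> omega
    · split_ifs <;> omega

/-- `μ'` agrees with `μ` except on temporary registers from `48 + d` on. -/
structure TempEq (d : ℕ) (μ μ' : State) : Prop where
  mem : ∀ a, a < 48 + d ∨ 64 ≤ a → μ'.mem a = μ.mem a
  pos : μ'.pos = μ.pos
  out : μ'.out = μ.out

theorem TempEq.trans {d : ℕ} {μ₁ μ₂ μ₃ : State} (h : TempEq d μ₁ μ₂) (h' : TempEq d μ₂ μ₃) :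
    TempEq d μ₁ μ₃ :=
  ⟨fun a ha => (h'.mem a ha).trans (h.mem a ha), h'.pos.trans h.pos, h'.out.trans h.out⟩

theorem TempEq.mono {d d' : ℕ} {μ μ' : State} (h : TempEq d' μ μ') (hd : d ≤ d') :
    TempEq d μ μ' :=
  ⟨fun a ha => h.mem a (by omega), h.pos, h.out⟩

theorem TempEq.write {d a v : ℕ} {μ : State} (h₁ : 48 + d ≤ a) (h₂ : a < 64) :
    TempEq d μ (μ.write a v) :=
  ⟨fun b hb => Function.update_of_ne (by omega) _ _, rfl, rfl⟩

theorem Sim.tempEq {V : Env} {μ μ' : State} {σ : St} (h : Sim V μ σ) (h' : TempEq 0 μ μ') :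
    Sim V μ' σ where
  var v := (h'.mem _ (.inl (by have := v.reg_lt; omega))).trans (h.var v)
  arr f i hi := (h'.mem _ (.inr (by omega))).trans (h.arr f i hi)
  var_lt := h.var_lt
  arr_lt := h.arr_lt
  pos := h'.pos.trans h.pos
  out := h'.out.trans h.out

theorem Sim.write_var {V : Env} {μ : State} {σ : St} (h : Sim V μ σ) (v : Var) {w : ℕ}
    (hw : w < V.X) : Sim V (μ.write v.reg w) (σ.set v w) where
  var v' := by
    rw [St.get_set]
    split_ifs with hv
    · subst hv
      exact Function.update_self ..
    · exact (Function.update_of_ne (fun h => hv (Var.reg_inj h)) _ _).trans (h.var v')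
  arr f i hi := by
    rw [St.geta_set]
    exact (Function.update_of_ne (by have := v.reg_lt; omega) _ _).trans (h.arr f i hi)
  var_lt v' := by
    rw [St.get_set]
    split_ifs
    exacts [hw, h.var_lt v']
  arr_lt f i hi := by
    rw [St.geta_set]
    exact h.arr_lt f i hi
  pos := by
    rw [St.pos_set]
    exact h.pos
  out := by
    rw [St.out_set]
    exact h.out

theorem Sim.write_arr {V : Env} {μ : State} {σ : St} (h : Sim V μ σ) (f : Arr) {i w : ℕ}
    (hw : w < V.X) : Sim V (μ.write (64 + 16 * i + f.off) w) (σ.seta f i w) where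
  var v := by
    rw [St.get_seta]
    exact (Function.update_of_ne (by have := v.reg_lt; omega) _ _).trans (h.var v)
  arr f' i' hi' := by
    rw [St.geta_seta]
    have := f.off_lt
    have := f'.off_lt
    split_ifs with hf
    · obtain ⟨rfl, rfl⟩ := hf
      exact Function.update_self ..
    · refine (Function.update_of_ne (fun h => hf ⟨Arr.off_inj ?_, ?_⟩) _ _).trans
        (h.arr f' i' hi') <;> omega
  var_lt v := by
    rw [St.get_seta]
    exact h.var_lt v
  arr_lt f' i' hi' := by
    rw [St.geta_seta]
    split_ifs
    exacts [hw, h.arr_lt f' i' hi']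
  pos := by
    rw [St.pos_seta]
    exact h.pos
  out := by
    rw [St.out_seta]
    exact h.out

section Compile

variable {V : Env} {M W : ℕ}

/-- A leaf costs at most two steps (a variable is copied by adding it to zero) and an operation one,
hence the bound. The second operand is evaluated one temporary register higher, so that it leaves
the first one intact. -/
theorem exec_comp_expr (hF : Fits V M W) {σ : St} (e : Expr) :
    ∀ (d : ℕ) (μ : State), Sim V μ σ → e.Lits → e.leaves ≤ 12 → d + e.temps ≤ 16 →
      ∃ t μ', Exec M W V.n V.S (e.comp d) μ t μ' ∧ t + 1 ≤ 3 * e.leaves ∧ TempEq d μ μ' ∧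
        μ'.mem (48 + d) = e.eval σ := by
  have hM := hF.mem
  have hX := hF.hundred
  have hXW : V.X ≤ W := (Nat.le_self_pow (by norm_num) _).trans hF.word
  induction e with
  | lit k =>
    intro d μ hμ hl _ hd
    simp only [Expr.Lits, decide_eq_true_eq, Expr.temps] at hl hd
    exact ⟨1, _, .const μ _ _ (by omega) (by omega), by simp [Expr.leaves],
      .write (by omega) (by omega), Function.update_self ..⟩
  | var v =>
    intro d μ hμ hl _ hd
    simp only [Expr.temps] at hd
    have hv := v.reg_lt
    have e₁ : (μ.write (48 + d) 0).mem v.reg = σ.get v :=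
      (Function.update_of_ne (by omega) _ _).trans (hμ.var v)
    have e₂ : (μ.write (48 + d) 0).mem (48 + d) = 0 := Function.update_self ..
    have e₃ : BinOp.add.eval ((μ.write (48 + d) 0).mem v.reg)
        ((μ.write (48 + d) 0).mem (48 + d)) = σ.get v := by rw [e₁, e₂]; rfl
    have := hμ.var_lt v
    refine ⟨1 + 1, _, .seq _ _ _ _ _ _ _ (.const μ _ _ (by omega) (by omega))
      (.op _ _ _ _ _ (by omega) (by omega) (by omega) (by omega)), by simp [Expr.leaves],
      (TempEq.write (by omega) (by omega)).trans (.write (by omega) (by omega)), ?_⟩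
    exact (Function.update_self ..).trans e₃
  | bin o a b iha ihb =>
    intro d μ hμ hl hs hd
    have hval := Expr.eval_lt_pow hX hμ.var_lt _ hl
    have hval := hval.trans_le ((Nat.pow_le_pow_right (by omega) hs).trans hF.word)
    simp only [Expr.Lits, Bool.and_eq_true, Expr.leaves, Expr.temps] at hl hs hd
    have := a.leaves_pos
    have := b.leaves_pos
    obtain ⟨t₁, μ₁, x₁, c₁, q₁, v₁⟩ := iha d μ hμ hl.1 (by omega) (by omega)
    obtain ⟨t₂, μ₂, x₂, c₂, q₂, v₂⟩ := ihb (d + 1) μ₁ (hμ.tempEq (q₁.mono (by omega))) hl.2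
      (by omega) (by omega)
    have e₁ : μ₂.mem (48 + d) = a.eval σ := (q₂.mem _ (.inl (by omega))).trans v₁
    have e₂ : μ₂.mem (49 + d) = b.eval σ := by rw [← v₂]; congr 1; omega
    have e₃ : o.eval (μ₂.mem (48 + d)) (μ₂.mem (49 + d)) = (Expr.bin o a b).eval σ := by
      rw [e₁, e₂]; rfl
    have : b.temps ≠ 0 := by
      cases b <;> simp [Expr.temps]
    refine ⟨t₁ + (t₂ + 1), _, .seq _ _ _ _ _ _ _ x₁ (.seq _ _ _ _ _ _ _ x₂
      (.op _ _ _ _ _ (by omega) (by omega) (by omega) (by omega))),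
      by simp only [Expr.leaves]; omega,
      q₁.trans ((q₂.mono (by omega)).trans (.write (by omega) (by omega))), ?_⟩
    exact (Function.update_self ..).trans e₃

theorem exec_comp (hF : Fits V M W) {σ : St} {e : Expr} (he : e.Ok) {d : ℕ} (hd : d ≤ 1)
    {μ : State} (hμ : Sim V μ σ) : ∃ t μ', Exec M W V.n V.S (e.comp d) μ t μ' ∧ t ≤ 35 ∧
      TempEq d μ μ' ∧ μ'.mem (48 + d) = e.eval σ := by
  simp only [Expr.Ok, Bool.and_eq_true, decide_eq_true_eq] at he
  obtain ⟨t, μ', h₁, h₂, h₃⟩ := exec_comp_expr hF e d μ hμ he.2 he.1.1 (by omega)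
  exact ⟨t, μ', h₁, by omega, h₃⟩

theorem exec_addrCmd (hF : Fits V M W) (f : Arr) {μ : State} {i : ℕ} (hi : i < V.N)
    (hμ : μ.mem 48 = i) : ∃ μ', Exec M W V.n V.S (addrCmd f 0) μ 4 μ' ∧ TempEq 0 μ μ' ∧
      μ'.mem 48 = 64 + 16 * i + f.off := by
  have hM := hF.mem
  have hX := hF.addr
  have hf := f.off_lt
  refine ⟨_, .seq _ _ _ _ _ _ _ (.const μ _ _ (by omega) (by omega)) (.seq _ _ _ _ _ _ _
    (.op _ _ _ _ _ (by omega) (by omega) (by omega) ?_) (.seq _ _ _ _ _ _ _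
    (.const _ _ _ (by omega) (by omega)) (.op _ _ _ _ _ (by omega) (by omega) (by omega) ?_))),
    ?_, ?_⟩
  · simp [State.write, BinOp.eval, hμ]
    omega
  · simp [State.write, BinOp.eval, hμ]
    omega
  · refine .trans (.write ?_ ?_) (.trans (.write ?_ ?_) (.trans (.write ?_ ?_) (.write ?_ ?_))) <;>
      omega
  · simp [State.write, BinOp.eval, hμ]
    omega

theorem exec_moveCmd (hF : Fits V M W) {μ : State} {σ : St} (hμ : Sim V μ σ) (v : Var)
    (hv : μ.mem 48 < V.X) :
    ∃ μ', Exec M W V.n V.S (moveCmd v) μ 2 μ' ∧ Sim V μ' (σ.set v (μ.mem 48)) := by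
  have hM := hF.mem
  have hX := hF.addr
  have hr := v.reg_lt
  have hXW : V.X ≤ W := (Nat.le_self_pow (by norm_num) _).trans hF.word
  have e : BinOp.add.eval ((μ.write 49 0).mem 48) ((μ.write 49 0).mem 49) = μ.mem 48 := by
    simp [State.write, BinOp.eval]
  refine ⟨_, .seq _ _ _ _ _ _ _ (.const μ _ _ (by omega) (by omega))
    (.op _ _ _ _ _ (by omega) (by omega) (by omega) (by omega)), ?_⟩
  rw [e]
  exact (hμ.tempEq (.write (by omega) (by omega))).write_var v hv

end Compile

/-! ### Rules for the structured language -/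

section Rules

variable {V : Env} {σ : St} {P : St → Prop}

theorem Sim.tick {V : Env} {μ : State} {σ : St} (h : Sim V μ σ) : Sim V μ σ.tick where
  var v := (h.var v).trans (by cases v <;> rfl)
  arr f i hi := (h.arr f i hi).trans (by cases f <;> rfl)
  var_lt v := lt_of_eq_of_lt (by cases v <;> rfl) (h.var_lt v)
  arr_lt f i hi := lt_of_eq_of_lt (by cases f <;> rfl) (h.arr_lt f i hi)
  pos := h.pos
  out := h.out

theorem Run.skip (h : P σ.tick) : Run V .skip σ P := fun _ M W _ μ hμ =>
  ⟨1, μ, _, .skip μ, hμ.tick, by simp only [St.tick]; omega, h⟩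

theorem Run.assign {v : Var} {e : Expr} (h : e.eval σ < V.X)
    (hP : P (σ.set v (e.eval σ)).tick) : Run V (.assign v e) σ P := by
  intro he M W hF μ hμ
  obtain ⟨t, μ₁, x₁, c₁, q₁, v₁⟩ := exec_comp hF he (d := 0) (by omega) hμ
  obtain ⟨μ₂, x₂, s₂⟩ := exec_moveCmd hF (hμ.tempEq q₁) v (v₁ ▸ h)
  rw [v₁] at s₂
  exact ⟨t + 2, μ₂, _, .seq _ _ _ _ _ _ _ x₁ x₂, s₂.tick,
    by simp only [St.tick, St.time_set]; omega, hP⟩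

theorem Run.aget {v : Var} {f : Arr} {i : Expr} (h : i.eval σ < V.N)
    (hP : P (σ.set v (σ.geta f (i.eval σ))).tick) : Run V (.aget v f i) σ P := by
  intro he M W hF μ hμ
  have hf := f.off_lt
  have hM := hF.mem
  have hXW : V.X ≤ W := (Nat.le_self_pow (by norm_num) _).trans hF.word
  obtain ⟨t, μ₁, x₁, c₁, q₁, v₁⟩ := exec_comp hF he (d := 0) (by omega) hμ
  obtain ⟨μ₂, x₂, q₂, v₂⟩ := exec_addrCmd hF f h v₁
  have s₂ := hμ.tempEq (q₁.trans q₂)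
  have v₃ : μ₂.mem (μ₂.mem 48) = σ.geta f (i.eval σ) := by
    rw [v₂]
    exact s₂.arr f _ h
  have hlt := s₂.arr_lt f _ h
  have e : (μ₂.write 48 (μ₂.mem (μ₂.mem 48))).mem 48 = σ.geta f (i.eval σ) := by
    simp only [State.write, Function.update_self, v₃]
  obtain ⟨μ₄, x₄, s₄⟩ := exec_moveCmd hF
    (s₂.tempEq (.write (a := 48) (v := μ₂.mem (μ₂.mem 48)) (by omega) (by omega))) v
    (e ▸ hlt)
  rw [e] at s₄
  exact ⟨t + (4 + (1 + 2)), μ₄, _, .seq _ _ _ _ _ _ _ x₁ (.seq _ _ _ _ _ _ _ x₂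
    (.seq _ _ _ _ _ _ _ (.load μ₂ _ _ (by omega) (by omega) (by omega) (by omega)) x₄)),
    s₄.tick, by simp only [St.tick, St.time_set]; omega, hP⟩

theorem Run.aset {f : Arr} {i e : Expr} (hi : i.eval σ < V.N) (h : e.eval σ < V.X)
    (hP : P (σ.seta f (i.eval σ) (e.eval σ)).tick) : Run V (.aset f i e) σ P := by
  intro he M W hF μ hμ
  simp only [Stmt.Ok, Bool.and_eq_true] at he
  have hf := f.off_lt
  have hM := hF.mem
  have hXW : V.X ≤ W := (Nat.le_self_pow (by norm_num) _).trans hF.word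
  obtain ⟨t, μ₁, x₁, c₁, q₁, v₁⟩ := exec_comp hF he.1 (d := 0) (by omega) hμ
  obtain ⟨μ₂, x₂, q₂, v₂⟩ := exec_addrCmd hF f hi v₁
  have s₂ := hμ.tempEq (q₁.trans q₂)
  obtain ⟨t₃, μ₃, x₃, c₃, q₃, v₃⟩ := exec_comp hF he.2 (d := 1) (by omega) s₂
  have e₁ : μ₃.mem 48 = 64 + 16 * i.eval σ + f.off := (q₃.mem _ (.inl (by omega))).trans v₂
  have s₃ := (s₂.tempEq (q₃.mono (by omega))).write_arr f (i := i.eval σ) h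
  rw [← e₁, ← v₃] at s₃
  rw [v₃] at s₃
  refine ⟨t + (4 + (t₃ + 1)), _, _, .seq _ _ _ _ _ _ _ x₁ (.seq _ _ _ _ _ _ _ x₂
    (.seq _ _ _ _ _ _ _ x₃ (.store μ₃ 48 49 (by omega) (by omega) (by omega) ?_))),
    ?_, ?_, hP⟩
  · have : μ₃.mem 49 = _ := v₃
    omega
  · have : μ₃.mem 49 = _ := v₃
    rw [this]
    exact s₃.tick
  · simp only [St.tick, St.time_seta]
    omega

theorem Run.read {v : Var} (hpos : σ.pos < V.n) (h : V.S (σ.pos + 1) < V.X)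
    (hP : P { (σ.set v (V.S (σ.pos + 1))).tick with pos := σ.pos + 1 }) :
    Run V (.read v) σ P := by
  intro _ M W hF μ hμ
  have hr := v.reg_lt
  have hM := hF.mem
  have hXW : V.X ≤ W := (Nat.le_self_pow (by norm_num) _).trans hF.word
  have s := (hμ.write_var v h).tick
  rw [← hμ.pos] at s h hpos
  refine ⟨1, _, _, .read μ v.reg (by omega) hpos (by omega), ?_, ?_, hP⟩
  · rw [← hμ.pos]
    exact ⟨fun v' => (s.var v').trans (by cases v' <;> rfl),
      fun f i hi => (s.arr f i hi).trans (by cases f <;> rfl),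
      fun v' => lt_of_eq_of_lt (by cases v' <;> rfl) (s.var_lt v'),
      fun f i hi => lt_of_eq_of_lt (by cases f <;> rfl) (s.arr_lt f i hi), rfl, s.out⟩
  · simp only [St.tick, St.time_set]
    omega

theorem Run.report {e₁ e₂ : Expr}
    (hP : P { σ.tick with out := σ.out ++ [(e₁.eval σ, e₂.eval σ)] }) :
    Run V (.report e₁ e₂) σ P := by
  intro he M W hF μ hμ
  simp only [Stmt.Ok, Bool.and_eq_true] at he
  have hM := hF.mem
  obtain ⟨t, μ₁, x₁, c₁, q₁, v₁⟩ := exec_comp hF he.1 (d := 0) (by omega) hμ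
  have s₁ := hμ.tempEq q₁
  obtain ⟨t₂, μ₂, x₂, c₂, q₂, v₂⟩ := exec_comp hF he.2 (d := 1) (by omega) s₁
  have s₂ := (s₁.tempEq (q₂.mono (by omega))).tick
  have e₃ : μ₂.mem 48 = e₁.eval σ := (q₂.mem _ (.inl (by omega))).trans v₁
  have e₄ : μ₂.mem 49 = e₂.eval σ := v₂
  refine ⟨t + (t₂ + 1), _, _, .seq _ _ _ _ _ _ _ x₁ (.seq _ _ _ _ _ _ _ x₂
    (.report μ₂ 48 49 (by omega) (by omega))), ?_, ?_, hP⟩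
  · rw [e₃, e₄, s₂.out]
    exact ⟨fun v' => (s₂.var v').trans (by cases v' <;> rfl),
      fun f i hi => (s₂.arr f i hi).trans (by cases f <;> rfl),
      fun v' => lt_of_eq_of_lt (by cases v' <;> rfl) (s₂.var_lt v'),
      fun f i hi => lt_of_eq_of_lt (by cases f <;> rfl) (s₂.arr_lt f i hi), s₂.pos, rfl⟩
  · simp only [St.tick]
    omega

theorem Run.seq {a b : Stmt} (h : Run V a σ fun τ => Run V b τ P) : Run V (.seq a b) σ P := by
  intro he M W hF μ hμ
  simp only [Stmt.Ok, Bool.and_eq_true] at he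
  obtain ⟨t₁, μ₁, σ₁, x₁, s₁, c₁, h₁⟩ := h he.1 M W hF μ hμ
  obtain ⟨t₂, μ₂, σ₂, x₂, s₂, c₂, h₂⟩ := h₁ he.2 M W hF μ₁ s₁
  exact ⟨t₁ + t₂, μ₂, σ₂, .seq _ _ _ _ _ _ _ x₁ x₂, s₂, by omega, h₂⟩

theorem Run.ite {e : Expr} {a b : Stmt} (h₁ : e.eval σ ≠ 0 → Run V a σ.tick P)
    (h₂ : e.eval σ = 0 → Run V b σ.tick P) : Run V (.ite e a b) σ P := by
  intro he M W hF μ hμ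
  simp only [Stmt.Ok, Bool.and_eq_true] at he
  have hM := hF.mem
  obtain ⟨t, μ₁, x₁, c₁, q₁, v₁⟩ := exec_comp hF he.1.1 (d := 0) (by omega) hμ
  have s₁ := (hμ.tempEq q₁).tick
  have v₁ : μ₁.mem 48 = e.eval σ := v₁
  by_cases h : e.eval σ = 0
  · obtain ⟨t₂, μ₂, σ₂, x₂, s₂, c₂, p₂⟩ := h₂ h he.2 M W hF μ₁ s₁
    refine ⟨t + (t₂ + 1), μ₂, σ₂, .seq _ _ _ _ _ _ _ x₁
      (.iteFalse _ _ _ _ _ _ (by omega) (by omega) x₂), s₂, ?_, p₂⟩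
    simp only [St.tick] at c₂
    omega
  · obtain ⟨t₂, μ₂, σ₂, x₂, s₂, c₂, p₂⟩ := h₁ h he.1.2 M W hF μ₁ s₁
    refine ⟨t + (t₂ + 1), μ₂, σ₂, .seq _ _ _ _ _ _ _ x₁
      (.iteTrue _ _ _ _ _ _ (by omega) (by omega) x₂), s₂, ?_, p₂⟩
    simp only [St.tick] at c₂
    omega

/-- The rule for loops, with the invariant `I` and the termination measure `f`. -/
theorem Run.loop {e : Expr} {a : Stmt} (I : St → Prop) (f : St → ℕ)
    (h : ∀ τ, I τ → e.eval τ ≠ 0 → Run V a τ.tick fun τ' => I τ' ∧ f τ' < f τ) (h₀ : I σ)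
    (hP : ∀ τ, I τ → e.eval τ = 0 → P τ.tick) : Run V (.loop e a) σ P := by
  intro he M W hF μ hμ
  simp only [Stmt.Ok, Bool.and_eq_true] at he
  have hM := hF.mem
  -- The 65 steps in hand, together with the at most 35 of one evaluation of the condition, make up
  -- one unit of time.
  have key : ∀ w τ μ, f τ = w → I τ → Sim V μ τ → μ.mem 48 = e.eval τ →
      ∃ t μ' σ', Exec M W V.n V.S (.loop 48 (.seq a.comp (e.comp 0))) μ t μ' ∧ Sim V μ' σ' ∧
        t + 65 + 100 * τ.time ≤ 100 * σ'.time ∧ P σ' := by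
    intro w
    induction w using Nat.strong_induction_on with
    | _ w ih =>
      intro τ μ hw hI hμ hv
      by_cases hz : e.eval τ = 0
      · refine ⟨1, μ, _, .loopDone _ _ _ (by omega) (by omega), hμ.tick, ?_, hP τ hI hz⟩
        simp only [St.tick]
        omega
      · obtain ⟨t₁, μ₁, τ₁, x₁, s₁, c₁, hI₁, hf₁⟩ := h τ hI hz he.2 M W hF μ hμ.tick
        obtain ⟨t₂, μ₂, x₂, c₂, q₂, v₂⟩ := exec_comp hF he.1 (d := 0) (by omega) s₁
        obtain ⟨t₃, μ₃, τ₃, x₃, s₃, c₃, p₃⟩ := ih _ (by omega) τ₁ μ₂ rfl hI₁ (s₁.tempEq q₂) v₂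
        refine ⟨t₁ + t₂ + t₃ + 1, μ₃, τ₃, .loopStep _ _ _ _ _ _ _ (by omega) (by omega)
          (.seq _ _ _ _ _ _ _ x₁ x₂) x₃, s₃, ?_, p₃⟩
        simp only [St.tick] at c₁
        omega
  obtain ⟨t₁, μ₁, x₁, c₁, q₁, v₁⟩ := exec_comp hF he.1 (d := 0) (by omega) hμ
  obtain ⟨t₂, μ₂, τ₂, x₂, s₂, c₂, p₂⟩ := key _ σ μ₁ rfl h₀ (hμ.tempEq q₁) v₁
  exact ⟨t₁ + t₂, μ₂, τ₂, .seq _ _ _ _ _ _ _ x₁ x₂, s₂, by omega, p₂⟩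

theorem Run.mono {a : Stmt} {P' : St → Prop} (h : Run V a σ P) (hP : ∀ τ, P τ → P' τ) :
    Run V a σ P' := by
  intro he M W hF μ hμ
  obtain ⟨t₁, μ₁, σ₁, x₁, s₁, c₁, h₁⟩ := h he M W hF μ hμ
  exact ⟨t₁, μ₁, σ₁, x₁, s₁, c₁, hP _ h₁⟩

/-- A precondition of `s` for the postcondition `P`. -/
def wp (V : Env) : Stmt → (St → Prop) → St → Prop
  | .skip, P, σ => P σ.tick
  | .assign v e, P, σ => e.eval σ < V.X ∧ P (σ.set v (e.eval σ)).tick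
  | .aget v f i, P, σ => i.eval σ < V.N ∧ P (σ.set v (σ.geta f (i.eval σ))).tick
  | .aset f i e, P, σ => i.eval σ < V.N ∧ e.eval σ < V.X ∧
      P (σ.seta f (i.eval σ) (e.eval σ)).tick
  | .read v, P, σ => σ.pos < V.n ∧ V.S (σ.pos + 1) < V.X ∧
      P { (σ.set v (V.S (σ.pos + 1))).tick with pos := σ.pos + 1 }
  | .report e₁ e₂, P, σ => P { σ.tick with out := σ.out ++ [(e₁.eval σ, e₂.eval σ)] }
  | .seq a b, P, σ => wp V a (wp V b P) σ
  | .ite e a b, P, σ => (e.eval σ ≠ 0 → wp V a P σ.tick) ∧ (e.eval σ = 0 → wp V b P σ.tick)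
  | .loop e a, P, σ => Run V (.loop e a) σ P

theorem Run.of_wp {a : Stmt} (h : wp V a P σ) : Run V a σ P := by
  induction a generalizing σ P with
  | skip => exact .skip h
  | assign v e => exact .assign h.1 h.2
  | aget v f i => exact .aget h.1 h.2
  | aset f i e => exact .aset h.1 h.2.1 h.2.2
  | read v => exact .read h.1 h.2.1 h.2.2
  | report e₁ e₂ => exact .report h
  | seq a b iha ihb => exact .seq ((iha h).mono fun _ => ihb)
  | ite e a b iha ihb => exact .ite (fun hc => iha (h.1 hc)) fun hc => ihb (h.2 hc)
  | loop e a _ => exact h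

theorem wp_mono {a : Stmt} {P' : St → Prop} (h : wp V a P σ) (hP : ∀ τ, P τ → P' τ) :
    wp V a P' σ := by
  induction a generalizing σ P P' with
  | skip => exact hP _ h
  | assign v e => exact ⟨h.1, hP _ h.2⟩
  | aget v f i => exact ⟨h.1, hP _ h.2⟩
  | aset f i e => exact ⟨h.1, h.2.1, hP _ h.2.2⟩
  | read v => exact ⟨h.1, h.2.1, hP _ h.2.2⟩
  | report e₁ e₂ => exact hP _ h
  | seq a b iha ihb => exact iha h fun _ h' => ihb h' hP
  | ite e a b iha ihb => exact ⟨fun hc => iha (h.1 hc) hP, fun hc => ihb (h.2 hc) hP⟩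
  | loop e a _ => exact Run.mono h hP

theorem wp_loop {e : Expr} {a : Stmt} (I : St → Prop) (f : St → ℕ)
    (h : ∀ τ, I τ → e.eval τ ≠ 0 → wp V a (fun τ' => I τ' ∧ f τ' < f τ) τ.tick) (h₀ : I σ)
    (hP : ∀ τ, I τ → e.eval τ = 0 → P τ.tick) : wp V (.loop e a) P σ :=
  Run.loop I f (fun τ hI hz => .of_wp (h τ hI hz)) h₀ hP

end Rules

/-! ### The program -/

prefix:max "§" => Expr.var
infix:30 " ≔ " => Stmt.assign
infixr:20 " ;; " => Stmt.seq

/-- Compare the fingerprints `(f₁, g₁, r₁)` and `(f₂, g₂, r₂)`. -/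
def cmpFp : Stmt :=
  .res ≔ ((§.f₂ * §.r₁ + §.g₁) % §.Q).eq ((§.f₁ * §.r₂ + §.g₂) % §.Q)

/-- `(f₂, g₂, r₂) :=` the fingerprint at the current position. -/
def loadCur : Stmt := .f₂ ≔ §.F ;; .g₂ ≔ §.G ;; .r₂ ≔ §.R

/-- Compare the fingerprint at the position `x`, if it is buffered, with `(f₂, g₂, r₂)`. -/
def bufTest : Stmt :=
  .b ≔ (§.x + §.s - 1) / §.s ;;
  .aget .sl .slot §.b ;;
  .ite (§.sl * (§.rank).lt (§.sl + 48))
    (.o ≔ §.sl % 48 * §.s + (§.x + §.s - 1) % §.s ;;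
      .aget .f₁ .bufF §.o ;; .aget .g₁ .bufG §.o ;; .aget .r₁ .bufR §.o ;; cmpFp)
    (.res ≔ 0)

/-- Buffer the fingerprint at the current position, unless the current block is not needed. -/
def storeBuf : Stmt :=
  .aget .sl .slot §.k ;;
  .ite §.sl
    (.o ≔ §.sl % 48 * §.s + (§.y + §.s - 1) % §.s ;;
      .aset .bufF §.o §.F ;; .aset .bufG §.o §.G ;; .aset .bufR §.o §.R)
    .skip

/-- Increase `L` if a palindrome of length `L + 1` ends at the current position. -/
def grow : Stmt :=
  .ite ((§.L).lt §.lim * (2 * §.L + 1).lt §.y)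
    (.x ≔ §.y - (2 * §.L + 2) ;; loadCur ;; bufTest)
    (.res ≔ 0) ;;
  .ite §.res (.L ≔ §.L + 1 ;; .cnt ≔ 0) .skip

/-- Read the next symbol. -/
def readStep : Stmt :=
  .y ≔ §.y + 1 ;; .read .c ;;
  .F ≔ (§.F * §.r + §.c) % §.Q ;; .G ≔ (§.G + §.c * §.R) % §.Q ;; .R ≔ §.R * §.r % §.Q ;;
  storeBuf ;; grow

/-- Decide whether the current block is needed. -/
def beginBlock : Stmt :=
  .aget .bst .best §.k ;;
  .ite (§.small + (§.E).lt (§.bst + §.s))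
    (.rank ≔ §.rank + 1 ;; .aset .slot §.k §.rank)
    (.aset .slot §.k 0)

/-- Read the current block. -/
def scanBlock (tail : Stmt) : Stmt :=
  .t ≔ §.s ;;
  .loop §.t (.t ≔ §.t - 1 ;; .ite ((§.y).lt §.n) (readStep ;; tail) .skip)

def initScan : Stmt :=
  .y ≔ 0 ;; .F ≔ 0 ;; .G ≔ 0 ;; .R ≔ 1 ;; .k ≔ 0 ;; .rank ≔ 0 ;; beginBlock ;; storeBuf

/-- Store the fingerprint at a checkpoint. -/
def storeChk : Stmt :=
  .aset .chkF §.k §.F ;; .aset .chkG §.k §.G ;; .aset .chkR §.k §.R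

/-- Take into account that `m` is alive at the level `ip`. -/
def touch : Stmt :=
  .e ≔ §.m - (§.ip - 1) * §.s ;; .aget .bst .best (§.ip - 1) ;;
  .ite ((§.bst).lt §.e) (.aset .best (§.ip - 1) §.e) .skip ;;
  .ite ((§.E).lt §.e) (.E ≔ §.e) .skip

/-- Test whether `m` is alive at the level `ip`. -/
def aliveTest : Stmt :=
  .res ≔ 0 ;;
  .ite §.ip
    (.x ≔ 2 * §.m - (§.ip - 1) * §.s ;;
      .ite ((§.x).lt (§.n + 1))
        (.aget .f₂ .chkF (§.ip - 1) ;; .aget .g₂ .chkG (§.ip - 1) ;;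
          .aget .r₂ .chkR (§.ip - 1) ;; bufTest ;; .ite §.res touch .skip)
        .skip)
    .skip

/-- Report a midpoint that is not alive any more. -/
def die : Stmt := .report §.m (§.m - §.ip * §.s)

/-- Append `m` to the arithmetic progression `af, af + ad, …, af + (ac - 1) * ad`. -/
def append : Stmt :=
  .ite ((§.ac).eq 1) (.ad ≔ §.m - §.af) .skip ;; .ite §.ac .skip (.af ≔ §.m) ;; .ac ≔ §.ac + 1

/-- Find the midpoints in the block `k - 2` that are alive at the level `k - 3`. -/
def startBlock : Stmt :=
  .j ≔ §.k - 2 ;; .ac ≔ 0 ;; .af ≔ 0 ;; .ad ≔ 0 ;; .m ≔ (§.j - 1) * §.s ;; .t ≔ §.s ;;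
  .loop §.t (.t ≔ §.t - 1 ;; .m ≔ §.m + 1 ;;
    .ite ((§.m).lt (§.n + 1))
      (.ip ≔ §.j ;; aliveTest ;; .ite §.res (.ip ≔ §.j - 1 ;; aliveTest) .skip ;;
        .ite §.res append die)
      .skip) ;;
  .aset .afst §.j §.af ;; .aset .adif §.j §.ad ;; .aset .acnt §.j §.ac

/-- Remove the midpoints that are not alive at the level `ip` from the progression of the block
`j`. -/
def prune : Stmt :=
  .aget .af .afst §.j ;; .aget .ad .adif §.j ;; .aget .ac .acnt §.j ;; .go ≔ 1 ;;
  .loop §.go (.ite §.ac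
    (.m ≔ §.af + (§.ac - 1) * §.ad ;; aliveTest ;;
      .ite §.res
        (.ite ((§.ac).eq 1) (.go ≔ 0)
          (.m ≔ §.af ;; aliveTest ;;
            .ite §.res (.go ≔ 0) (die ;; .af ≔ §.af + §.ad ;; .ac ≔ §.ac - 1)))
        (die ;; .ac ≔ §.ac - 1))
    (.go ≔ 0)) ;;
  .aset .afst §.j §.af ;; .aset .acnt §.j §.ac

/-- Process the midpoints for which a palindrome may end in the current block. -/
def processBlock : Stmt :=
  .ite (Expr.lt 2 §.k)
    (startBlock ;; .j ≔ 1 ;;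
      .loop ((§.j + 2).lt §.k)
        (.ite ((§.k).lt (2 * §.j + 2)) (.ip ≔ 2 * §.j + 1 - §.k ;; prune) .skip ;;
          .j ≔ §.j + 1))
    .skip

def powStmt : ℕ → Stmt
  | 0 => .Q ≔ §.p
  | a + 1 => powStmt a ;; .Q ≔ §.Q * §.p

def setup (a : ℕ) : Stmt :=
  .t ≔ 0 ;; .loop (((§.t + 1) * (§.t + 1)).lt (§.n + 1)) (.t ≔ §.t + 1) ;;
  .s ≔ (§.t + 1) / 2 ;; .K ≔ §.n / §.s + 3 ;; powStmt a

def firstPass (a : ℕ) : Stmt :=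
  setup a ;; .lim ≔ 6 * §.s ;; .small ≔ 1 ;; initScan ;; storeChk ;;
  .loop ((§.k).lt §.K)
    (.k ≔ §.k + 1 ;; beginBlock ;; scanBlock .skip ;; storeChk ;; processBlock)

/-- Report or record the midpoint of a palindrome of length `L` that ends at the current
position. -/
def collect : Stmt :=
  .ite ((2 * §.L).lt (§.y + 1)) (.x ≔ §.y - 2 * §.L ;; loadCur ;; bufTest) (.res ≔ 0) ;;
  .ite §.res
    (.ite §.small (.report (§.y - §.L) §.L)
      (.ite ((§.cnt).lt (48 * §.s))
        (.aset .list §.cnt (§.y - §.L) ;; .cnt ≔ §.cnt + 1) .skip))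
    .skip

def secondPass : Stmt :=
  .small ≔ (§.L).lt (6 * §.s) ;; .ite §.small .skip (.L ≔ §.E) ;; .lim ≔ §.n ;; .cnt ≔ 0 ;;
  initScan ;;
  .loop ((§.k).lt §.K) (.k ≔ §.k + 1 ;; beginBlock ;; scanBlock collect) ;;
  .t ≔ 0 ;;
  .loop ((§.t).lt §.cnt) (.aget .m .list §.t ;; .report §.m §.L ;; .t ≔ §.t + 1)

theorem firstPass_ok (a : ℕ) : (firstPass a).Ok := by
  have h : (powStmt a).Ok := by
    induction a with
    | zero => decide
    | succ a ih => exact (Bool.and_eq_true _ _).mpr ⟨ih, by decide⟩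
  simp only [firstPass, setup, Stmt.Ok, h]
  decide

theorem secondPass_ok : secondPass.Ok := by decide

/-! ### Specifications of the parts of the program -/

/-- The parameters of an execution: the stream `S` of length `n`, the random number `r`, the
modulus `Q`, the block size `s`, and the bound `X` for the contents of the registers. -/
structure Ctx where
  (n r Q s X : ℕ)
  S : ℕ → ℕ

namespace Ctx

/-- The number of blocks. -/
def K (C : Ctx) : ℕ := C.n / C.s + 3

def env (C : Ctx) : Env := ⟨C.n, C.X, 48 * C.s, C.S⟩

/-- The bound `n_le` expresses `s ≥ √n / 2`. The slack in `X_ge` covers all arithmetic on positions,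
also for the meaningless progressions that may arise when fingerprints collide. -/
structure Ok (C : Ctx) : Prop where
  s_pos : 1 ≤ C.s
  s_le : C.s ≤ C.n
  n_le : C.n ≤ 4 * (C.s * C.s) + 4 * C.s
  Q_gt : 1 < C.Q
  Q_le : C.Q ≤ C.X
  X_ge : 1000 * (C.n * C.n) + 1000 ≤ C.X
  sym : ∀ i, 1 ≤ i → i ≤ C.n → C.S i < C.X

variable {C : Ctx}

theorem Ok.n_le_mul (h : C.Ok) : C.n ≤ C.n * C.n :=
  Nat.le_mul_of_pos_left _ (h.s_pos.trans h.s_le)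

theorem Ok.K_le (h : C.Ok) : C.K ≤ 4 * C.s + 7 := by
  have : C.n / C.s ≤ 4 * C.s + 4 := by
    refine Nat.div_le_of_le_mul ?_
    have := h.n_le
    linarith
  unfold K
  omega

theorem K_mul_le : C.K * C.s ≤ C.n + 3 * C.s := by
  have := Nat.div_mul_le_self C.n C.s
  rw [K, Nat.add_mul]
  omega

/-- The first `K - 2` blocks already cover the stream. The two further rounds are there because
candidates are first tested two blocks late. -/
theorem Ok.lt_K_mul (h : C.Ok) : C.n < (C.K - 2) * C.s :=
  Nat.lt_mul_of_div_lt (by unfold K; omega) h.s_pos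

theorem Ok.blk_le (h : C.Ok) {x : ℕ} (hx : x ≤ C.n) : blk C.s x + 2 ≤ C.K := by
  have := (blk_le_iff (x := x) (i := C.K - 2) h.s_pos).2 (hx.trans h.lt_K_mul.le)
  have : 3 ≤ C.K := Nat.le_add_left _ _
  omega

/-- The variables that are constant after the initialization. -/
def Const (C : Ctx) (n r Q s K : ℕ) : Prop := n = C.n ∧ r = C.r ∧ Q = C.Q ∧ s = C.s ∧ K = C.K

/-- The left end `x` is in a needed block that has not been overwritten after `κ` blocks. -/
def Valid (C : Ctx) (need : ℕ → Prop) [DecidablePred need] (κ x : ℕ) : Prop :=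
  need (blk C.s x) ∧ Nat.count need κ < Nat.count need (blk C.s x + 1) + 48

/-- The buffer index of the position `x` in the block with the given slot. -/
def bufIdx (C : Ctx) (sl x : ℕ) : ℕ := sl % 48 * C.s + (x + C.s - 1) % C.s

abbrev fF (C : Ctx) : ℕ → ℕ := fpF C.S C.r C.Q
abbrev fG (C : Ctx) : ℕ → ℕ := fpG C.S C.r C.Q
abbrev fR (C : Ctx) : ℕ → ℕ := fpR C.r C.Q
abbrev Match (C : Ctx) : ℕ → ℕ → Prop := FpMatch C.S C.r C.Q

/-- The invariant of the scan: the current fingerprint, and the buffered ones of the needed blocks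
among the first `κ` ones. -/
structure Scan (C : Ctx) (need : ℕ → Prop) [DecidablePred need] (y z κ F G R rank : ℕ)
    (slot bufF bufG bufR : ℕ → ℕ) : Prop where
  F_eq : F = C.fF y
  G_eq : G = C.fG y
  R_eq : R = C.fR y
  rank_eq : rank = Nat.count need κ
  slot_eq : ∀ i < κ, slot i = if need i then Nat.count need (i + 1) else 0
  buf : ∀ x < z, C.Valid need κ x →
    bufF (C.bufIdx (Nat.count need (blk C.s x + 1)) x) = C.fF x ∧
    bufG (C.bufIdx (Nat.count need (blk C.s x + 1)) x) = C.fG x ∧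
    bufR (C.bufIdx (Nat.count need (blk C.s x + 1)) x) = C.fR x

theorem Ok.bufIdx_lt (h : C.Ok) (sl x : ℕ) : C.bufIdx sl x < 48 * C.s := by
  have h₁ := Nat.mod_lt (x + C.s - 1) (show C.s > 0 from h.s_pos)
  have h₂ := Nat.mul_le_mul_right C.s (show sl % 48 + 1 ≤ 48 by omega)
  rw [Nat.add_mul] at h₂
  unfold bufIdx
  omega

theorem Ok.fF_lt (h : C.Ok) (y : ℕ) : C.fF y < C.X := by
  have := h.Q_gt
  have := h.Q_le
  cases y with
  | zero => simp only [fF, fpF]; omega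
  | succ y => exact (Nat.mod_lt _ (by omega)).trans_le h.Q_le

theorem Ok.fG_lt (h : C.Ok) (y : ℕ) : C.fG y < C.X := by
  have := h.Q_gt
  have := h.Q_le
  cases y with
  | zero => simp only [fG, fpG]; omega
  | succ y => exact (Nat.mod_lt _ (by omega)).trans_le h.Q_le

theorem Ok.fR_lt (h : C.Ok) (y : ℕ) : C.fR y < C.X := by
  have := h.Q_gt
  have := h.Q_le
  cases y with
  | zero => simp only [fR, fpR]; omega
  | succ y => exact (Nat.mod_lt _ (by omega)).trans_le h.Q_le

end Ctx

variable {C : Ctx} {σ : St} {P : St → Prop}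

/-- As in the later rules, the hypothesis `h` quantifies over the new values of the scratch
variables, so that only the properties stated in it are passed on. The product in the condition of
`bufTest` is a conjunction: the block has a slot, and the slot has not been reused. -/
theorem wp_bufTest (hC : C.Ok) (hc : C.Const σ.n σ.r σ.Q σ.s σ.K) (hx : σ.x ≤ C.n)
    (h : ∀ b sl o f₁ g₁ r₁ res time, time ≤ σ.time + 10 →
      (res ≠ 0 ↔ σ.slot (blk C.s σ.x) ≠ 0 ∧ σ.rank < σ.slot (blk C.s σ.x) + 48 ∧
        (σ.f₂ * σ.bufR (C.bufIdx (σ.slot (blk C.s σ.x)) σ.x) +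
          σ.bufG (C.bufIdx (σ.slot (blk C.s σ.x)) σ.x)) % C.Q =
        (σ.bufF (C.bufIdx (σ.slot (blk C.s σ.x)) σ.x) * σ.r₂ + σ.g₂) % C.Q) →
      P { σ with b, sl, o, f₁, g₁, r₁, res, time }) : wp C.env bufTest P σ := by
  obtain ⟨-, -, hQ, hs, -⟩ := hc
  have hX := hC.X_ge
  have hn := hC.n_le_mul
  have hsn := hC.s_le
  have hb : (σ.x + σ.s - 1) / σ.s = blk C.s σ.x := by rw [hs, blk]
  have hb' : blk C.s σ.x < 48 * C.s := by
    have := hC.blk_le hx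
    have := hC.K_le
    have := hC.s_pos
    omega
  have ho : σ.slot (blk C.s σ.x) % 48 * σ.s + (σ.x + σ.s - 1) % σ.s =
    C.bufIdx (σ.slot (blk C.s σ.x)) σ.x := by rw [hs, Ctx.bufIdx]
  have hi := hC.bufIdx_lt (σ.slot (blk C.s σ.x)) σ.x
  have e₁ : C.env.X = C.X := rfl
  have e₂ : C.env.N = 48 * C.s := rfl
  simp only [bufTest, cmpFp, wp, Expr.eval_rules, St.get, St.set, St.geta, St.tick, hb, ho,
    e₁, e₂]
  refine ⟨by omega, hb', fun hv => ⟨by omega, hi, hi, hi, by split_ifs <;> omega, ?_⟩,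
    fun hv => ⟨by omega, ?_⟩⟩
  · have hv₁ := left_ne_zero_of_mul hv
    have hv₂ := right_ne_zero_of_mul hv
    rw [ite_ne_right_iff] at hv₂
    refine h _ _ _ _ _ _ _ _ (by omega) ?_
    rw [hQ, ite_ne_right_iff]
    simp [hv₁, hv₂]
  · refine h _ _ _ _ _ _ _ _ (by omega) ?_
    have : ¬ (σ.slot (blk C.s σ.x) ≠ 0 ∧ σ.rank < σ.slot (blk C.s σ.x) + 48) := by
      rintro ⟨h₁, h₂⟩
      simp [h₁, h₂] at hv
    tauto

/-- The outcome of `bufTest` if the scan invariant holds. -/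
theorem wp_bufTest_scan (hC : C.Ok) {need : ℕ → Prop} [DecidablePred need] {y z κ u : ℕ}
    (hc : C.Const σ.n σ.r σ.Q σ.s σ.K)
    (hscan : C.Scan need y z κ σ.F σ.G σ.R σ.rank σ.slot σ.bufF σ.bufG σ.bufR)
    (hx : σ.x ≤ C.n) (hF : σ.f₂ = C.fF u) (hG : σ.g₂ = C.fG u) (hR : σ.r₂ = C.fR u)
    (h : ∀ b sl o f₁ g₁ r₁ res time, time ≤ σ.time + 10 →
      (blk C.s σ.x < κ → σ.x < z → (res ≠ 0 ↔ C.Valid need κ σ.x ∧ C.Match σ.x u)) →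
      P { σ with b, sl, o, f₁, g₁, r₁, res, time }) : wp C.env bufTest P σ := by
  refine wp_bufTest hC hc hx fun b sl o f₁ g₁ r₁ res time ht hres =>
    h b sl o f₁ g₁ r₁ res time ht fun hκ hz => ?_
  rw [hres, hscan.slot_eq _ hκ, hscan.rank_eq]
  by_cases hneed : need (blk C.s σ.x)
  · rw [if_pos hneed]
    have h0 : Nat.count need (blk C.s σ.x + 1) ≠ 0 := by
      rw [Nat.count_succ, if_pos hneed]
      omega
    by_cases hlt : Nat.count need κ < Nat.count need (blk C.s σ.x + 1) + 48
    · obtain ⟨e₁, e₂, e₃⟩ := hscan.buf _ hz ⟨hneed, hlt⟩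
      rw [e₁, e₂, e₃, hF, hG, hR]
      simp only [hlt, Ctx.Valid, hneed, Ctx.Match, FpMatch]
      tauto
    · simp [hlt, Ctx.Valid]
  · simp [hneed, Ctx.Valid]

/-- Writing the current fingerprint spoils no valid entry: valid blocks have slots less than 48
behind the current one, so an equal buffer index means the same block and the same position. -/
theorem Ctx.Scan.store (hC : C.Ok) {need : ℕ → Prop} [DecidablePred need]
    {y κ F G R rank : ℕ} {slot bufF bufG bufR : ℕ → ℕ}
    (h : C.Scan need y y (κ + 1) F G R rank slot bufF bufG bufR) (hy : blk C.s y = κ) :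
    (slot κ = 0 → C.Scan need y (y + 1) (κ + 1) F G R rank slot bufF bufG bufR) ∧
    (slot κ ≠ 0 → C.Scan need y (y + 1) (κ + 1) F G R rank slot
      (Function.update bufF (C.bufIdx (slot κ) y) F) (Function.update bufG (C.bufIdx (slot κ) y) G)
      (Function.update bufR (C.bufIdx (slot κ) y) R)) := by
  have hs := hC.s_pos
  have hsl := h.slot_eq κ (Nat.lt_succ_self _)
  constructor
  · intro h0
    refine { h with buf := fun x hx hv => ?_ }
    rcases (Nat.lt_succ_iff.1 hx).eq_or_lt with rfl | hx'
    · exfalso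
      have hn := hv.1
      rw [hy] at hn
      rw [hsl, if_pos hn, Nat.count_succ, if_pos hn] at h0
      omega
    · exact h.buf x hx' hv
  · intro h0
    have hn : need κ := by
      by_contra hn
      exact h0 (by rw [hsl, if_neg hn])
    rw [if_pos hn] at hsl
    refine { h with buf := fun x hx hv => ?_ }
    rcases (Nat.lt_succ_iff.1 hx).eq_or_lt with rfl | hx'
    · rw [hy, ← hsl]
      simp only [Function.update_self]
      exact ⟨h.F_eq, h.G_eq, h.R_eq⟩
    · have hne : C.bufIdx (Nat.count need (blk C.s x + 1)) x ≠ C.bufIdx (slot κ) y := by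
        intro he
        have hbx : blk C.s x ≤ κ := hy ▸ (blk_le_iff hs).2 (hx'.le.trans (le_blk_mul hs))
        have h₁ : Nat.count need (blk C.s x + 1) ≤ Nat.count need (κ + 1) :=
          Nat.count_monotone need (by omega)
        have h₂ := hv.2
        unfold Ctx.bufIdx at he
        have l₁ := Nat.mod_lt (x + C.s - 1) (show C.s > 0 from hs)
        have l₂ := Nat.mod_lt (y + C.s - 1) (show C.s > 0 from hs)
        -- Quotient and remainder by `s` recover the slot modulo 48 and the offset in the block.
        have d₁ := congrArg (· / C.s) he
        have d₂ := congrArg (· % C.s) he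
        simp only [Nat.mul_add_mod_self_right, Nat.mod_mod, Nat.add_div_of_dvd_right
          (Dvd.intro_left _ rfl), Nat.mul_div_cancel _ (show 0 < C.s from hs),
          Nat.div_eq_of_lt l₁, Nat.div_eq_of_lt l₂] at d₁ d₂
        rw [hsl] at d₁
        have hbe : blk C.s x = κ := by
          by_contra hbne
          have : Nat.count need (blk C.s x + 1) < Nat.count need (κ + 1) := by
            refine (Nat.count_monotone need (show blk C.s x + 1 ≤ κ by omega)).trans_lt ?_
            rw [Nat.count_succ, if_pos hn]
            omega
          omega
        rw [← hy] at hbe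
        unfold blk at hbe
        have a₁ := Nat.div_add_mod (x + C.s - 1) C.s
        have a₂ := Nat.div_add_mod (y + C.s - 1) C.s
        rw [hbe, d₂] at a₁
        omega
      obtain ⟨e₁, e₂, e₃⟩ := h.buf x hx' hv
      rw [Function.update_of_ne hne, Function.update_of_ne hne, Function.update_of_ne hne]
      exact ⟨e₁, e₂, e₃⟩

theorem wp_storeBuf (hC : C.Ok) {need : ℕ → Prop} [DecidablePred need] {κ : ℕ}
    (hc : C.Const σ.n σ.r σ.Q σ.s σ.K)
    (hscan : C.Scan need σ.y σ.y (κ + 1) σ.F σ.G σ.R σ.rank σ.slot σ.bufF σ.bufG σ.bufR)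
    (hk : σ.k = κ) (hκ : κ ≤ C.K) (hy : blk C.s σ.y = κ)
    (h : ∀ sl o bufF bufG bufR time, time ≤ σ.time + 10 →
      C.Scan need σ.y (σ.y + 1) (κ + 1) σ.F σ.G σ.R σ.rank σ.slot bufF bufG bufR →
      P { σ with sl, o, bufF, bufG, bufR, time }) : wp C.env storeBuf P σ := by
  obtain ⟨-, -, hQ, hs, -⟩ := hc
  have hX := hC.X_ge
  have hn := hC.n_le_mul
  have hsn := hC.s_le
  have hK := hC.K_le
  have hs1 := hC.s_pos
  have ho : σ.slot κ % 48 * σ.s + (σ.y + σ.s - 1) % σ.s = C.bufIdx (σ.slot κ) σ.y := by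
    rw [hs, Ctx.bufIdx]
  have hi := hC.bufIdx_lt (σ.slot κ) σ.y
  have e₁ : C.env.X = C.X := rfl
  have e₂ : C.env.N = 48 * C.s := rfl
  simp only [storeBuf, wp, Expr.eval_rules, St.get, St.set, St.geta, St.seta, St.tick, hk,
    ho, e₁, e₂]
  obtain ⟨hst₁, hst₂⟩ := hscan.store hC hy
  refine ⟨by omega, fun hv => ⟨by omega, hi, ?_, hi, ?_, hi, ?_, ?_⟩, fun hv => ?_⟩
  · rw [hscan.F_eq]; exact hC.fF_lt _
  · rw [hscan.G_eq]; exact hC.fG_lt _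
  · rw [hscan.R_eq]; exact hC.fR_lt _
  · have := h (σ.slot κ) (C.bufIdx (σ.slot κ) σ.y) _ _ _ (σ.time + 6) (by omega) (hst₂ hv)
    subst hk
    exact this
  · have := h (σ.slot κ) σ.o _ _ _ (σ.time + 3) (by omega) (hst₁ hv)
    subst hk
    exact this

/-! ### Reading symbols: buffering fingerprints and growing `L` -/

section
set_option linter.unusedSimpArgs false

variable {C : Ctx} {σ : St} {P : St → Prop} {need : ℕ → Prop} [DecidablePred need]

/-- The scan invariant after `κ` blocks have been begun. -/
def Ctx.ScanSt (C : Ctx) (need : ℕ → Prop) [DecidablePred need] (κ : ℕ) (σ : St) : Prop :=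
  C.Const σ.n σ.r σ.Q σ.s σ.K ∧ σ.pos = σ.y ∧ σ.y ≤ C.n ∧
    C.Scan need σ.y (σ.y + 1) κ σ.F σ.G σ.R σ.rank σ.slot σ.bufF σ.bufG σ.bufR

/-- A palindrome `S[y - 2 * l + 1..y]` is found. -/
def Ctx.Found (C : Ctx) (need : ℕ → Prop) [DecidablePred need] (κ y l : ℕ) : Prop :=
  2 * l ≤ y ∧ C.Valid need κ (y - 2 * l) ∧ C.Match (y - 2 * l) y

theorem wp_beginBlock (hC : C.Ok) {y z κ : ℕ} (hs : σ.s = C.s)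
    (hscan : C.Scan need y z κ σ.F σ.G σ.R σ.rank σ.slot σ.bufF σ.bufG σ.bufR)
    (hk : σ.k = κ) (hκ : κ ≤ C.K)
    (hneed : need κ ↔ σ.small ≠ 0 ∨ σ.E < σ.best κ + C.s)
    (h : ∀ bst rank slot time, time ≤ σ.time + 4 →
      C.Scan need y z (κ + 1) σ.F σ.G σ.R rank slot σ.bufF σ.bufG σ.bufR →
      P { σ with bst, rank, slot, time }) : wp C.env beginBlock P σ := by
  have hX := hC.X_ge
  have hn := hC.n_le_mul
  have hsn := hC.s_le
  have hs1 := hC.s_pos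
  have hK := hC.K_le
  have e₁ : C.env.X = C.X := rfl
  have e₂ : C.env.N = 48 * C.s := rfl
  have hcnt : Nat.count need κ ≤ κ := Nat.count_le _
  have hr := hscan.rank_eq
  -- Beginning a block can only invalidate older positions; nothing new becomes valid.
  have hvalid : ∀ x, C.Valid need (κ + 1) x → C.Valid need κ x := fun x hx =>
    ⟨hx.1, (Nat.count_monotone need (Nat.le_succ κ)).trans_lt hx.2⟩
  simp only [beginBlock, wp, Expr.eval_rules, St.get, St.set, St.geta, St.seta, St.tick, e₁, e₂, hk]
  refine ⟨by omega, fun hc => ⟨by omega, by omega, by omega, ?_⟩, fun hc =>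
    ⟨by omega, by omega, ?_⟩⟩
  · have hn : need κ := by
      rw [hneed, ← hs]
      by_contra hcon
      push Not at hcon
      simp [hcon.1, hcon.2] at hc
    have := h (σ.best κ) (σ.rank + 1) (Function.update σ.slot κ (σ.rank + 1)) (σ.time + 4)
      (by omega)
    subst hk
    refine this ⟨hscan.F_eq, hscan.G_eq, hscan.R_eq, ?_, fun i hi => ?_, fun x hx hv =>
      hscan.buf x hx (hvalid x hv)⟩
    · rw [Nat.count_succ, if_pos hn, hr]
    · rcases (Nat.lt_succ_iff.1 hi).eq_or_lt with rfl | hi'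
      · rw [Function.update_self, if_pos hn, Nat.count_succ, if_pos hn, hr]
      · rw [Function.update_of_ne hi'.ne, hscan.slot_eq i hi']
  · have hn : ¬ need κ := by
      rw [hneed, ← hs]
      rintro (h0 | h0)
      · simp [h0] at hc
      · simp [h0] at hc
    have := h (σ.best κ) σ.rank (Function.update σ.slot κ 0) (σ.time + 3) (by omega)
    subst hk
    refine this ⟨hscan.F_eq, hscan.G_eq, hscan.R_eq, ?_, fun i hi => ?_, fun x hx hv =>
      hscan.buf x hx (hvalid x hv)⟩
    · rw [Nat.count_succ, if_neg hn, hr, Nat.add_zero]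
    · rcases (Nat.lt_succ_iff.1 hi).eq_or_lt with rfl | hi'
      · rw [Function.update_self, if_neg hn]
      · rw [Function.update_of_ne hi'.ne, hscan.slot_eq i hi']

/-- The test whether a palindrome of length `l` ends at the current position. -/
theorem wp_curTest (hC : C.Ok) {κ l : ℕ} {e : Expr} (hscan : C.ScanSt need κ σ)
    (he : e.eval σ = 2 * l) (hl : 2 * l ≤ σ.y) (hκ : blk C.s σ.y < κ)
    (h : ∀ x b sl o f₁ g₁ r₁ f₂ g₂ r₂ res time, time ≤ σ.time + 14 →
      (res ≠ 0 ↔ C.Found need κ σ.y l) →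
      P { σ with x, b, sl, o, f₁, g₁, r₁, f₂, g₂, r₂, res, time }) :
    wp C.env (.x ≔ §.y - e ;; loadCur ;; bufTest) P σ := by
  obtain ⟨hc, hpos, hy, hsc⟩ := hscan
  have hX := hC.X_ge
  have hn := hC.n_le_mul
  have e₁ : C.env.X = C.X := rfl
  have hs1 := hC.s_pos
  simp only [loadCur, wp, Expr.eval_rules, St.get, St.set, St.tick, e₁, he]
  refine ⟨by omega, ?_, ?_, ?_, ?_⟩
  · rw [hsc.F_eq]; exact hC.fF_lt _
  · rw [hsc.G_eq]; exact hC.fG_lt _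
  · rw [hsc.R_eq]; exact hC.fR_lt _
  refine wp_bufTest_scan hC hc hsc (u := σ.y) (by dsimp only; omega) hsc.F_eq hsc.G_eq hsc.R_eq
    fun b sl o f₁ g₁ r₁ res time ht hres => ?_
  dsimp only at ht hres ⊢
  refine h _ _ _ _ _ _ _ _ _ _ _ _ (by omega) ?_
  have hb : blk C.s (σ.y - 2 * l) ≤ blk C.s σ.y :=
    (blk_le_iff hs1).2 ((Nat.sub_le _ _).trans (le_blk_mul hs1))
  rw [hres (by omega) (by omega)]
  exact ⟨fun h => ⟨hl, h⟩, fun h => h.2⟩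

theorem wp_grow (hC : C.Ok) {κ : ℕ} (hscan : C.ScanSt need κ σ) (hκ : blk C.s σ.y < κ)
    (h : ∀ x b sl o f₁ g₁ r₁ f₂ g₂ r₂ res L cnt time, time ≤ σ.time + 20 →
      ((σ.L < σ.lim ∧ C.Found need κ σ.y (σ.L + 1)) ∧ L = σ.L + 1 ∧ cnt = 0 ∨
        ¬ (σ.L < σ.lim ∧ C.Found need κ σ.y (σ.L + 1)) ∧ L = σ.L ∧ cnt = σ.cnt) →
      P { σ with x, b, sl, o, f₁, g₁, r₁, f₂, g₂, r₂, res, L, cnt, time }) :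
    wp C.env grow P σ := by
  have hX := hC.X_ge
  have hn := hC.n_le_mul
  have hy := hscan.2.2.1
  have e₁ : C.env.X = C.X := rfl
  rw [grow, wp, wp]
  refine ⟨fun hc => ?_, fun hc => ?_⟩
  · simp only [Expr.eval_rules, St.get, ne_eq, mul_eq_zero, ite_eq_right_iff, one_ne_zero,
      imp_false, not_or, not_not] at hc
    refine wp_curTest (σ := σ.tick) (l := σ.L + 1) hC hscan rfl (by dsimp only [St.tick]; omega) hκ
      fun x b sl o f₁ g₁ r₁ f₂ g₂ r₂ res time ht hres => ?_
    simp only [wp, Expr.eval_rules, St.get, St.set, St.tick, e₁] at ht hres ⊢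
    refine ⟨fun h1 => ⟨by omega, by omega, ?_⟩, fun h1 => ?_⟩
    · exact h _ _ _ _ _ _ _ _ _ _ _ _ _ _ (by omega) (.inl ⟨⟨hc.1, hres.1 h1⟩, rfl, rfl⟩)
    · exact h _ _ _ _ _ _ _ _ _ _ _ _ _ _ (by omega)
        (.inr ⟨fun hcon => hres.2 hcon.2 h1, rfl, rfl⟩)
  · simp only [Expr.eval_rules, St.get, mul_eq_zero, ite_eq_right_iff, one_ne_zero,
      imp_false] at hc
    simp only [wp, Expr.eval_rules, St.get, St.set, St.tick, e₁]
    refine ⟨by omega, fun h1 => absurd rfl h1, fun h1 => ?_⟩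
    refine h _ _ _ _ _ _ _ _ _ _ _ _ _ _ (by omega) (.inr ⟨?_, rfl, rfl⟩)
    rintro ⟨h₁, h₂, -⟩
    omega

theorem wp_readStep (hC : C.Ok) {κ : ℕ} (hscan : C.ScanSt need (κ + 1) σ) (hk : σ.k = κ)
    (hκ : κ ≤ C.K) (hy : σ.y < C.n) (hb : blk C.s (σ.y + 1) = κ)
    (h : ∀ y F G R c sl bufF bufG bufR pos x b o f₁ g₁ r₁ f₂ g₂ r₂ res L cnt time,
      time ≤ σ.time + 40 → y = σ.y + 1 →
      ((σ.L < σ.lim ∧ C.Found need (κ + 1) y (σ.L + 1)) ∧ L = σ.L + 1 ∧ cnt = 0 ∨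
        ¬ (σ.L < σ.lim ∧ C.Found need (κ + 1) y (σ.L + 1)) ∧ L = σ.L ∧ cnt = σ.cnt) →
      C.ScanSt need (κ + 1) { σ with y, F, G, R, bufF, bufG, bufR, pos } →
      P { σ with y, F, G, R, c, sl, bufF, bufG, bufR, pos, x, b, o, f₁, g₁, r₁, f₂, g₂, r₂, res, L,
                 cnt, time }) :
    wp C.env readStep P σ := by
  obtain ⟨hc, hpos, -, hsc⟩ := hscan
  have hX := hC.X_ge
  have hn := hC.n_le_mul
  have hQ := hC.Q_le
  have hQ1 := hC.Q_gt
  have e₁ : C.env.X = C.X := rfl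
  have e₂ : C.env.n = C.n := rfl
  have e₃ : C.env.S = C.S := rfl
  have eQ : σ.Q = C.Q := hc.2.2.1
  have er : σ.r = C.r := hc.2.1
  simp only [readStep, wp, Expr.eval_rules, St.get, St.set, St.tick, e₁, e₂, e₃]
  have hm : ∀ a, a % σ.Q < C.X := fun a => by
    rw [eQ]
    exact (Nat.mod_lt _ (by omega)).trans_le hQ
  refine ⟨by omega, by omega, hC.sym _ (by omega) (by omega), hm _, hm _, hm _, ?_⟩
  refine wp_storeBuf (need := need) hC hc (κ := κ) ?_ hk hκ hb ?_
  · dsimp only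
    exact ⟨by rw [hsc.F_eq, hpos, eQ, er]; rfl, by rw [hsc.G_eq, hsc.R_eq, hpos, eQ]; rfl,
      by rw [hsc.R_eq, eQ, er]; rfl, hsc.rank_eq, hsc.slot_eq, hsc.buf⟩
  · intro sl o bufF bufG bufR time ht hsc'
    dsimp only at ht hsc' ⊢
    have hst : C.ScanSt need (κ + 1)
        { σ with y := σ.y + 1, F := (σ.F * σ.r + C.S (σ.pos + 1)) % σ.Q,
                 G := (σ.G + C.S (σ.pos + 1) * σ.R) % σ.Q, R := σ.R * σ.r % σ.Q, bufF, bufG, bufR,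
                 pos := σ.pos + 1 } :=
      ⟨hc, by dsimp only; omega, by dsimp only; omega, hsc'⟩
    refine wp_grow (need := need) (κ := κ + 1) hC hst (by dsimp only; omega) ?_
    intro x b sl o f₁ g₁ r₁ f₂ g₂ r₂ res L cnt time' ht' hL
    exact h _ _ _ _ _ _ _ _ _ _ _ _ _ _ _ _ _ _ _ _ _ _ _ (by dsimp only at ht'; omega) rfl hL hst

end

/-! ### Testing midpoints at checkpoints -/

section
set_option linter.unusedSimpArgs false

variable {C : Ctx} {σ : St} {P : St → Prop}

theorem flag_ne {p : Prop} [Decidable p] : (if p then 1 else 0 : ℕ) ≠ 0 ↔ p := by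
  split_ifs <;> simp_all

theorem flag_eq {p : Prop} [Decidable p] : (if p then 1 else 0 : ℕ) = 0 ↔ ¬ p := by
  split_ifs <;> simp_all

namespace Ctx

/-- The fingerprints are reliable. -/
def Good (C : Ctx) : Prop := StreamPal.Good C.S C.r C.Q C.n

abbrev Pal (C : Ctx) : ℕ → ℕ → Prop := HasPalindrome C.n C.S
abbrev Alive (C : Ctx) : ℕ → ℕ → Prop := StreamPal.Alive C.n C.S C.s
noncomputable abbrev level (C : Ctx) : ℕ → ℕ := StreamPal.level C.n C.S C.s
noncomputable abbrev estimate (C : Ctx) : ℕ → ℕ := StreamPal.estimate C.n C.S C.s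

theorem Good.match_iff (h : C.Good) {x y m : ℕ} (hm : x + y = 2 * m) (hxy : x ≤ y) (hy : y ≤ C.n) :
    C.Match x y ↔ C.Pal m (m - x) := by
  have e₁ : m - (m - x) = x := by omega
  have e₂ : m + (m - x) = y := by omega
  constructor
  · intro hM
    exact h m (m - x) (by omega) (by omega) (by rwa [e₁, e₂])
  · intro hP
    have := hP.fpMatch (r := C.r) (Q := C.Q)
    rwa [e₁, e₂] at this

/-- The fingerprints at the checkpoints are stored. -/
def Chk (C : Ctx) (k : ℕ) (chkF chkG chkR : ℕ → ℕ) : Prop :=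
  ∀ i ≤ k, chkF i = C.fF (min (i * C.s) C.n) ∧ chkG i = C.fG (min (i * C.s) C.n) ∧
    chkR i = C.fR (min (i * C.s) C.n)

/-- `best i` is a lower bound for the length of a palindrome whose left end is the checkpoint `i`,
and `E` is the maximum of these bounds. -/
structure BestOk (C : Ctx) (best : ℕ → ℕ) (E : ℕ) : Prop where
  le : ∀ i, best i ≤ E
  E_le : E ≤ C.n
  sound : C.Good → ∀ i, best i ≠ 0 → C.Pal (i * C.s + best i) (best i)
  attained : C.Good → ∃ m, C.Pal m E

/-- The state of the first pass after the block `k` has been read. -/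
def PassSt (C : Ctx) (k : ℕ) (σ : St) : Prop :=
  C.ScanSt (fun _ => True) (k + 1) σ ∧ σ.k = k ∧ k ≤ C.K ∧ σ.y = min (k * C.s) C.n ∧
    C.Chk k σ.chkF σ.chkG σ.chkR ∧ C.BestOk σ.best σ.E

/-- It can be tested after the block `k` whether `m` is alive at the level `ip`. -/
def InRange (C : Ctx) (k ip m : ℕ) : Prop :=
  1 ≤ m ∧ m ≤ C.n ∧ (ip - 1) * C.s < m ∧
    (1 ≤ ip → 2 * m ≤ k * C.s + (ip - 1) * C.s ∧ k * C.s + (ip - 1) * C.s ≤ 2 * m + 3 * C.s)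

end Ctx

theorem wp_touch {best : ℕ → ℕ} (hC : C.Ok) (hs : σ.s = C.s) (hip : σ.ip ≤ C.K)
    (hb : C.BestOk σ.best σ.E)
    (hm : σ.m - (σ.ip - 1) * C.s ≤ C.n)
    (hgood : C.Good → C.Alive σ.ip σ.m ∧ (σ.ip - 1) * C.s < σ.m) (hbest : σ.best = best)
    (h : ∀ e bst best' E time, time ≤ σ.time + 7 → C.BestOk best' E → (∀ i, best i ≤ best' i) →
      σ.m - (σ.ip - 1) * C.s ≤ best' (σ.ip - 1) →
      P { σ with e, bst, best := best', E, time }) : wp C.env touch P σ := by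
  subst hbest
  have hX := hC.X_ge
  have hn := hC.n_le_mul
  have hs1 := hC.s_pos
  have hK := hC.K_le
  have e₁ : C.env.X = C.X := rfl
  have e₂ : C.env.N = 48 * C.s := rfl
  simp only [touch, wp, Expr.eval_rules, St.get, St.set, St.geta, St.seta, St.tick, e₁, e₂]
  rw [hs]
  have hle := hb.le (σ.ip - 1)
  have hE := hb.E_le
  set e := σ.m - (σ.ip - 1) * C.s with he
  set i := σ.ip - 1 with hi
  have hpal : C.Good → C.Pal σ.m e := fun hg => (hgood hg).1.2
  have hup : σ.best i < e → ∀ E', σ.E ≤ E' → e ≤ E' → E' ≤ C.n → (C.Good → ∃ m, C.Pal m E') →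
      C.BestOk (Function.update σ.best i e) E' := by
    intro hlt E' h₁ h₂ h₃ h₄
    refine ⟨fun i' => ?_, h₃, fun hg i' hi' => ?_, h₄⟩
    · rw [Function.update_apply]
      split_ifs
      exacts [h₂, (hb.le i').trans h₁]
    · rw [Function.update_apply] at hi' ⊢
      split_ifs at hi' ⊢ with hii
      · have h₅ := (hgood hg).2
        rw [hii, show i * C.s + e = σ.m by omega]
        exact hpal hg
      · exact hb.sound hg i' hi'
  have hmono : σ.best i < e → ∀ i', σ.best i' ≤ Function.update σ.best i e i' := by
    intro hlt i'
    rw [Function.update_apply]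
    split_ifs with hii
    · rw [hii]; exact hlt.le
    · exact le_rfl
  refine ⟨by omega, by omega, fun h₁ => ⟨by omega, by omega, fun h₂ => ⟨by omega, ?_⟩,
    fun h₂ => ?_⟩,
    fun h₁ => ⟨fun h₂ => ⟨by omega, ?_⟩, fun h₂ => ?_⟩⟩
  · have h₁ := flag_ne.1 h₁
    have h₂ := flag_ne.1 h₂
    rw [← hs]
    exact h e (σ.best i) _ e (σ.time + 6) (by omega)
      (hup h₁ e h₂.le le_rfl hm fun hg => ⟨_, hpal hg⟩) (hmono h₁) (by rw [Function.update_self])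
  · have h₁ := flag_ne.1 h₁
    have h₂ := flag_eq.1 h₂
    rw [← hs]
    exact h e (σ.best i) _ σ.E (σ.time + 6) (by omega)
      (hup h₁ _ le_rfl (by omega) hE hb.attained) (hmono h₁) (by rw [Function.update_self])
  -- This branch is impossible: `e ≤ best i ≤ E`.
  · have h₁ := flag_eq.1 h₁
    have h₂ := flag_ne.1 h₂
    omega
  · have h₁ := flag_eq.1 h₁
    rw [← hs]
    exact h e (σ.best i) σ.best σ.E (σ.time + 6) (by omega) hb (fun _ => le_rfl) (by omega)

/-- Aliveness is compared by fingerprints at the checkpoint and at the right end. Without `Good` the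
outcome is arbitrary, and only the bounds on sizes and time survive. -/
theorem wp_aliveTest (hC : C.Ok) {k : ℕ} (hp : C.PassSt k σ) (hip : σ.ip ≤ k + 1)
    (hipK : σ.ip ≤ C.K)
    (hm : σ.m ≤ 2 * (C.n * C.n)) (hr : C.Good → C.InRange k σ.ip σ.m)
    (h : ∀ x b sl o f₁ g₁ r₁ f₂ g₂ r₂ res e bst best E time, time ≤ σ.time + 30 →
      C.BestOk best E → (∀ i, σ.best i ≤ best i) → (C.Good → (res ≠ 0 ↔ C.Alive σ.ip σ.m)) →
      (C.Good → C.Alive σ.ip σ.m → σ.m - (σ.ip - 1) * C.s ≤ best (σ.ip - 1)) →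
      P { σ with x, b, sl, o, f₁, g₁, r₁, f₂, g₂, r₂, res, e, bst, best, E, time }) :
    wp C.env aliveTest P σ := by
  obtain ⟨hscan, hk, hkK, hy, hchk, hbest⟩ := hp
  have hc := hscan.1
  have hX := hC.X_ge
  have hn := hC.n_le_mul
  have hs1 := hC.s_pos
  have hK := hC.K_le
  have es : σ.s = C.s := hc.2.2.2.1
  have en : σ.n = C.n := hc.1
  have e₁ : C.env.X = C.X := rfl
  have e₂ : C.env.N = 48 * C.s := rfl
  simp only [aliveTest, wp, Expr.eval_rules, St.get, St.set, St.geta, St.seta, St.tick, e₁, e₂]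
  refine ⟨by omega, fun h₀ => ⟨by omega, fun h₁ => ⟨by omega, by omega, by omega, ?_⟩,
    fun h₁ => ?_⟩,
    fun h₀ => ?_⟩
  · obtain ⟨c₁, c₂, c₃⟩ := hchk (σ.ip - 1) (by omega)
    simp only [ne_eq, ite_eq_right_iff, one_ne_zero, imp_false, not_not] at h₁
    refine wp_bufTest_scan (need := fun _ => True) (κ := k + 1) hC hc hscan.2.2.2
      (u := min ((σ.ip - 1) * C.s) C.n) (by dsimp only; omega) c₁ c₂ c₃ ?_
    intro b sl o f₁ g₁ r₁ res time ht hres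
    dsimp only at ht hres
    rw [es] at hres h₁
    rw [en] at h₁
    have hal : C.Good → (res ≠ 0 ↔ C.Alive σ.ip σ.m) := by
      intro hg
      obtain ⟨i₁, i₂, i₃, i₄⟩ := hr hg
      obtain ⟨i₄, i₅⟩ := i₄ (by omega)
      -- The right end lies in one of the last four blocks read, so its fingerprint is still
      -- buffered.
      have hb₁ : blk C.s (2 * σ.m - (σ.ip - 1) * C.s) ≤ k := (blk_le_iff hs1).2 (by omega)
      have hb₂ : k < blk C.s (2 * σ.m - (σ.ip - 1) * C.s) + 4 := by
        by_contra! hcon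
        have a := Nat.mul_le_mul_right C.s hcon
        have b := le_blk_mul (x := 2 * σ.m - (σ.ip - 1) * C.s) hs1
        rw [Nat.add_mul] at a
        omega
      have hv : C.Valid (fun _ => True) (k + 1) (2 * σ.m - (σ.ip - 1) * C.s) :=
        ⟨trivial, by simp only [Nat.count_true]; omega⟩
      rw [hres (by omega) (by omega), Nat.min_eq_left (by omega)]
      have := hg.match_iff (x := (σ.ip - 1) * C.s) (y := 2 * σ.m - (σ.ip - 1) * C.s) (m := σ.m)
        (by omega) (by omega) (by omega)
      constructor
      · rintro ⟨-, hM⟩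
        exact ⟨by omega, this.1 hM.symm⟩
      · rintro ⟨-, hP⟩
        exact ⟨hv, FpMatch.symm (this.2 hP)⟩
    simp only [wp, Expr.eval_rules, St.get, St.set, St.tick]
    refine ⟨fun hr0 => ?_, fun hr0 => ?_⟩
    · refine wp_touch (best := σ.best) hC es hipK hbest ?_ ?_ rfl ?_
      · dsimp only
        omega
      · intro hg
        exact ⟨(hal hg).1 hr0, (hr hg).2.2.1⟩
      · intro e bst best E time' ht' hB hmono hge
        exact h _ _ _ _ _ _ _ _ _ _ _ _ _ _ _ _ (by dsimp only at ht'; omega) hB hmono hal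
          fun _ _ => hge
    · exact h _ _ _ _ _ _ _ _ _ _ _ _ _ _ _ _ (by omega) hbest (fun _ => le_rfl) hal
        fun hg ha => absurd hr0 ((hal hg).2 ha)
  · simp only [ite_eq_right_iff, one_ne_zero, imp_false] at h₁
    rw [es, en] at h₁
    -- The right end would lie beyond the end of the stream.
    have hna : ¬ C.Alive σ.ip σ.m := by
      rintro ⟨-, ha⟩
      have h₂ := ha.1
      have h₃ := ha.2.1
      omega
    exact h _ _ _ _ _ _ _ _ _ _ 0 _ _ _ _ _ (by omega) hbest (fun _ => le_rfl)
      (fun _ => ⟨fun h => absurd rfl h, fun h => absurd h hna⟩) fun _ h => absurd h hna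
  · have hna : ¬ C.Alive σ.ip σ.m := fun h => by
      have := h.1
      omega
    exact h _ _ _ _ _ _ _ _ _ _ 0 _ _ _ _ _ (by omega) hbest (fun _ => le_rfl)
      (fun _ => ⟨fun h => absurd rfl h, fun h => absurd h hna⟩) fun _ h => absurd h hna

end

/-- `m` belongs to the arithmetic progression `af, af + ad, …, af + (ac - 1) * ad`. -/
def InAP (af ad ac m : ℕ) : Prop := ∃ q < ac, m = af + q * ad

/-! ### Changing arithmetic progressions at their ends -/

section AP

variable {af ad ac m : ℕ}

theorem inAP_pop_last (h : 2 ≤ ac → 0 < ad) :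
    InAP af ad (ac - 1) m ↔ InAP af ad ac m ∧ m ≠ af + (ac - 1) * ad := by
  constructor
  · rintro ⟨q, hq, rfl⟩
    have := Nat.mul_lt_mul_of_pos_right hq (h (by omega))
    exact ⟨⟨q, by omega, rfl⟩, by omega⟩
  · rintro ⟨⟨q, hq, rfl⟩, hne⟩
    refine ⟨q, ?_, rfl⟩
    by_contra hc
    exact hne (by rw [show q = ac - 1 by omega])

theorem inAP_pop_first (had : 0 < ad) :
    InAP (af + ad) ad (ac - 1) m ↔ InAP af ad ac m ∧ m ≠ af := by
  constructor
  · rintro ⟨q, hq, rfl⟩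
    exact ⟨⟨q + 1, by omega, by ring⟩, by omega⟩
  · rintro ⟨⟨q, hq, rfl⟩, hne⟩
    cases q with
    | zero => simp at hne
    | succ q => exact ⟨q, by omega, by ring⟩

theorem inAP_succ : InAP af ad (ac + 1) m ↔ InAP af ad ac m ∨ m = af + ac * ad := by
  constructor
  · rintro ⟨q, hq, rfl⟩
    rcases (Nat.lt_succ_iff.1 hq).eq_or_lt with rfl | h
    exacts [.inr rfl, .inl ⟨q, h, rfl⟩]
  · rintro (⟨q, hq, rfl⟩ | rfl)
    exacts [⟨q, by omega, rfl⟩, ⟨ac, by omega, rfl⟩]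

end AP

/-! ### Invariants for reported midpoints and candidate progressions -/

namespace Ctx

variable {C : Ctx}

/-- The midpoints `m` with the property `D` have been reported with their estimates. -/
def OutOk (C : Ctx) (out : List (ℕ × ℕ)) (D : ℕ → Prop) : Prop :=
  ∀ m e, (m, e) ∈ out ↔ 1 ≤ m ∧ m ≤ C.n ∧ D m ∧ e = C.estimate m

theorem OutOk.congr {out : List (ℕ × ℕ)} {D D' : ℕ → Prop} (h : C.OutOk out D)
    (hD : ∀ m, 1 ≤ m → m ≤ C.n → (D' m ↔ D m)) : C.OutOk out D' := by
  intro m e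
  rw [h m e]
  constructor
  · rintro ⟨h₁, h₂, h₃, h₄⟩
    exact ⟨h₁, h₂, (hD m h₁ h₂).2 h₃, h₄⟩
  · rintro ⟨h₁, h₂, h₃, h₄⟩
    exact ⟨h₁, h₂, (hD m h₁ h₂).1 h₃, h₄⟩

theorem OutOk.append {out : List (ℕ × ℕ)} {D D' : ℕ → Prop} (h : C.OutOk out D) {m₀ e₀ : ℕ}
    (h₁ : 1 ≤ m₀) (h₂ : m₀ ≤ C.n) (he : e₀ = C.estimate m₀)
    (hD : ∀ m, 1 ≤ m → m ≤ C.n → (D' m ↔ D m ∨ m = m₀)) : C.OutOk (out ++ [(m₀, e₀)]) D' := by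
  intro m e
  rw [List.mem_append, h m e, List.mem_singleton, Prod.mk.injEq]
  constructor
  · rintro (⟨a, b, c, d⟩ | ⟨rfl, rfl⟩)
    exacts [⟨a, b, (hD m a b).2 (.inl c), d⟩, ⟨h₁, h₂, (hD m h₁ h₂).2 (.inr rfl), he⟩]
  · rintro ⟨a, b, c, d⟩
    rcases (hD m a b).1 c with c | rfl
    exacts [.inl ⟨a, b, c, d⟩, .inr ⟨rfl, d.trans he.symm⟩]

/-- After the first pass has processed some block, the midpoints `m` of the block `j` have been
tested at the levels from `lvf j` on: those that are not alive at the level `lvf j` have been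
reported, and the other ones form an arithmetic progression. -/
structure Data (C : Ctx) (lvf : ℕ → ℕ) (out : List (ℕ × ℕ)) (best afst adif acnt : ℕ → ℕ) :
    Prop where
  out : C.OutOk out fun m => lvf (blk C.s m) ≤ C.level m
  ap : ∀ j, lvf j < j → ∀ m, InAP (afst j) (adif j) (acnt j) m ↔
    1 ≤ m ∧ m ≤ C.n ∧ blk C.s m = j ∧ C.level m < lvf j
  dif : ∀ j, lvf j < j → 2 ≤ acnt j → 0 < adif j ∧ adif j < C.s
  best : ∀ m ip, 1 ≤ m → m ≤ C.n → lvf (blk C.s m) ≤ ip → ip ≤ blk C.s m → C.level m < ip →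
    m - (ip - 1) * C.s ≤ best (ip - 1)

theorem one_le_blk (hs : 1 ≤ C.s) {m : ℕ} (hm : 1 ≤ m) : 1 ≤ blk C.s m := by
  have := le_blk_mul (x := m) hs
  by_contra h
  rw [show blk C.s m = 0 by omega] at this
  omega

theorem Data.congr {lvf lvf' : ℕ → ℕ} {out : List (ℕ × ℕ)} {best afst adif acnt : ℕ → ℕ}
    (hs : 1 ≤ C.s) (h : C.Data lvf out best afst adif acnt) (hl : ∀ j, 1 ≤ j → lvf' j = lvf j) :
    C.Data lvf' out best afst adif acnt where
  out := h.out.congr fun m h₁ _ => by rw [hl _ (one_le_blk hs h₁)]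
  ap j hj := by
    rw [hl j (by omega)] at hj ⊢
    exact h.ap j hj
  dif j hj := by
    rw [hl j (by omega)] at hj
    exact h.dif j hj
  best m ip h₁ h₂ h₃ := by
    rw [hl _ (one_le_blk hs h₁)] at h₃
    exact h.best m ip h₁ h₂ h₃

/-- The invariant for removing the midpoints that are not alive at the level `ip` from the set `A`
of candidates in the block `j`. -/
structure Pruning (C : Ctx) (j ip : ℕ) (A D : ℕ → Prop) (out : List (ℕ × ℕ)) : Prop where
  mem : ∀ m, A m → 1 ≤ m ∧ m ≤ C.n ∧ blk C.s m = j ∧ C.level m < ip + 1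
  of_lt : ∀ m, 1 ≤ m → m ≤ C.n → blk C.s m = j → C.level m < ip → A m
  out : C.OutOk out fun m => D m ∨ blk C.s m = j ∧ C.level m = ip ∧ ¬ A m

/-- A candidate has level at most `ip`; being dead at `ip` it has level exactly `ip`, so the
reported length is its estimate. -/
theorem Pruning.die {j ip m₀ : ℕ} {A A' D : ℕ → Prop} {out : List (ℕ × ℕ)}
    (h : C.Pruning j ip A D out) (hm : A m₀) (hip : ip ≤ j) (hd : ¬ C.Alive ip m₀)
    (hA : ∀ m, A' m ↔ A m ∧ m ≠ m₀) : C.Pruning j ip A' D (out ++ [(m₀, m₀ - ip * C.s)]) := by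
  obtain ⟨h₁, h₂, h₃, h₄⟩ := h.mem m₀ hm
  have hl : ¬ C.level m₀ < ip := fun hl => hd ((level_lt_iff (by omega)).1 hl)
  have hl : C.level m₀ = ip := by omega
  refine ⟨fun m hm => h.mem m ((hA m).1 hm).1, fun m a b c d => (hA m).2 ⟨h.of_lt m a b c d, ?_⟩,
    h.out.append h₁ h₂ ?_ fun m a b => ?_⟩
  · rintro rfl
    omega
  · show _ = m₀ - C.level m₀ * C.s
    rw [hl]
  · rw [hA m]
    by_cases hmm : m = m₀
    · subst hmm
      simp [h₃, hl]
    · simp [hmm]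

theorem Data.pruning {lvf : ℕ → ℕ} {out : List (ℕ × ℕ)} {best afst adif acnt : ℕ → ℕ} {j ip : ℕ}
    (h : C.Data lvf out best afst adif acnt) (hl : lvf j = ip + 1) (hj : ip + 1 < j) :
    C.Pruning j ip (InAP (afst j) (adif j) (acnt j)) (fun m => lvf (blk C.s m) ≤ C.level m)
      out := by
  have := h.ap j (by omega)
  refine ⟨fun m hm => hl ▸ (this m).1 hm, fun m a b c d => (this m).2 ⟨a, b, c, by omega⟩,
    h.out.congr fun m a b => ?_⟩
  constructor
  · rintro (h | ⟨h₁, h₂, h₃⟩)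
    · exact h
    · exact absurd ((this m).2 ⟨a, b, h₁, by omega⟩) h₃
  · exact .inl

/-- When every remaining candidate of the block `j` is known to be alive at `ip`, the level reached
by the block drops from `ip + 1` to `ip`. The other blocks are unaffected, since `best` only
increases. -/
theorem Data.prune {lvf : ℕ → ℕ} {out out' : List (ℕ × ℕ)} {best best' afst adif acnt : ℕ → ℕ}
    {j ip af ac : ℕ} (h : C.Data lvf out best afst adif acnt) (hl : lvf j = ip + 1)
    (hj : ip + 1 < j) (hp : C.Pruning j ip (InAP af (adif j) ac)
      (fun m => lvf (blk C.s m) ≤ C.level m) out')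
    (hdif : 2 ≤ ac → 0 < adif j ∧ adif j < C.s)
    (hfin : ∀ m, InAP af (adif j) ac m → C.level m < ip ∧ m - (ip - 1) * C.s ≤ best' (ip - 1))
    (hbest : ∀ i, best i ≤ best' i) :
    C.Data (Function.update lvf j ip) out' best' (Function.update afst j af) adif
      (Function.update acnt j ac) where
  out := hp.out.congr fun m h₁ h₂ => by
    by_cases hb : blk C.s m = j
    · rw [hb, Function.update_self, hl]
      constructor
      · intro hle
        rcases hle.eq_or_lt with he | hlt
        · refine .inr ⟨rfl, he.symm, fun hA => ?_⟩
          have := (hfin m hA).1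
          omega
        · exact .inl hlt
      · rintro (hle | ⟨-, he, -⟩) <;> omega
    · rw [Function.update_of_ne hb]
      simp [hb]
  ap j' hj' m := by
    by_cases hb : j' = j
    · subst hb
      simp only [Function.update_self]
      constructor
      · intro hA
        obtain ⟨a, b, c, d⟩ := hp.mem m hA
        exact ⟨a, b, c, (hfin m hA).1⟩
      · rintro ⟨a, b, c, d⟩
        exact hp.of_lt m a b c d
    · simp only [Function.update_of_ne hb] at hj' ⊢
      exact h.ap j' hj' m
  dif j' hj' := by
    by_cases hb : j' = j
    · subst hb
      simp only [Function.update_self]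
      exact hdif
    · simp only [Function.update_of_ne hb] at hj' ⊢
      exact h.dif j' hj'
  best m ip' h₁ h₂ h₃ h₄ h₅ := by
    by_cases hb : blk C.s m = j
    · rw [hb, Function.update_self] at h₃
      rcases h₃.eq_or_lt with rfl | hlt
      · exact (hfin m (hp.of_lt m h₁ h₂ hb h₅)).2
      · exact (h.best m ip' h₁ h₂ (by rw [hb]; omega) h₄ h₅).trans (hbest _)
    · rw [Function.update_of_ne hb] at h₃
      exact (h.best m ip' h₁ h₂ h₃ h₄ h₅).trans (hbest _)

/-- The invariant for finding the midpoints in the block `j` up to `m₀` that are alive at the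
level `j - 1`. -/
structure Starting (C : Ctx) (j m₀ af ad ac : ℕ) (D : ℕ → Prop) (out : List (ℕ × ℕ))
    (best : ℕ → ℕ) : Prop where
  ap : ∀ m, InAP af ad ac m ↔
    1 ≤ m ∧ m ≤ C.n ∧ blk C.s m = j ∧ C.level m < j - 1 ∧ m ≤ m₀
  dif : 2 ≤ ac → 0 < ad ∧ ad < C.s
  out : C.OutOk out fun m => D m ∨ blk C.s m = j ∧ j - 1 ≤ C.level m ∧ m ≤ m₀
  best : ∀ m ip, 1 ≤ m → m ≤ C.n → blk C.s m = j → m ≤ m₀ → j - 1 ≤ ip → ip ≤ j →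
    C.level m < ip → m - (ip - 1) * C.s ≤ best (ip - 1)

section Starting

variable {j m₀ af ad ac : ℕ} {D : ℕ → Prop} {out : List (ℕ × ℕ)} {best best' : ℕ → ℕ}

theorem Starting.skip (h : C.Starting j m₀ af ad ac D out best) (hm : C.n < m₀ + 1) :
    C.Starting j (m₀ + 1) af ad ac D out best where
  ap m := by
    rw [h.ap m]
    constructor
    · rintro ⟨a, b, c, d, e⟩
      exact ⟨a, b, c, d, by omega⟩
    · rintro ⟨a, b, c, d, e⟩
      exact ⟨a, b, c, d, by omega⟩
  dif := h.dif
  out := h.out.congr fun m h₁ h₂ => by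
    rw [show m ≤ m₀ + 1 ↔ m ≤ m₀ by omega]
  best m ip h₁ h₂ h₃ _ := h.best m ip h₁ h₂ h₃ (by omega)

theorem Starting.die (h : C.Starting j m₀ af ad ac D out best) (hb : blk C.s (m₀ + 1) = j)
    (hm : m₀ + 1 ≤ C.n) {ip : ℕ} (hip : C.level (m₀ + 1) = ip) (hj : j - 1 ≤ ip)
    (hbest : ∀ i, best i ≤ best' i)
    (hnew : ∀ ip, j - 1 ≤ ip → ip ≤ j → C.level (m₀ + 1) < ip →
      (m₀ + 1) - (ip - 1) * C.s ≤ best' (ip - 1)) :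
    C.Starting j (m₀ + 1) af ad ac D (out ++ [(m₀ + 1, m₀ + 1 - ip * C.s)]) best' where
  ap m := by
    rw [h.ap m]
    constructor
    · rintro ⟨a, b, c, d, e⟩
      exact ⟨a, b, c, d, by omega⟩
    · rintro ⟨a, b, c, d, e⟩
      refine ⟨a, b, c, d, ?_⟩
      by_contra hcon
      rw [show m = m₀ + 1 by omega] at d
      omega
  dif := h.dif
  out := h.out.append (by omega) hm (by rw [← hip]; rfl) fun m h₁ h₂ => by
    by_cases he : m = m₀ + 1
    · subst he
      simp [hb, hip, hj]
    · rw [show m ≤ m₀ + 1 ↔ m ≤ m₀ by omega]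
      simp [he]
  best m ip h₁ h₂ h₃ h₄ h₅ h₆ h₇ := by
    rcases h₄.eq_or_lt with rfl | h₄
    · exact hnew ip h₅ h₆ h₇
    · exact (h.best m ip h₁ h₂ h₃ (by omega) h₅ h₆ h₇).trans (hbest _)

/-- Up to two midpoints always form a progression. From the third on, the new midpoint continues it
because consecutive live midpoints have equal gaps. -/
theorem Starting.append (h : C.Starting j m₀ af ad ac D out best) (hs : 1 ≤ C.s)
    (hb : blk C.s (m₀ + 1) = j) (hm : m₀ + 1 ≤ C.n) (hl : C.level (m₀ + 1) < j - 1)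
    (hbest : ∀ i, best i ≤ best' i)
    (hnew : ∀ ip, j - 1 ≤ ip → ip ≤ j → C.level (m₀ + 1) < ip →
      (m₀ + 1) - (ip - 1) * C.s ≤ best' (ip - 1)) :
    C.Starting j (m₀ + 1) (if ac ≠ 0 then af else m₀ + 1) (if ac = 1 then m₀ + 1 - af else ad)
      (ac + 1) D out best' := by
  have hblk : ∀ m, 1 ≤ m → blk C.s m = j → (j - 1) * C.s < m ∧ m ≤ j * C.s := fun m h₁ h₂ => by
    have := pred_blk_mul_lt hs h₁
    rw [h₂] at this
    exact ⟨this, h₂ ▸ le_blk_mul hs⟩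
  have hj : 1 ≤ j := hb ▸ one_le_blk hs (by omega)
  obtain ⟨b₁, b₂⟩ := hblk _ (by omega) hb
  have e₁ : (j - 1) * C.s + C.s = j * C.s := by
    rw [← Nat.succ_mul, Nat.succ_eq_add_one, Nat.sub_add_cancel hj]
  have hal : ∀ m, blk C.s m = j → (C.level m < j - 1 ↔ C.Alive (j - 1) m) := fun m hm =>
    level_lt_iff (by omega)
  have hkey : (∀ m, InAP (if ac ≠ 0 then af else m₀ + 1) (if ac = 1 then m₀ + 1 - af else ad)
      (ac + 1) m ↔ InAP af ad ac m ∨ m = m₀ + 1) ∧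
      (2 ≤ ac + 1 → 0 < (if ac = 1 then m₀ + 1 - af else ad) ∧
        (if ac = 1 then m₀ + 1 - af else ad) < C.s) := by
    rcases Nat.lt_or_ge ac 2 with hac | hac
    · obtain rfl | rfl : ac = 0 ∨ ac = 1 := by omega
      · refine ⟨fun m => ?_, fun h => absurd h (by omega)⟩
        rw [inAP_succ]
        simp [InAP]
      · have hA := (h.ap af).1 ⟨0, by omega, by omega⟩
        obtain ⟨a₁, a₂⟩ := hblk _ hA.1 hA.2.2.1
        refine ⟨fun m => ?_, fun _ => ?_⟩
        · rw [inAP_succ]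
          simp only [ne_eq, one_ne_zero, not_false_eq_true, if_true, one_mul]
          rw [show af + (m₀ + 1 - af) = m₀ + 1 by omega]
          simp [InAP]
        · simp only [if_true]
          omega
    · have hx := (h.ap (af + (ac - 2) * ad)).1 ⟨ac - 2, by omega, rfl⟩
      have hy := (h.ap (af + (ac - 1) * ad)).1 ⟨ac - 1, by omega, rfl⟩
      obtain ⟨d₁, d₂⟩ := h.dif hac
      have e₂ : (ac - 1) * ad = (ac - 2) * ad + ad := by
        rw [← Nat.succ_mul, Nat.succ_eq_add_one, show ac - 2 + 1 = ac - 1 by omega]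
      have e₃ : ac * ad = (ac - 1) * ad + ad := by
        rw [← Nat.succ_mul, Nat.succ_eq_add_one, Nat.sub_add_cancel (by omega)]
      -- The last two members and the new midpoint are consecutive: by the invariant, a live
      -- midpoint in one of the gaps would be a member of the progression.
      have hgap := alive_gap_eq hs (j := j) (x := af + (ac - 2) * ad) (y := af + (ac - 1) * ad)
        (z := m₀ + 1) ((hal _ hx.2.2.1).1 hx.2.2.2.1) ((hal _ hy.2.2.1).1 hy.2.2.2.1)
        ((hal _ hb).1 hl) (hblk _ hx.1 hx.2.2.1).1 (by omega) (by omega) b₂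
        (fun m h₁ h₂ hm => ?_) fun m h₁ h₂ hm => ?_
      · rw [if_pos (by omega), if_neg (by omega)]
        refine ⟨fun m => ?_, fun _ => ⟨d₁, d₂⟩⟩
        rw [inAP_succ, show af + ac * ad = m₀ + 1 by omega]
      · have hbm : blk C.s m = j := (blk_eq_iff hs).2 (by
          have := (hblk _ hx.1 hx.2.2.1).1
          have := (hblk _ hy.1 hy.2.2.1).2
          omega)
        obtain ⟨q, hq, rfl⟩ := (h.ap m).2 ⟨by omega, by omega, hbm, (hal _ hbm).2 hm, by omega⟩
        have := Nat.lt_of_mul_lt_mul_right (a := ad) (show (ac - 2) * ad < q * ad by omega)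
        have := Nat.lt_of_mul_lt_mul_right (a := ad) (show q * ad < (ac - 1) * ad by omega)
        omega
      · have hbm : blk C.s m = j := (blk_eq_iff hs).2 (by
          have := (hblk _ hy.1 hy.2.2.1).1
          omega)
        obtain ⟨q, hq, rfl⟩ := (h.ap m).2 ⟨by omega, by omega, hbm, (hal _ hbm).2 hm, by omega⟩
        have := Nat.lt_of_mul_lt_mul_right (a := ad) (show (ac - 1) * ad < q * ad by omega)
        omega
  refine ⟨fun m => ?_, hkey.2, h.out.congr fun m h₁ h₂ => ?_, fun m ip h₁ h₂ h₃ h₄ h₅ h₆ h₇ => ?_⟩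
  · rw [hkey.1, h.ap]
    by_cases he : m = m₀ + 1
    · subst he
      simp [hb, hm, hl]
    · rw [show m ≤ m₀ + 1 ↔ m ≤ m₀ by omega]
      simp [he]
  · by_cases he : m = m₀ + 1
    · subst he
      refine or_congr_right ⟨fun h => ?_, fun h => ?_⟩ <;> omega
    · rw [show m ≤ m₀ + 1 ↔ m ≤ m₀ by omega]
  · rcases h₄.eq_or_lt with rfl | h₄
    · exact hnew ip h₅ h₆ h₇
    · exact (h.best m ip h₁ h₂ h₃ (by omega) h₅ h₆ h₇).trans (hbest _)

end Starting

theorem Data.starting {lvf : ℕ → ℕ} {out : List (ℕ × ℕ)} {best afst adif acnt : ℕ → ℕ} {j : ℕ}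
    (hs : 1 ≤ C.s) (h : C.Data lvf out best afst adif acnt) :
    C.Starting j ((j - 1) * C.s) 0 0 0 (fun m => lvf (blk C.s m) ≤ C.level m) out best := by
  have key : ∀ m, 1 ≤ m → blk C.s m = j → ¬ m ≤ (j - 1) * C.s := fun m h₁ h₂ => by
    have := pred_blk_mul_lt hs h₁
    rw [h₂] at this
    omega
  refine ⟨fun m => ⟨?_, ?_⟩, fun h => absurd h (by omega), h.out.congr fun m h₁ h₂ => ?_,
    fun m ip h₁ h₂ h₃ h₄ => absurd h₄ (key m h₁ h₃)⟩
  · rintro ⟨q, hq, -⟩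
    omega
  · rintro ⟨a, b, c, d, e⟩
    exact absurd e (key m a c)
  · have := key m h₁
    tauto

theorem Data.start {lvf : ℕ → ℕ} {out out' : List (ℕ × ℕ)} {best best' afst adif acnt : ℕ → ℕ}
    {j af ad ac m₀ : ℕ} (h : C.Data lvf out best afst adif acnt) (hl : lvf j = j + 1)
    (hm : ∀ m, blk C.s m = j → m ≤ m₀)
    (hp : C.Starting j m₀ af ad ac (fun m => lvf (blk C.s m) ≤ C.level m) out' best')
    (hbest : ∀ i, best i ≤ best' i) :
    C.Data (Function.update lvf j (j - 1)) out' best' (Function.update afst j af)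
      (Function.update adif j ad) (Function.update acnt j ac) where
  out := hp.out.congr fun m h₁ h₂ => by
    by_cases hb : blk C.s m = j
    · have := level_le (n := C.n) (S := C.S) (s := C.s) m
      rw [hb, Function.update_self, hl]
      simp only [hm m hb, and_true, true_and]
      constructor
      · exact .inr
      · rintro (hh | hh)
        · have : C.level m ≤ blk C.s m := this
          omega
        · exact hh
    · rw [Function.update_of_ne hb]
      simp [hb]
  ap j' hj' m := by
    by_cases hb : j' = j
    · subst hb
      simp only [Function.update_self]
      rw [hp.ap m]
      constructor
      · rintro ⟨a, b, c, d, -⟩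
        exact ⟨a, b, c, d⟩
      · rintro ⟨a, b, c, d⟩
        exact ⟨a, b, c, d, hm m c⟩
    · simp only [Function.update_of_ne hb] at hj' ⊢
      exact h.ap j' hj' m
  dif j' hj' := by
    by_cases hb : j' = j
    · subst hb
      simp only [Function.update_self]
      exact hp.dif
    · simp only [Function.update_of_ne hb] at hj' ⊢
      exact h.dif j' hj'
  best m ip' h₁ h₂ h₃ h₄ h₅ := by
    by_cases hb : blk C.s m = j
    · rw [hb, Function.update_self] at h₃
      exact hp.best m ip' h₁ h₂ hb (hm m hb) h₃ (hb ▸ h₄) h₅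
    · rw [Function.update_of_ne hb] at h₃
      exact (h.best m ip' h₁ h₂ h₃ h₄ h₅).trans (hbest _)

end Ctx

/-! ### Pruning a progression -/

section
set_option linter.unusedSimpArgs false

variable {C : Ctx} {σ : St} {P : St → Prop}

namespace Ctx

/-- Bounds for the components of an arithmetic progression. -/
structure APBound (C : Ctx) (af ad ac : ℕ) : Prop where
  ad_le : ad ≤ C.n
  ac_le : ac ≤ C.s
  af_le : af ≤ C.n + C.n * C.n
  last_le : ac ≠ 0 → af + (ac - 1) * ad ≤ C.n + C.n * C.n

theorem APBound.pop_last {af ad ac : ℕ} (h : C.APBound af ad ac) : C.APBound af ad (ac - 1) where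
  ad_le := h.ad_le
  ac_le := (Nat.sub_le _ _).trans h.ac_le
  af_le := h.af_le
  last_le h' := by
    refine le_trans ?_ (h.last_le (by omega))
    gcongr
    omega

theorem APBound.pop_first {af ad ac : ℕ} (h : C.APBound af ad ac) (hac : 2 ≤ ac) :
    C.APBound (af + ad) ad (ac - 1) := by
  have h₁ := h.last_le (by omega)
  obtain ⟨c, rfl⟩ : ∃ c, ac = c + 2 := ⟨ac - 2, by omega⟩
  have e : (c + 2 - 1) * ad = c * ad + ad := by
    rw [show c + 2 - 1 = c + 1 by omega, Nat.succ_mul]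
  rw [e] at h₁
  refine ⟨h.ad_le, (Nat.sub_le _ _).trans h.ac_le, by omega, fun _ => ?_⟩
  rw [show c + 2 - 1 - 1 = c by omega]
  omega

/-- The quantities that are not changed while a block is processed. -/
def Same (σ τ : St) : Prop := τ.small = σ.small ∧ τ.L = σ.L ∧ τ.lim = σ.lim

def DataOf (C : Ctx) (lvf : ℕ → ℕ) (σ : St) : Prop :=
  C.Data lvf σ.out σ.best σ.afst σ.adif σ.acnt

/-- The state while the progression of the block `j` is pruned. -/
structure PruneSt (C : Ctx) (k : ℕ) (lvf : ℕ → ℕ) (σ τ : St) : Prop where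
  pass : C.PassSt k τ
  same : Same σ τ
  j : τ.j = σ.j
  ip : τ.ip = σ.ip
  afst : τ.afst = σ.afst
  adif : τ.adif = σ.adif
  acnt : τ.acnt = σ.acnt
  ad : τ.ad = σ.adif σ.j
  bound : C.APBound τ.af τ.ad τ.ac
  go : τ.go ≤ 1
  time : τ.time + 100 * (τ.ac + τ.go) ≤ σ.time + 100 * σ.acnt σ.j + 110
  best : ∀ i, σ.best i ≤ τ.best i
  good : C.Good → C.Pruning σ.j σ.ip (InAP τ.af τ.ad τ.ac)
      (fun m => lvf (blk C.s m) ≤ C.level m) τ.out ∧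
    (2 ≤ τ.ac → 0 < τ.ad ∧ τ.ad < C.s) ∧
    (τ.go = 0 → ∀ m, InAP τ.af τ.ad τ.ac m →
      C.level m < σ.ip ∧ m - (σ.ip - 1) * C.s ≤ τ.best (σ.ip - 1))

end Ctx

/-- The relation between `ip`, `k` and `j` says that, for `ip ≥ 1`, the right ends of the candidates
fall into the two most recent blocks. -/
theorem Ctx.inRange_prune (hC : C.Ok) {k j ip m : ℕ} (hj : ip + k = 2 * j + 1) (h₁ : 1 ≤ m)
    (h₂ : m ≤ C.n) (h₃ : blk C.s m = j) (h₄ : ip ≤ j + 1 - 1) : C.InRange k ip m := by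
  have a := pred_blk_mul_lt hC.s_pos h₁
  have b := le_blk_mul (x := m) hC.s_pos
  have c := Ctx.one_le_blk hC.s_pos h₁
  rw [h₃] at a b c
  have d := Nat.mul_le_mul_right C.s (show ip - 1 ≤ j - 1 by omega)
  have e : (j - 1) * C.s + C.s = j * C.s := by
    rw [← Nat.succ_mul, Nat.succ_eq_add_one, Nat.sub_add_cancel c]
  refine ⟨h₁, h₂, by omega, fun hip => ?_⟩
  rw [← Nat.add_mul, show k + (ip - 1) = j + j by omega, Nat.add_mul]
  omega

/-- Each round deletes a candidate or clears `go`, so `ac + go` decreases, and the deletions are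
paid for by the decrease of `acnt`. If `ip = 0`, every test fails and the whole progression is
reported. -/
theorem wp_prune (hC : C.Ok) {k : ℕ} {lvf : ℕ → ℕ} (hp : C.PassSt k σ) (hjk : σ.j + 3 ≤ k)
    (hip : σ.ip + k = 2 * σ.j + 1) (hb : ∀ i, C.APBound (σ.afst i) (σ.adif i) (σ.acnt i))
    (hd : C.Good → C.DataOf lvf σ) (hl : lvf σ.j = σ.ip + 1)
    (h : ∀ τ, C.PassSt k τ → Ctx.Same σ τ → τ.j = σ.j →
      (∀ i, C.APBound (τ.afst i) (τ.adif i) (τ.acnt i)) → (∀ i, i ≠ σ.j → τ.acnt i = σ.acnt i) →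
      (C.Good → C.DataOf (Function.update lvf σ.j σ.ip) τ) →
      τ.time + 100 * τ.acnt σ.j ≤ σ.time + 100 * σ.acnt σ.j + 120 → P τ) :
    wp C.env prune P σ := by
  have hX := hC.X_ge
  have hn := hC.n_le_mul
  have hs1 := hC.s_pos
  have hsn := hC.s_le
  have hK := hC.K_le
  have hkK := hp.2.2.1
  have e₁ : C.env.X = C.X := rfl
  have e₂ : C.env.N = 48 * C.s := rfl
  simp only [prune, wp, Expr.eval_rules, St.get, St.set, St.geta, St.seta, St.tick, e₁, e₂]
  refine ⟨by omega, by omega, by omega, by omega, ?_⟩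
  have hb0 := hb σ.j
  refine wp_loop (C.PruneSt k lvf σ) (fun τ => τ.ac + τ.go) ?_ ?_ ?_
  · intro τ hτ hz
    obtain ⟨pass, same, t₁, t₂, t₃, t₄, t₅, t₆, bound, go, time, best, good⟩ := hτ
    simp only [wp, Expr.eval_rules, St.get, St.set, St.geta, St.seta, St.tick, e₁, e₂] at hz ⊢
    have b₁ := bound.ad_le
    have b₂ := bound.ac_le
    have b₃ := bound.af_le
    have b₄ := bound.last_le
    refine ⟨fun hac => ⟨by omega, ?_⟩, fun hac => ⟨by omega, ?_⟩⟩
    · have b₄ := b₄ hac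
      have hlast : InAP τ.af τ.ad τ.ac (τ.af + (τ.ac - 1) * τ.ad) := ⟨τ.ac - 1, by omega, rfl⟩
      refine wp_aliveTest hC (k := k) pass (by dsimp only; omega) (by dsimp only; omega)
        (by dsimp only; omega) (fun hg => ?_) ?_
      · obtain ⟨a₁, a₂, a₃, -⟩ := (good hg).1.mem _ hlast
        exact C.inRange_prune hC (j := σ.j) (by dsimp only; omega) a₁ a₂ a₃ (by dsimp only; omega)
      intro x b sl o f₁ g₁ r₁ f₂ g₂ r₂ res e bst best' E time' ht hB hmono hres hge
      dsimp only at ht hmono hres hge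
      rw [t₂] at hres hge
      simp only [die, wp, Expr.eval_rules, St.get, St.set, St.geta, St.seta, St.tick, e₁, e₂]
      refine ⟨fun hr => ⟨fun h1 => ⟨by omega, ?_⟩, fun h1 => ⟨by omega, ?_⟩⟩,
        fun hr => ⟨by omega, ?_⟩⟩
      · have h1 := flag_ne.1 h1
        refine ⟨⟨⟨pass.1, pass.2.1, pass.2.2.1, pass.2.2.2.1, pass.2.2.2.2.1, hB⟩, same, t₁, t₂, t₃,
          t₄, t₅, t₆, bound, by dsimp only; omega, by dsimp only; omega,
          fun i => (best i).trans (hmono i), fun hg => ?_⟩, by omega⟩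
        obtain ⟨g₁, g₂, -⟩ := good hg
        refine ⟨g₁, g₂, fun _ m hm => ?_⟩
        obtain ⟨q, hq, rfl⟩ := hm
        dsimp only at hq
        rw [show q = τ.ac - 1 by omega]
        have hal := (hres hg).1 hr
        have := g₁.mem _ hlast
        dsimp only
        exact ⟨(level_lt_iff (by omega)).2 hal, hge hg hal⟩
      · have h1 := flag_eq.1 h1
        have hfirst : InAP τ.af τ.ad τ.ac τ.af := ⟨0, by omega, by omega⟩
        refine wp_aliveTest hC (k := k)
          ⟨pass.1, pass.2.1, pass.2.2.1, pass.2.2.2.1, pass.2.2.2.2.1, hB⟩ (by dsimp only; omega)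
          (by dsimp only; omega) (by dsimp only; omega) (fun hg => ?_) ?_
        · obtain ⟨a₁, a₂, a₃, -⟩ := (good hg).1.mem _ hfirst
          exact C.inRange_prune hC (j := σ.j) (by dsimp only; omega) a₁ a₂ a₃
            (by dsimp only; omega)
        intro x b sl o f₁ g₁ r₁ f₂ g₂ r₂ res' e bst best'' E time'' ht' hB' hmono' hres' hge'
        dsimp only at ht' hmono' hres' hge'
        rw [t₂] at hres' hge'
        simp only [die, wp, Expr.eval_rules, St.get, St.set, St.geta, St.seta, St.tick, e₁, e₂]
        have hbm : ∀ i, σ.best i ≤ best'' i := fun i =>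
          ((best i).trans (hmono i)).trans (hmono' i)
        refine ⟨fun hr' => ⟨by omega, ?_⟩, fun hr' => ⟨by omega, by omega, ?_⟩⟩
        · refine ⟨⟨⟨pass.1, pass.2.1, pass.2.2.1, pass.2.2.2.1, pass.2.2.2.2.1, hB'⟩, same, t₁, t₂,
            t₃, t₄, t₅, t₆, bound, by dsimp only; omega, by dsimp only; omega, hbm, fun hg => ?_⟩,
            by omega⟩
          obtain ⟨g₁, g₂, -⟩ := good hg
          refine ⟨g₁, g₂, fun _ m hm => ?_⟩
          have hal := (hres hg).1 hr
          have hal' := (hres' hg).1 hr'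
          have hge := (hge hg hal).trans (hmono' _)
          obtain ⟨q, hq, rfl⟩ := hm
          dsimp only at hq ⊢
          have hA : ∀ q ≤ τ.ac - 1, C.Alive (σ.ip + 1) (τ.af + q * τ.ad) := fun q hq => by
            obtain ⟨-, -, c₁, c₂⟩ := g₁.mem _ ⟨q, by omega, rfl⟩
            exact (level_lt_iff (by omega)).1 c₂
          obtain ⟨c₁, -, c₂, -⟩ := g₁.mem _ hfirst
          have c₃ := pred_blk_mul_lt hs1 c₁
          rw [c₂] at c₃
          obtain ⟨-, -, d₁, -⟩ := g₁.mem _ ⟨q, by omega, rfl⟩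
          -- Both ends have passed the test at `ip`, and all members are alive at `ip + 1`.
          have := alive_between (j := σ.j) (by omega) (g₂ (by omega)).2 c₃ hA hal' hal
            (q := q) (by omega)
          -- Among palindromes that start at one checkpoint, the last midpoint has the longest, so
          -- its entry in `best` bounds all others.
          refine ⟨(level_lt_iff (by omega)).2 this, le_trans ?_ hge⟩
          have := Nat.mul_le_mul_right τ.ad (show q ≤ τ.ac - 1 by omega)
          omega
        · have bound' := bound.pop_first (by omega)
          refine ⟨⟨⟨pass.1, pass.2.1, pass.2.2.1, pass.2.2.2.1, pass.2.2.2.2.1, hB'⟩, same, t₁, t₂,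
            t₃, t₄, t₅, t₆, bound', by dsimp only; omega, by dsimp only; omega, hbm, fun hg => ?_⟩,
            by omega⟩
          obtain ⟨g₁, g₂, -⟩ := good hg
          dsimp only
          refine ⟨?_, fun h => g₂ (by omega), fun h => absurd h (by omega)⟩
          have := g₁.die hfirst (by omega) (fun hal => (hres' hg).2 hal hr')
            (A' := InAP (τ.af + τ.ad) τ.ad (τ.ac - 1))
            fun m => inAP_pop_first (g₂ (by omega)).1
          rw [t₂, show τ.s = C.s from pass.1.1.2.2.2.1]
          exact this
      · have bound' := bound.pop_last
        refine ⟨⟨⟨pass.1, pass.2.1, pass.2.2.1, pass.2.2.2.1, pass.2.2.2.2.1, hB⟩, same, t₁, t₂, t₃,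
          t₄, t₅, t₆, bound', by dsimp only; omega, by dsimp only; omega,
          fun i => (best i).trans (hmono i), fun hg => ?_⟩, by omega⟩
        obtain ⟨g₁, g₂, -⟩ := good hg
        dsimp only
        refine ⟨?_, fun h => g₂ (by omega), fun h => absurd h (by omega)⟩
        have := g₁.die hlast (by omega) (fun hal => (hres hg).2 hal hr)
          (A' := InAP τ.af τ.ad (τ.ac - 1)) fun m => inAP_pop_last fun h => (g₂ h).1
        rw [t₂, show τ.s = C.s from pass.1.1.2.2.2.1]
        exact this
    · refine ⟨⟨pass, same, t₁, t₂, t₃, t₄, t₅, t₆, bound, by dsimp only; omega,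
        by dsimp only; omega, best, fun hg => ?_⟩, by omega⟩
      obtain ⟨g₁, g₂, -⟩ := good hg
      refine ⟨g₁, g₂, fun _ m hm => ?_⟩
      obtain ⟨q, hq, -⟩ := hm
      dsimp only at hq
      omega
  · refine ⟨hp, ⟨rfl, rfl, rfl⟩, rfl, rfl, rfl, rfl, rfl, rfl, hb0, le_rfl, ?_, fun _ => le_rfl,
      fun hg => ?_⟩
    · dsimp only
      omega
    · exact ⟨(hd hg).pruning hl (by omega), (hd hg).dif _ (by omega), fun h => absurd h one_ne_zero⟩
  · intro τ hτ hz
    simp only [wp, Expr.eval_rules, St.get, St.set, St.geta, St.seta, St.tick, e₁, e₂] at hz ⊢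
    have t₁ := hτ.j
    have t₂ := hτ.bound
    have t₃ := t₂.af_le
    have t₄ := t₂.ac_le
    have t₅ := hτ.time
    refine ⟨by omega, by omega, by omega, by omega, ?_⟩
    refine h _ hτ.pass hτ.same hτ.j (fun i => ?_) (fun i hi => ?_) (fun hg => ?_) ?_
    · dsimp only
      by_cases hi : i = σ.j
      · subst hi
        rw [t₁, Function.update_self, Function.update_self, hτ.adif, ← hτ.ad]
        exact t₂
      · rw [t₁, Function.update_of_ne hi, Function.update_of_ne hi, hτ.afst, hτ.adif, hτ.acnt]
        exact hb i
    · dsimp only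
      rw [t₁, Function.update_of_ne hi, hτ.acnt]
    · obtain ⟨g₁, g₂, g₃⟩ := hτ.good hg
      have := hτ.ad
      rw [this] at g₁ g₂ g₃
      have key := (hd hg).prune hl (by omega) g₁ g₂ (g₃ hz) hτ.best
      unfold Ctx.DataOf
      dsimp only
      rw [t₁, hτ.afst, hτ.adif, hτ.acnt]
      exact key
    · dsimp only
      rw [t₁, Function.update_self]
      omega

end

/-! ### The first tests of the midpoints of a block -/

section
set_option linter.unusedSimpArgs false

variable {C : Ctx} {σ : St} {P : St → Prop}

theorem Ctx.inRange_start (hC : C.Ok) {k ip m : ℕ} (h₁ : 1 ≤ m) (h₂ : m ≤ C.n)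
    (h₃ : blk C.s m + 2 = k) (h₄ : k ≤ ip + 3) (h₅ : ip + 2 ≤ k) : C.InRange k ip m := by
  have a := pred_blk_mul_lt hC.s_pos h₁
  have b := le_blk_mul (x := m) hC.s_pos
  have c := Ctx.one_le_blk hC.s_pos h₁
  set j := blk C.s m
  have d := Nat.mul_le_mul_right C.s (show ip - 1 ≤ j - 1 by omega)
  have e : (j - 1) * C.s + C.s = j * C.s := by
    rw [← Nat.succ_mul, Nat.succ_eq_add_one, Nat.sub_add_cancel c]
  refine ⟨h₁, h₂, by omega, fun hip => ?_⟩
  rw [← Nat.add_mul]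
  obtain hh | hh : k + (ip - 1) = j + j ∨ k + (ip - 1) = j + j + 1 := by omega
  · rw [hh, Nat.add_mul]
    omega
  · rw [hh, Nat.add_mul, Nat.add_mul]
    omega

theorem wp_append (hm : σ.m < C.env.X) (hac : σ.ac + 1 < C.env.X)
    (h : ∀ time, time ≤ σ.time + 6 →
      P { σ with ad := if σ.ac = 1 then σ.m - σ.af else σ.ad, af := if σ.ac ≠ 0 then σ.af else σ.m,
                 ac := σ.ac + 1, time }) : wp C.env append P σ := by
  simp only [append, wp, Expr.eval_rules, St.get, St.set, St.tick]
  refine ⟨fun h1 => ⟨by omega, fun h2 => ⟨hac, ?_⟩, fun h2 => ⟨hm, hac, ?_⟩⟩,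
    fun h1 => ⟨fun h2 => ⟨hac, ?_⟩, fun h2 => ⟨hm, hac, ?_⟩⟩⟩
  · have := h (σ.time + 5) (by omega)
    rwa [if_pos (flag_ne.1 h1), if_pos h2] at this
  · have := flag_ne.1 h1
    omega
  · have := h (σ.time + 5) (by omega)
    rwa [if_neg (flag_eq.1 h1), if_pos h2] at this
  · have := h (σ.time + 5) (by omega)
    rwa [if_neg (flag_eq.1 h1), if_neg (not_not.2 h2)] at this

/-- The state while the midpoints of the block `j` are tested for the first time. -/
structure Ctx.StartSt (C : Ctx) (k j₀ : ℕ) (lvf : ℕ → ℕ) (σ τ : St) : Prop where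
  pass : C.PassSt k τ
  same : Ctx.Same σ τ
  j : τ.j = j₀
  afst : τ.afst = σ.afst
  adif : τ.adif = σ.adif
  acnt : τ.acnt = σ.acnt
  m : τ.m + τ.t = j₀ * C.s
  t : τ.t + τ.ac ≤ C.s
  af : τ.af ≤ C.n
  ad : τ.ad ≤ C.n
  time : τ.time + 90 * τ.t ≤ σ.time + 90 * C.s + 10
  best : ∀ i, σ.best i ≤ τ.best i
  good : C.Good → C.Starting j₀ τ.m τ.af τ.ad τ.ac (fun m => lvf (blk C.s m) ≤ C.level m) τ.out
    τ.best

/-- The block `k - 2` is tested at the levels `k - 2` and `k - 3`. Only at the lower one do the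
palindromes overlap enough for the survivors to form a progression; midpoints that are dead at
either level are reported immediately. -/
theorem wp_startBlock (hC : C.Ok) {k : ℕ} {lvf : ℕ → ℕ} (hp : C.PassSt k σ) (hk : 3 ≤ k)
    (hb : ∀ i, C.APBound (σ.afst i) (σ.adif i) (σ.acnt i))
    (hd : C.Good → C.DataOf lvf σ) (hl : lvf (k - 2) = k - 2 + 1)
    (h : ∀ τ, C.PassSt k τ → Ctx.Same σ τ →
      (∀ i, C.APBound (τ.afst i) (τ.adif i) (τ.acnt i)) → (∀ i, i ≠ k - 2 → τ.acnt i = σ.acnt i) →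
      (C.Good → C.DataOf (Function.update lvf (k - 2) (k - 2 - 1)) τ) →
      τ.time ≤ σ.time + 90 * C.s + 20 → P τ) :
    wp C.env startBlock P σ := by
  have hX := hC.X_ge
  have hn := hC.n_le_mul
  have hs1 := hC.s_pos
  have hsn := hC.s_le
  have hK := hC.K_le
  have hkK := hp.2.2.1
  obtain rfl : σ.k = k := hp.2.1
  have es : σ.s = C.s := hp.1.1.2.2.2.1
  have hKs := C.K_mul_le
  have hjs := Nat.mul_le_mul_right C.s (show σ.k - 2 ≤ C.K by omega)
  have hj1 : (σ.k - 2 - 1) * C.s + C.s = (σ.k - 2) * C.s := by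
    rw [← Nat.succ_mul, Nat.succ_eq_add_one, Nat.sub_add_cancel (by omega)]
  have e₁ : C.env.X = C.X := rfl
  have e₂ : C.env.N = 48 * C.s := rfl
  simp only [startBlock, wp, Expr.eval_rules, St.get, St.set, St.geta, St.seta, St.tick, e₁, e₂]
  generalize hj : σ.k - 2 = j at *
  have e0 : (j - 1) * σ.s = (j - 1) * C.s := by rw [es]
  refine ⟨by omega, by omega, by omega, by omega, by omega, by omega, ?_⟩
  refine wp_loop (C.StartSt σ.k j lvf σ) (fun τ => τ.t) ?_ ?_ ?_
  · intro τ hτ hz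
    obtain ⟨pass, same, t₁, t₂, t₃, t₄, hm, ht, haf, had, time, best, good⟩ := hτ
    simp only [wp, Expr.eval_rules, St.get, St.set, St.geta, St.seta, St.tick, e₁, e₂] at hz ⊢
    have en : τ.n = C.n := pass.1.1.1
    refine ⟨by omega, by omega, fun h1 => ⟨by omega, ?_⟩, fun h1 => ?_⟩
    · have h1 := flag_ne.1 h1
      rw [t₁]
      have hblk : blk C.s (τ.m + 1) = j := (blk_eq_iff hs1).2 (by omega)
      have hlv : ∀ ip, ip ≤ j → (C.level (τ.m + 1) < ip ↔ C.Alive ip (τ.m + 1)) := fun ip hip =>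
        level_lt_iff (by omega)
      have hlv0 : C.level (τ.m + 1) ≤ j := hblk ▸ level_le _
      have hir : ∀ ip, σ.k ≤ ip + 3 → ip + 2 ≤ σ.k → C.InRange σ.k ip (τ.m + 1) := fun ip =>
        C.inRange_start hC (by omega) (by omega) (by omega)
      refine wp_aliveTest hC (k := σ.k) pass (by dsimp only; omega) (by dsimp only; omega)
        (by dsimp only; omega) (fun hg => hir _ (by dsimp only; omega) (by dsimp only; omega)) ?_
      intro x b sl o f₁ g₁ r₁ f₂ g₂ r₂ res e bst best' E time' ht' hB hmono hres hge
      dsimp only at ht' hmono hres hge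
      simp only [wp, Expr.eval_rules, St.get, St.set, St.geta, St.seta, St.tick, e₁, e₂]
      have hbm : ∀ i, σ.best i ≤ best' i := fun i => (best i).trans (hmono i)
      refine ⟨fun hr => ⟨by omega, ?_⟩, fun hr => ?_⟩
      · refine wp_aliveTest hC (k := σ.k)
          ⟨pass.1, pass.2.1, pass.2.2.1, pass.2.2.2.1, pass.2.2.2.2.1, hB⟩ (by dsimp only; omega)
          (by dsimp only; omega) (by dsimp only; omega)
          (fun hg => hir _ (by dsimp only; omega) (by dsimp only; omega)) ?_
        intro x b sl o f₁ g₁ r₁ f₂ g₂ r₂ res' e bst best'' E time'' ht'' hB' hmono' hres' hge'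
        dsimp only at ht'' hmono' hres' hge'
        have hbm' : ∀ i, σ.best i ≤ best'' i := fun i => (hbm i).trans (hmono' i)
        simp only [die, wp, Expr.eval_rules, St.get, St.set, St.geta, St.seta, St.tick, e₁, e₂]
        have hbm'' : ∀ i, τ.best i ≤ best'' i := fun i => (hmono i).trans (hmono' i)
        refine ⟨fun hr' => ?_, fun hr' => ?_⟩
        · refine wp_append (by dsimp only [e₁]; omega) (by dsimp only [e₁]; omega) ?_
          intro time₃ ht₃
          dsimp only at ht₃ ⊢
          refine ⟨⟨⟨pass.1, pass.2.1, pass.2.2.1, pass.2.2.2.1, pass.2.2.2.2.1, hB'⟩, same, rfl, t₂,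
            t₃, t₄, by dsimp only; omega, by dsimp only; omega, by dsimp only; split_ifs <;> omega,
            by dsimp only; split_ifs <;> omega, by dsimp only; omega, hbm', fun hg => ?_⟩,
            by omega⟩
          have a₁ := (hres hg).1 hr
          have a₂ := (hres' hg).1 hr'
          refine (good hg).append hs1 hblk (by omega) ((hlv _ (by omega)).2 a₂) hbm'' ?_
          intro ip h₁ h₂ _
          obtain rfl | rfl : ip = j ∨ ip = j - 1 := by omega
          exacts [(hge hg a₁).trans (hmono' _), hge' hg a₂]
        · refine ⟨⟨⟨pass.1, pass.2.1, pass.2.2.1, pass.2.2.2.1, pass.2.2.2.2.1, hB'⟩, same, rfl, t₂,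
            t₃, t₄, by dsimp only; omega, by dsimp only; omega, haf, had, by dsimp only; omega,
              hbm',
            fun hg => ?_⟩, by omega⟩
          have a₁ := (hres hg).1 hr
          have a₂ : ¬ C.Alive (j - 1) (τ.m + 1) := fun h => (hres' hg).2 h hr'
          have l₁ := (hlv j le_rfl).2 a₁
          have l₂ : ¬ C.level (τ.m + 1) < j - 1 := fun h => a₂ ((hlv _ (by omega)).1 h)
          dsimp only
          rw [show τ.s = C.s from pass.1.1.2.2.2.1]
          refine (good hg).die hblk (by omega) (by omega) le_rfl hbm'' ?_
          intro ip h₁ h₂ h₃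
          obtain rfl : ip = j := by omega
          exact (hge hg a₁).trans (hmono' _)
      · simp only [die, wp, Expr.eval_rules, St.get, St.set, St.geta, St.seta, St.tick, e₁, e₂]
        refine ⟨fun hr' => absurd hr hr', fun _ => ?_⟩
        refine ⟨⟨⟨pass.1, pass.2.1, pass.2.2.1, pass.2.2.2.1, pass.2.2.2.2.1, hB⟩, same, rfl, t₂,
          t₃,
          t₄, by dsimp only; omega, by dsimp only; omega, haf, had, by dsimp only; omega, hbm,
          fun hg => ?_⟩, by omega⟩
        have a₁ : ¬ C.Alive j (τ.m + 1) := fun h => (hres hg).2 h hr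
        have l₁ : ¬ C.level (τ.m + 1) < j := fun h => a₁ ((hlv _ le_rfl).1 h)
        dsimp only
        rw [show τ.s = C.s from pass.1.1.2.2.2.1]
        refine (good hg).die hblk (by omega) (by omega) (by omega) hmono ?_
        intro ip h₁ h₂ h₃
        omega
    · have h1 := flag_eq.1 h1
      refine ⟨⟨pass, same, t₁, t₂, t₃, t₄, by dsimp only; omega, by dsimp only; omega, haf, had,
        by dsimp only; omega, best, fun hg => (good hg).skip (by omega)⟩, by omega⟩
  · refine ⟨hp, ⟨rfl, rfl, rfl⟩, rfl, rfl, rfl, rfl, by dsimp only; omega, by dsimp only; omega,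
      Nat.zero_le _, Nat.zero_le _, ?_, fun _ => le_rfl, fun hg => ?_⟩
    · dsimp only
      omega
    · rw [es]
      exact (hd hg).starting hs1
  · intro τ hτ hz
    obtain ⟨pass, same, t₁, t₂, t₃, t₄, hm, ht, haf, had, time, best, good⟩ := hτ
    simp only [wp, Expr.eval_rules, St.get, St.set, St.geta, St.seta, St.tick, e₁, e₂] at hz ⊢
    rw [t₁, t₂, t₃, t₄]
    refine ⟨by omega, by omega, by omega, by omega, by omega, by omega, ?_⟩
    have hbd : C.APBound τ.af τ.ad τ.ac := by
      refine ⟨had, by omega, by omega, fun hac => ?_⟩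
      have := Nat.mul_le_mul (show τ.ac - 1 ≤ C.n by omega) had
      omega
    refine h _ pass same (fun i => ?_) (fun i hi => ?_) (fun hg => ?_) ?_
    · dsimp only
      by_cases hi : i = j
      · subst hi
        rw [Function.update_self, Function.update_self, Function.update_self]
        exact hbd
      · rw [Function.update_of_ne hi, Function.update_of_ne hi, Function.update_of_ne hi]
        exact hb i
    · dsimp only
      rw [Function.update_of_ne hi]
    · refine (hd hg).start hl (m₀ := τ.m) (fun m hm' => ?_) (good hg) best
      have := le_blk_mul (x := m) hs1
      rw [hm'] at this
      omega
    · dsimp only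
      omega

end

/-! ### Processing all candidates after a block; scanning a block -/

section
set_option linter.unusedSimpArgs false

variable {C : Ctx} {σ : St} {P : St → Prop}

/-- The level from which on the midpoints in the block `j` have been tested after the block `k`. -/
def lv (k j : ℕ) : ℕ := if j + 2 ≤ k then 2 * j + 1 - k else j + 1

/-- The levels when the block `k` has been processed for the midpoints in the blocks before `j`. -/
def lvMid (k j i : ℕ) : ℕ := if i < j ∨ i + 2 = k then lv k i else lv (k - 1) i

/-- Used for the reserve in `cost`: starting or pruning a block changes the number of candidates of
that block only. -/
theorem sum_range_of_eq {f f' : ℕ → ℕ} {j K : ℕ} (hj : j < K) (h : ∀ i, i ≠ j → f' i = f i) :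
    ∑ i ∈ Finset.range K, f' i + f j = ∑ i ∈ Finset.range K, f i + f' j := by
  have h₁ := Finset.add_sum_erase _ f (Finset.mem_range.2 hj)
  have h₂ := Finset.add_sum_erase _ f' (Finset.mem_range.2 hj)
  have h₃ : ∑ i ∈ (Finset.range K).erase j, f' i = ∑ i ∈ (Finset.range K).erase j, f i :=
    Finset.sum_congr rfl fun i hi => h i (Finset.ne_of_mem_erase hi)
  omega

namespace Ctx

def Bounds (C : Ctx) (σ : St) : Prop := ∀ i, C.APBound (σ.afst i) (σ.adif i) (σ.acnt i)

/-- The time, with a reserve for the midpoints that are still to be removed. -/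
def cost (C : Ctx) (σ : St) : ℕ := σ.time + 100 * ∑ i ∈ Finset.range C.K, σ.acnt i

/-- The invariant of the loop in `processBlock`. -/
structure ProcSt (C : Ctx) (k : ℕ) (σ τ : St) : Prop where
  pass : C.PassSt k τ
  same : Same σ τ
  bounds : C.Bounds τ
  one_le : 1 ≤ τ.j
  le : τ.j + 2 ≤ k
  good : C.Good → C.DataOf (lvMid k τ.j) τ
  cost : C.cost τ + 130 * (k - τ.j) ≤ C.cost σ + 190 * C.s + 130 * k + 30

end Ctx

/-- Starting a block takes 90 units per midpoint and puts 100 more aside for its later deletion,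
which gives `190 * s`. The deletions in `prune` draw on this reserve, so each older block costs only
a constant. -/
theorem wp_processBlock (hC : C.Ok) {k : ℕ} (hp : C.PassSt k σ) (hb : C.Bounds σ)
    (hd : C.Good → C.DataOf (lv (k - 1)) σ)
    (h : ∀ τ, C.PassSt k τ → Ctx.Same σ τ → C.Bounds τ → (C.Good → C.DataOf (lv k) τ) →
      C.cost τ ≤ C.cost σ + 190 * C.s + 130 * k + 40 → P τ) : wp C.env processBlock P σ := by
  have hX := hC.X_ge
  have hn := hC.n_le_mul
  have hs1 := hC.s_pos
  have hsn := hC.s_le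
  have hK := hC.K_le
  have hkK := hp.2.2.1
  have hk' := hp.2.1
  have e₁ : C.env.X = C.X := rfl
  simp only [processBlock, wp, Expr.eval_rules, St.get, St.set, St.tick, e₁]
  refine ⟨fun h1 => ?_, fun h1 => ?_⟩
  · have h1 := flag_ne.1 h1
    rw [hk'] at h1
    refine wp_startBlock hC (k := k) (lvf := lv (k - 1)) hp h1 hb hd ?_ ?_
    · unfold lv
      split_ifs <;> omega
    intro τ pass same bounds hacnt good ht
    dsimp only at hacnt ht
    have hsum := sum_range_of_eq (K := C.K) (by omega) hacnt
    have hac := (bounds (k - 2)).ac_le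
    refine ⟨by omega, ?_⟩
    refine wp_loop (C.ProcSt k σ) (fun τ => k - τ.j) ?_ ?_ ?_
    · intro τ hτ hz
      obtain ⟨pass, same, bounds, hj1, hjk, good, hc⟩ := hτ
      have hk'' := pass.2.1
      simp only [wp, Expr.eval_rules, St.get, St.set, St.tick, e₁] at hz ⊢
      rw [hk''] at hz
      have hz := flag_ne.1 hz
      refine ⟨fun h2 => ⟨by omega, ?_⟩, fun h2 => ⟨by omega, ?_⟩⟩
      · have h2 := flag_ne.1 h2
        rw [hk''] at h2
        refine wp_prune hC (k := k) (lvf := lvMid k τ.j) pass hz (by dsimp only; omega) bounds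
          good ?_ ?_
        · dsimp only
          unfold lvMid lv
          split_ifs <;> omega
        intro τ' pass' same' hj' bounds' hacnt' good' ht'
        dsimp only at hj' hacnt' ht' good'
        have hsum := sum_range_of_eq (K := C.K) (by omega) hacnt'
        refine ⟨by omega, ⟨⟨pass', ?_, bounds', ?_, ?_, fun hg => ?_, ?_⟩, ?_⟩⟩
        · exact ⟨same'.1.trans same.1, same'.2.1.trans same.2.1, same'.2.2.trans same.2.2⟩
        · dsimp only; omega
        · dsimp only; omega
        · refine (good' hg).congr hs1 fun i hi => ?_
          dsimp only
          rw [Function.update_apply, hj']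
          unfold lvMid lv
          split_ifs <;> omega
        · dsimp only [Ctx.cost] at hc ⊢
          omega
        · omega
      -- Here `2 * j + 2 ≤ k`: the level of the block was `0` before and stays `0`, so there is
      -- nothing to prune.
      · have h2 := flag_eq.1 h2
        rw [hk''] at h2
        refine ⟨⟨pass, same, bounds, ?_, ?_, fun hg => ?_, ?_⟩, ?_⟩
        · dsimp only; omega
        · dsimp only; omega
        · refine (good hg).congr hs1 fun i hi => ?_
          dsimp only
          unfold lvMid lv
          split_ifs <;> omega
        · dsimp only [Ctx.cost] at hc ⊢
          omega
        · omega
    · refine ⟨pass, same, bounds, le_rfl, h1, fun hg => ?_, ?_⟩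
      · refine (good hg).congr hs1 fun i hi => ?_
        dsimp only
        rw [Function.update_apply]
        unfold lvMid lv
        split_ifs <;> omega
      · dsimp only [Ctx.cost]
        omega
    · intro τ hτ hz
      obtain ⟨pass, same, bounds, hj1, hjk, good, hc⟩ := hτ
      simp only [Expr.eval_rules, St.get] at hz
      have hz := flag_eq.1 hz
      rw [pass.2.1] at hz
      refine h _ pass same bounds (fun hg => ?_) ?_
      · refine (good hg).congr hs1 fun i hi => ?_
        unfold lvMid lv
        split_ifs <;> omega
      · dsimp only [Ctx.cost, St.tick] at hc ⊢
        omega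
  · have h1 := flag_eq.1 h1
    rw [hk'] at h1
    refine h _ hp ⟨rfl, rfl, rfl⟩ hb (fun hg => ?_) ?_
    · refine (hd hg).congr hs1 fun i hi => ?_
      unfold lv
      split_ifs <;> omega
    · dsimp only [Ctx.cost]
      omega

/-- The rule for reading a block, with the invariant `J`. -/
theorem wp_scanBlock (hC : C.Ok) {need : ℕ → Prop} [DecidablePred need] {κ c : ℕ} {tail : Stmt}
    (J : St → Prop) (hκ : 1 ≤ κ) (hst : C.ScanSt need (κ + 1) σ) (hk : σ.k = κ)
    (hy : σ.y = min ((κ - 1) * C.s) C.n) (hJ : J σ)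
    (hJt : ∀ τ t time, J τ → J { τ with t, time })
    (hstep : ∀ τ, J τ → C.ScanSt need (κ + 1) τ → τ.k = κ → τ.y < C.n → blk C.s (τ.y + 1) = κ →
      wp C.env (.seq readStep tail) (fun τ' => J τ' ∧ C.ScanSt need (κ + 1) τ' ∧ τ'.k = κ ∧
        τ'.y = τ.y + 1 ∧ τ'.t = τ.t ∧ τ'.time ≤ τ.time + c) τ)
    (h : ∀ τ, J τ → C.ScanSt need (κ + 1) τ → τ.k = κ → τ.y = min (κ * C.s) C.n →
      τ.time ≤ σ.time + (c + 4) * C.s + 2 → P τ) : wp C.env (scanBlock tail) P σ := by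
  have hX := hC.X_ge
  have hn := hC.n_le_mul
  have hs1 := hC.s_pos
  have hsn := hC.s_le
  have es : σ.s = C.s := hst.1.2.2.2.1
  have e₁ : C.env.X = C.X := rfl
  have hκs : (κ - 1) * C.s + C.s = κ * C.s := by
    rw [← Nat.succ_mul, Nat.succ_eq_add_one, Nat.sub_add_cancel hκ]
  simp only [scanBlock, wp, Expr.eval_rules, St.get, St.set, St.tick, e₁]
  refine ⟨by omega, ?_⟩
  refine wp_loop (fun τ => J τ ∧ C.ScanSt need (κ + 1) τ ∧ τ.k = κ ∧ τ.t ≤ C.s ∧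
    τ.y = min (κ * C.s - τ.t) C.n ∧ τ.time + (c + 4) * τ.t ≤ σ.time + (c + 4) * C.s + 1)
    (fun τ => τ.t) ?_ ?_ ?_
  · rintro τ ⟨hJτ, hs, hkτ, htτ, hyτ, htm⟩ hz
    have en : τ.n = C.n := hs.1.1
    simp only [wp, Expr.eval_rules, St.get, St.set, St.tick, e₁] at hz ⊢
    have e₃ : (c + 4) * (τ.t - 1) + (c + 4) = (c + 4) * τ.t := by
      rw [← Nat.mul_succ, Nat.succ_eq_add_one, Nat.sub_add_cancel (by omega)]
    refine ⟨by omega, fun h1 => ?_, fun h1 => ?_⟩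
    · have h1 := flag_ne.1 h1
      refine wp_mono (a := .seq readStep tail) (hstep _ (hJt _ _ _ hJτ) hs hkτ
        (by dsimp only; omega)
        ((blk_eq_iff hs1).2 (by dsimp only; omega))) ?_
      rintro τ' ⟨a₁, a₂, a₃, a₄, a₅, a₆⟩
      dsimp only at a₄ a₅ a₆
      refine ⟨⟨a₁, a₂, a₃, by omega, by rw [a₄, a₅]; omega, by rw [a₅]; omega⟩, by omega⟩
    · have h1 := flag_eq.1 h1
      refine ⟨⟨hJt _ _ _ hJτ, hs, hkτ, by omega, by omega,
        by omega⟩, by omega⟩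
  · refine ⟨hJt _ _ _ hJ, hst, hk, by dsimp only; omega, ?_, by dsimp only; rw [es]; omega⟩
    dsimp only
    rw [hy, es]
    congr 1
    omega
  · rintro τ ⟨hJτ, hs, hkτ, htτ, hyτ, htm⟩ hz
    simp only [Expr.eval_rules, St.get] at hz
    rw [hz] at hyτ htm
    exact h _ (hJt τ τ.t (τ.time + 1) hJτ) hs hkτ hyτ (by dsimp only [St.tick]; omega)

namespace Ctx

/-- `L` is the length of a longest palindrome in `S[1..y]`, or at least `lim`. -/
structure Grown (C : Ctx) (lim y L : ℕ) : Prop where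
  pal : ∃ m, C.Pal m L
  le : ∀ m l, C.Pal m l → m + l ≤ y → l ≤ L ∨ lim ≤ L

theorem Good.found_iff (h : C.Good) {need : ℕ → Prop} [DecidablePred need] {κ y l : ℕ}
    (hl : 2 * l ≤ y) (hy : y ≤ C.n) :
    C.Found need κ y l ↔ C.Valid need κ (y - 2 * l) ∧ C.Pal (y - l) l := by
  have := h.match_iff (x := y - 2 * l) (y := y) (m := y - l) (by omega) (by omega) hy
  rw [show y - l - (y - 2 * l) = l by omega] at this
  rw [Found, this]
  tauto

/-- A palindrome longer than `L` that ends at `y + 1` has length exactly `L + 1`, because its core,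
shorter by one, ends at `y`. Hence one test per position suffices. -/
theorem Grown.step (hg : C.Good) {need : ℕ → Prop} [DecidablePred need] {κ lim y L L' : ℕ}
    (h : C.Grown lim y L) (hy : y + 1 ≤ C.n)
    (hv : L < lim → 2 * (L + 1) ≤ y + 1 → C.Pal (y + 1 - (L + 1)) (L + 1) →
      C.Valid need κ (y + 1 - 2 * (L + 1)))
    (hL : (L < lim ∧ C.Found need κ (y + 1) (L + 1)) ∧ L' = L + 1 ∨
      ¬ (L < lim ∧ C.Found need κ (y + 1) (L + 1)) ∧ L' = L) : C.Grown lim (y + 1) L' := by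
  have key : ∀ m l, C.Pal m l → m + l ≤ y + 1 → L < l → L < lim →
      l = L + 1 ∧ m = y + 1 - (L + 1) ∧ 2 * (L + 1) ≤ y + 1 := by
    intro m l hp hml hl hlim
    have h₁ := hp.1
    have h₂ := h.le m (l - 1) (hp.mono (Nat.sub_le _ _)) (by omega)
    have h₃ : ¬ m + l ≤ y := fun h₃ => by
      have := h.le m l hp h₃
      omega
    omega
  rcases hL with ⟨⟨h₁, h₂⟩, rfl⟩ | ⟨h₁, rfl⟩
  · refine ⟨⟨_, ((hg.found_iff h₂.1 hy).1 h₂).2⟩, fun m l hp hml => ?_⟩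
    by_contra! hcon
    have := key m l hp hml (by omega) h₁
    omega
  · refine ⟨h.pal, fun m l hp hml => ?_⟩
    by_contra! hcon
    obtain ⟨rfl, rfl, h₃⟩ := key m l hp hml (by omega) (by omega)
    exact h₁ ⟨by omega, (hg.found_iff h₃ hy).2 ⟨hv (by omega) h₃ hp, hp⟩⟩

/-- If all blocks are buffered, 48 slots certainly reach back 40 blocks. -/
theorem valid_of_forall (hs : 1 ≤ C.s) {need : ℕ → Prop} [DecidablePred need]
    (hneed : ∀ i, need i) {κ y l : ℕ} (hκ : blk C.s y = κ) (hl : 2 * l ≤ 40 * C.s) :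
    C.Valid need (κ + 1) (y - 2 * l) := by
  refine ⟨hneed _, ?_⟩
  rw [Nat.count_iff_forall.2 fun i _ => hneed i, Nat.count_iff_forall.2 fun i _ => hneed i]
  have := le_blk_mul (x := y - 2 * l) hs
  have h : blk C.s y ≤ blk C.s (y - 2 * l) + 40 := by
    rw [blk_le_iff hs, Nat.add_mul]
    omega
  omega

end Ctx

end

/-! ### Setup and the complete first pass -/

section
set_option linter.unusedSimpArgs false

variable {C : Ctx} {σ : St} {P : St → Prop}

theorem wp_powStmt {V : Env} {a : ℕ} (hp : 1 ≤ σ.p) (hX : σ.p ^ (a + 1) < V.X)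
    (h : ∀ time, time ≤ σ.time + (a + 1) → P { σ with Q := σ.p ^ (a + 1), time }) :
    wp V (powStmt a) P σ := by
  induction a generalizing P with
  | zero =>
    simp only [powStmt, wp, Expr.eval_rules, St.get, St.set, St.tick]
    rw [zero_add, pow_one] at hX h
    exact ⟨hX, h _ le_rfl⟩
  | succ a ih =>
    have hle : σ.p ^ (a + 1) ≤ σ.p ^ (a + 1 + 1) := Nat.pow_le_pow_right hp (by omega)
    rw [powStmt, wp]
    refine ih (hle.trans_lt hX) fun time ht => ?_
    simp only [wp, Expr.eval_rules, St.get, St.set, St.tick]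
    rw [← pow_succ]
    exact ⟨hX, h _ (by omega)⟩

theorem wp_setup {a : ℕ} (hC : C.Ok) (hs : C.s = (Nat.sqrt C.n + 1) / 2) (hQ : C.Q = σ.p ^ (a + 1))
    (hp : 1 ≤ σ.p) (hQX : C.Q < C.X) (hn : σ.n = C.n)
    (h : ∀ t time, time ≤ σ.time + (3 * C.n + a + 10) →
      P { σ with t, s := C.s, K := C.K, Q := C.Q, time }) : wp C.env (setup a) P σ := by
  have hX := hC.X_ge
  have hnn := hC.n_le_mul
  have hs1 := hC.s_pos
  have hsn := hC.s_le
  have hK := hC.K_le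
  have e₁ : C.env.X = C.X := rfl
  have hsq := Nat.sqrt_le_self C.n
  simp only [setup, wp, Expr.eval_rules, St.get, St.set, St.tick, e₁]
  refine ⟨by omega, ?_⟩
  refine wp_loop (fun τ => τ.t * τ.t ≤ C.n ∧ ∃ t time, time ≤ σ.time + 1 + 2 * t ∧
    τ = { σ with t, time }) (fun τ => C.n - τ.t) ?_ ?_ ?_
  · rintro _ ⟨ht, t, time, htime, rfl⟩ hz
    simp only [wp, Expr.eval_rules, St.get, St.set, St.tick, e₁] at hz ht ⊢
    have hz := flag_ne.1 hz
    have := Nat.le_mul_of_pos_left (t + 1) (show 0 < t + 1 by omega)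
    refine ⟨by omega, ⟨by omega, t + 1, _, by omega, rfl⟩, by omega⟩
  · exact ⟨by simp, 0, _, by omega, rfl⟩
  · rintro _ ⟨ht, t, time, htime, rfl⟩ hz
    simp only [Expr.eval_rules, St.get] at hz ht
    have hz := flag_eq.1 hz
    have hts : t = Nat.sqrt C.n := by
      rw [Nat.eq_sqrt]
      omega
    have hK' : σ.n / C.s + 3 = C.K := by rw [hn, Ctx.K]
    simp only [wp, Expr.eval_rules, St.get, St.set, St.tick, e₁]
    rw [show (t + 1) / 2 = C.s by rw [hts, hs], hK']
    refine ⟨by omega, by omega, ?_⟩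
    refine wp_powStmt hp (by dsimp only; rw [← hQ]; exact hQX) fun time' ht' => ?_
    dsimp only at ht' ⊢
    rw [← hQ]
    exact h _ _ (by omega)

/-- The position `0` is the only one in block `0`. It is the left end of the palindromes that start
with the first symbol, so that block is begun and, if needed, its fingerprint buffered before
anything is read. -/
theorem wp_initScan (hC : C.Ok) {need : ℕ → Prop} [DecidablePred need]
    (hc : C.Const σ.n σ.r σ.Q σ.s σ.K) (hpos : σ.pos = 0)
    (hneed : need 0 ↔ σ.small ≠ 0 ∨ σ.E < σ.best 0 + C.s)
    (h : ∀ F G R rank slot bst sl o bufF bufG bufR time, time ≤ σ.time + 20 →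
      C.ScanSt need 1 { σ with y := 0, F, G, R, rank, slot, bufF, bufG, bufR } →
      P { σ with y := 0, F, G, R, k := 0, rank, slot, bst, sl, o, bufF, bufG, bufR, time }) :
    wp C.env initScan P σ := by
  have hX := hC.X_ge
  have e₁ : C.env.X = C.X := rfl
  have h0 : blk C.s 0 = 0 := (blk_eq_iff hC.s_pos).2 (by have := hC.s_pos; omega)
  simp only [initScan, wp, Expr.eval_rules, St.get, St.set, St.tick, e₁]
  refine ⟨by omega, by omega, by omega, by omega, by omega, by omega, ?_⟩
  refine wp_beginBlock hC (need := need) (κ := 0) (y := 0) (z := 0) hc.2.2.2.1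
    ⟨rfl, rfl, rfl, rfl, fun i hi => absurd hi (Nat.not_lt_zero _),
      fun x hx => absurd hx (Nat.not_lt_zero _)⟩ rfl (Nat.zero_le _) hneed ?_
  intro bst rank slot time ht hscan
  refine wp_storeBuf hC (need := need) (κ := 0) hc hscan rfl (Nat.zero_le _) h0 ?_
  intro sl o bufF bufG bufR time' ht' hscan'
  dsimp only at ht ht'
  exact h _ _ _ _ _ _ _ _ _ _ _ _ (by omega) ⟨hc, hpos, Nat.zero_le _, hscan'⟩

/-- The state after the first pass has processed the block `k`. -/
structure Ctx.FirstSt (C : Ctx) (T : ℕ) (τ : St) : Prop where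
  pass : C.PassSt τ.k τ
  small : τ.small ≠ 0
  lim : τ.lim = 6 * C.s
  bounds : C.Bounds τ
  data : C.Good → C.DataOf (lv τ.k) τ
  L_le : τ.L ≤ C.n
  grown : C.Good → C.Grown (6 * C.s) τ.y τ.L
  cost : C.cost τ ≤ T + τ.k * (250 * C.s + 130 * C.K + 70)

/-- Scanning a block takes at most `49 * s` units plus a constant, and processing its candidates
`190 * s + 130 * K` plus a constant; both are absorbed in the cost of `FirstSt`. -/
theorem wp_firstPass {a : ℕ} (hC : C.Ok) (hs : C.s = (Nat.sqrt C.n + 1) / 2)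
    (hQ : C.Q = σ.p ^ (a + 1)) (hp : 1 ≤ σ.p) (hQX : C.Q < C.X) (hn : σ.n = C.n) (hr : σ.r = C.r)
    (hpos : σ.pos = 0) (hout : σ.out = []) (hL : σ.L = 0) (hE : σ.E = 0) (hbest : σ.best = 0)
    (hafst : σ.afst = 0) (hadif : σ.adif = 0) (hacnt : σ.acnt = 0)
    (h : ∀ τ, τ.k = C.K → C.FirstSt (σ.time + 3 * C.n + a + 60) τ → P τ) :
    wp C.env (firstPass a) P σ := by
  have hX := hC.X_ge
  have hnn := hC.n_le_mul
  have hs1 := hC.s_pos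
  have hsn := hC.s_le
  have hK := hC.K_le
  have e₁ : C.env.X = C.X := rfl
  have e₂ : C.env.N = 48 * C.s := rfl
  simp only [firstPass, wp, Expr.eval_rules, St.get, St.set, St.tick, e₁]
  refine wp_setup hC hs hQ hp hQX hn ?_
  intro t time ht
  simp only [wp, Expr.eval_rules, St.get, St.set, St.tick, e₁]
  refine ⟨by omega, by omega, ?_⟩
  refine wp_initScan hC (need := fun _ => True) ⟨hn, hr, rfl, rfl, rfl⟩ hpos
    (by simp) ?_
  intro F G R rank slot bst sl o bufF bufG bufR time' ht' hst
  have hF := hst.2.2.2.F_eq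
  have hG := hst.2.2.2.G_eq
  have hR := hst.2.2.2.R_eq
  have hF' := hC.fF_lt 0
  have hG' := hC.fG_lt 0
  have hR' := hC.fR_lt 0
  simp only [storeChk, wp, Expr.eval_rules, St.get, St.set, St.seta, St.tick, e₁,
    e₂] at ht' hF hG hR ⊢
  refine ⟨by omega, by omega, by omega, by omega, by omega, by omega, ?_⟩
  refine wp_loop (C.FirstSt (σ.time + 3 * C.n + a + 50)) (fun τ => C.K - τ.k) ?_ ?_ ?_
  · intro τ hτ hz
    simp only [wp, Expr.eval_rules, St.get, St.set, St.tick, e₁] at hz ⊢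
    have hz := flag_ne.1 hz
    obtain ⟨⟨pass₁, pass₂, pass₃, pass₄, pass₅, pass₆⟩, small, lim, bounds, data, L_le, grown,
      cost⟩ := hτ
    have hKτ : τ.K = C.K := pass₁.1.2.2.2.2
    refine ⟨by omega, ?_⟩
    refine wp_beginBlock hC (need := fun _ => True) (κ := τ.k + 1) pass₁.1.2.2.2.1 pass₁.2.2.2 rfl
      (by omega) (by simp [small]) ?_
    intro bst rank slot time₁ ht₁ hscan₁
    refine wp_scanBlock hC (need := fun _ => True) (κ := τ.k + 1) (c := 45)
      (fun τ' => Ctx.Chk C τ.k τ'.chkF τ'.chkG τ'.chkR ∧ C.BestOk τ'.best τ'.E ∧ τ'.small ≠ 0 ∧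
        τ'.lim = 6 * C.s ∧ C.Bounds τ' ∧ (C.Good → C.DataOf (lv τ.k) τ') ∧ τ'.L ≤ C.n ∧
        (C.Good → C.Grown (6 * C.s) τ'.y τ'.L) ∧ τ'.acnt = τ.acnt)
      (by omega) ⟨pass₁.1, pass₁.2.1, pass₁.2.2.1, hscan₁⟩ rfl pass₄
      ⟨pass₅, pass₆, small, lim, bounds, data, L_le, grown, rfl⟩ (fun _ _ _ h => h) ?_ ?_
    · rintro τ' ⟨h₁, h₂, h₃, h₄, h₅, h₆, h₇, h₈, h₉⟩ hs' hk' hy' hb'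
      refine wp_readStep hC hs' hk' (by omega) hy' hb' ?_
      intro y F G R c sl bufF bufG bufR pos x b o f₁ g₁ r₁ f₂ g₂ r₂ res L cnt time₂ ht₂ hy hL hs''
      simp only [wp, St.tick]
      subst hy
      refine ⟨⟨h₁, h₂, h₃, h₄, h₅, h₆, ?_, fun hg => ?_, h₉⟩, hs'', hk', rfl, trivial, by omega⟩
      · rcases hL with ⟨⟨-, h, -⟩, rfl, -⟩ | ⟨-, rfl, -⟩
        · omega
        · exact h₇
      -- Tests occur only for `L < 6 * s`, so the left end is at most `12 * s` positions back.
      · refine (h₈ hg).step hg (need := fun _ => True) (κ := τ.k + 1 + 1) hy'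
          (fun hlt _ _ => C.valid_of_forall hs1 (fun _ => trivial) hb' (by omega)) ?_
        rcases hL with ⟨h, rfl, -⟩ | ⟨h, rfl, -⟩
        exacts [.inl ⟨h₄ ▸ h, rfl⟩, .inr ⟨h₄ ▸ h, rfl⟩]
    · rintro τ' ⟨h₁, h₂, h₃, h₄, h₅, h₆, h₇, h₈, h₉⟩ hs' hk' hy' ht'
      have hF := hs'.2.2.2.F_eq
      have hG := hs'.2.2.2.G_eq
      have hR := hs'.2.2.2.R_eq
      have hF' := hC.fF_lt τ'.y
      have hG' := hC.fG_lt τ'.y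
      have hR' := hC.fR_lt τ'.y
      simp only [storeChk, wp, Expr.eval_rules, St.get, St.set, St.seta, St.tick, e₁,
        e₂] at hF hG hR ⊢
      dsimp only at ht₁ ht'
      refine ⟨by omega, by omega, by omega, by omega, by omega, by omega, ?_⟩
      refine wp_processBlock hC (k := τ.k + 1)
        ⟨hs', hk', by omega, hy', fun i hi => ?_, h₂⟩ h₅ h₆ ?_
      · dsimp only
        rw [hk']
        rcases hi.eq_or_lt with rfl | hi
        · rw [Function.update_self, Function.update_self, Function.update_self, hF, hG, hR, hy']
          exact ⟨rfl, rfl, rfl⟩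
        · rw [Function.update_of_ne hi.ne, Function.update_of_ne hi.ne, Function.update_of_ne hi.ne]
          exact h₁ i (by omega)
      intro τ'' pass' same' bounds' data' cost'
      have hk'' := pass'.2.1
      have hKτ'' : τ''.K = C.K := pass'.1.1.2.2.2.2
      have hy'' := pass'.2.2.2.1
      obtain ⟨s₁, s₂, s₃⟩ := same'
      dsimp only at s₁ s₂ s₃
      refine ⟨⟨by rwa [hk''], by rwa [s₁], by rwa [s₃], bounds', by rwa [hk''], by rwa [s₂],
        fun hg => ?_, ?_⟩, by omega⟩
      · rw [s₂, hy'', ← hy']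
        exact h₈ hg
      · have e₅ : (τ.k + 1) * (250 * C.s + 130 * C.K + 70) =
            τ.k * (250 * C.s + 130 * C.K + 70) + (250 * C.s + 130 * C.K + 70) := by ring
        rw [hk'', e₅]
        unfold Ctx.cost at cost' cost ⊢
        dsimp only at cost' cost
        rw [h₉] at cost'
        omega
  · refine ⟨⟨hst, rfl, Nat.zero_le _, ?_, fun i hi => ?_, ?_⟩, one_ne_zero, rfl, fun i => ?_,
      fun hg => ?_, ?_, fun hg => ?_, ?_⟩
    · simp
    · obtain rfl : i = 0 := Nat.le_zero.1 hi
      simp [hF, hG, hR]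
    · dsimp only
      rw [hbest, hE]
      exact ⟨fun i => le_rfl, Nat.zero_le _, fun _ i hi => absurd rfl hi,
        fun _ => ⟨0, hasPalindrome_zero (Nat.zero_le _)⟩⟩
    · dsimp only
      rw [hafst, hadif, hacnt]
      exact ⟨Nat.zero_le _, Nat.zero_le _, Nat.zero_le _, fun h => absurd rfl h⟩
    · unfold Ctx.DataOf
      dsimp only
      rw [hout]
      -- Initially no level has been tested. As `level m ≤ blk m`, nothing has to be reported yet,
      -- and no block has a progression to maintain.
      have hlv : ∀ j, lv 0 j = j + 1 := fun j => by
        unfold lv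
        split_ifs <;> omega
      refine ⟨fun m e => ?_, fun j hj => ?_, fun j hj => ?_, fun m ip h₁ h₂ h₃ h₄ => ?_⟩
      · have : C.level m ≤ blk C.s m := level_le m
        simp only [List.not_mem_nil, false_iff, hlv]
        omega
      · rw [hlv] at hj
        omega
      · rw [hlv] at hj
        omega
      · rw [hlv] at h₃
        omega
    · dsimp only
      omega
    · dsimp only
      rw [hL]
      refine ⟨⟨0, hasPalindrome_zero (Nat.zero_le _)⟩, fun m l _ h => .inl ?_⟩
      omega
    · unfold Ctx.cost
      dsimp only
      rw [hacnt]
      simp only [Pi.zero_apply, Finset.sum_const_zero]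
      omega
  · intro τ hτ hz
    simp only [Expr.eval_rules, St.get] at hz
    have hz := flag_eq.1 hz
    have h₁ := hτ.pass.1.1.2.2.2.2
    have h₂ := hτ.pass.2.2.1
    refine h _ (by dsimp only [St.tick]; omega) ⟨hτ.pass, hτ.small, hτ.lim, hτ.bounds, hτ.data,
      hτ.L_le, hτ.grown, ?_⟩
    have := hτ.cost
    dsimp only [Ctx.cost, St.tick] at this ⊢
    omega

end

/-! ### Combinatorics of the second pass -/

section
set_option linter.unusedSimpArgs false

variable {C : Ctx} {σ : St} {P : St → Prop}

namespace Ctx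

/-- After `K` blocks no candidate is left: at the level reached by then, the right end would exceed
`(K - 2) * s > n`, so nothing can be alive there. -/
theorem Data.lv_le_level (hC : C.Ok) {m : ℕ} (h₁ : 1 ≤ m) (h₂ : m ≤ C.n) :
    lv C.K (blk C.s m) ≤ C.level m := by
  have hb := hC.blk_le h₂
  have hp := pred_blk_mul_lt hC.s_pos h₁
  have hb1 := C.one_le_blk hC.s_pos h₁
  have hK := hC.lt_K_mul
  have hlv : lv C.K (blk C.s m) = 2 * blk C.s m + 1 - C.K := by rw [lv, if_pos hb]
  by_contra! hlt
  obtain ⟨h₃, h₄⟩ := (level_lt_iff (by omega)).1 hlt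
  have h₅ := h₄.2.1
  have e : (lv C.K (blk C.s m) - 1) * C.s + (C.K - 2) * C.s =
      (blk C.s m - 1) * C.s + (blk C.s m - 1) * C.s := by
    rw [← Nat.add_mul, ← Nat.add_mul]
    congr 1
    omega
  omega

theorem Data.out_final (hC : C.Ok) {out : List (ℕ × ℕ)} {best afst adif acnt : ℕ → ℕ}
    (h : C.Data (lv C.K) out best afst adif acnt) : C.OutOk out fun _ => True :=
  h.out.congr fun _ h₁ h₂ => iff_of_true trivial (lv_le_level hC h₁ h₂)

/-- The first pass has determined the longest palindromes up to an error of `C.s - 1`. -/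
theorem Data.best_final (hC : C.Ok) {out : List (ℕ × ℕ)} {best afst adif acnt : ℕ → ℕ}
    (h : C.Data (lv C.K) out best afst adif acnt) {m l : ℕ} (hp : C.Pal m l) (hl : C.s ≤ l) :
    l + 1 ≤ best (blk C.s (m - l)) + C.s := by
  have hs := hC.s_pos
  have h₁ := hp.1
  have h₂ := hp.2.1
  have h₃ := le_blk_mul (x := m - l) hs
  have h₄ := blk_mul_lt (x := m - l) hs
  have h₅ := le_blk_mul (x := m) hs
  set b := blk C.s (m - l)
  have hb : b + 1 ≤ blk C.s m := by
    by_contra! hlt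
    have := Nat.mul_le_mul_right C.s (show blk C.s m ≤ b by omega)
    omega
  -- Cut the palindrome back to the first checkpoint at or after its left end; this costs less than
  -- `s` of its length.
  have hal : C.Alive (b + 1) m := ⟨by omega, hp.mono (by rw [Nat.add_sub_cancel]; omega)⟩
  have hlev := (level_lt_iff hb).2 hal
  have := h.best m (b + 1) (by omega) (by omega)
    ((lv_le_level hC (by omega) (by omega)).trans hlev.le) hb hlev
  rw [Nat.add_sub_cancel] at this
  omega

/-- The left ends of the longest palindromes lie in needed blocks that are still buffered when the
right ends are read. -/
theorem valid_of_le (hC : C.Ok) {best : ℕ → ℕ} {E : ℕ} {need : ℕ → Prop} [DecidablePred need]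
    (hneed : ∀ i, need i ↔ E < best i + C.s) (hE : 5 * C.s + 1 ≤ E) (hle : ∀ i, best i ≤ E)
    (hsound : ∀ i, best i ≠ 0 → C.Pal (i * C.s + best i) (best i))
    (hbest : ∀ m l, C.Pal m l → C.s ≤ l → l + 1 ≤ best (blk C.s (m - l)) + C.s) {m l : ℕ}
    (hp : C.Pal m l) (hl : E ≤ l) : C.Valid need (blk C.s (m + l) + 1) (m - l) := by
  have hs := hC.s_pos
  have h₁ := hbest m l hp (by omega)
  have h₂ := hp.1
  refine ⟨(hneed _).2 (by omega), ?_⟩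
  have d₁ := Nat.div_add_mod E C.s
  have d₂ := Nat.mod_lt E (show C.s > 0 from hs)
  have d₃ : 5 ≤ E / C.s := (Nat.le_div_iff_mul_le hs).2 (by omega)
  obtain ⟨w, hw⟩ : ∃ w, E / C.s = w + 2 := ⟨E / C.s - 2, by omega⟩
  rw [hw] at d₁ d₃
  have d₄ : C.s * (w + 2) = w * C.s + 2 * C.s := by ring
  -- A needed block has a palindrome of length `ρ = E - s + 1` at its checkpoint, whereas `hbest`
  -- limits all palindromes to lengths below `E + s`, hence below `ρ + 2 * s`. The choice `w = E / s
  -- - 2` makes the window fit into `ρ`.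
  have hwin : ∀ i, Nat.count need (i + w) ≤ Nat.count need i + 6 := by
    refine count_window_le (n := C.n) (S := C.S) (s := C.s) (ρ := E - C.s + 1) (fun i hi => ?_)
      (fun m' hm' => ?_) (by omega)
    · have a := (hneed i).1 hi
      have b := hle i
      exact ⟨i * C.s + best i, (hsound i (by omega)).mono (by omega), by omega, by omega⟩
    · have a := hbest _ _ hm' (by omega)
      have b := hle (blk C.s (m' - (E - C.s + 1 + 2 * C.s)))
      omega
  -- A palindrome spans at most `2 * w + 8 ≤ 6 * w` blocks, that is six windows with six needed
  -- blocks each; 36 slots are fewer than 48.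
  have h₃ := count_windows_le hwin 6 (blk C.s (m - l) + 1)
  have h₄ : blk C.s (m + l) + 1 ≤ blk C.s (m - l) + 1 + 6 * w := by
    have a := le_blk_mul (x := m - l) hs
    have b := hle (blk C.s (m - l))
    have : blk C.s (m + l) ≤ blk C.s (m - l) + 2 * w + 8 := by
      rw [blk_le_iff hs]
      have : (blk C.s (m - l) + 2 * w + 8) * C.s =
        blk C.s (m - l) * C.s + 2 * (w * C.s) + 8 * C.s := by ring
      omega
    omega
  have h₅ := Nat.count_monotone need h₄
  omega

/-- The list of the midpoints of the palindromes of length `L` in `S[1..y]`. -/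
structure ListOk (C : Ctx) (list : ℕ → ℕ) (cnt y L : ℕ) : Prop where
  incr : ∀ t u, t < u → u < cnt → list t < list u
  mem : ∀ m, (∃ t < cnt, list t = m) ↔ 1 ≤ m ∧ C.Pal m L ∧ m + L ≤ y

/-- If three consecutive midpoints lay within distance `L`, the middle palindrome could be extended
by one. It would still end at or before `y`, against the maximality of `L`. -/
theorem ListOk.gap {list : ℕ → ℕ} {cnt y L t : ℕ} (h : C.ListOk list cnt y L)
    (hg : C.Grown C.n y L) (ht : t + 2 < cnt) : list t + L < list (t + 2) := by
  obtain ⟨a₁, a₂, a₃⟩ := (h.mem _).1 ⟨t, by omega, rfl⟩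
  obtain ⟨b₁, b₂, b₃⟩ := (h.mem _).1 ⟨t + 1, by omega, rfl⟩
  obtain ⟨c₁, c₂, c₃⟩ := (h.mem _).1 ⟨t + 2, by omega, rfl⟩
  have i₁ := h.incr t (t + 1) (by omega) (by omega)
  have i₂ := h.incr (t + 1) (t + 2) (by omega) (by omega)
  by_contra! hlt
  have e := a₂.extend (e := 1) b₂ c₂ (by omega) (by omega) hlt
  have := hg.le _ _ e (by omega)
  have := e.1
  have := e.2.1
  omega

/-- Every second midpoint advances by more than `L > 5 * s`, so `48 * s` of them would need more
than `115 * s ^ 2` positions, which exceeds `n`. -/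
theorem ListOk.cnt_lt (hC : C.Ok) {list : ℕ → ℕ} {cnt y L : ℕ} (h : C.ListOk list cnt y L)
    (hg : C.Grown C.n y L) (hy : y ≤ C.n) (hL : 5 * C.s + 1 ≤ L) : cnt < 48 * C.s := by
  by_contra! hle
  have key : ∀ u, 2 * u < cnt → u * L ≤ list (2 * u) := by
    intro u
    induction u with
    | zero => simp
    | succ u ih =>
      intro hu
      have a := ih (by omega)
      have b := h.gap hg (t := 2 * u) (by omega)
      rw [show 2 * (u + 1) = 2 * u + 2 by omega, Nat.succ_mul]
      omega
  have hs := hC.s_pos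
  have hn := hC.n_le
  have a := key (24 * C.s - 1) (by omega)
  obtain ⟨-, b, -⟩ := (h.mem _).1 ⟨2 * (24 * C.s - 1), by omega, rfl⟩
  have b := b.2.1
  have c : (23 * C.s) * (5 * C.s + 1) ≤ (24 * C.s - 1) * L := Nat.mul_le_mul (by omega) hL
  have d : (23 * C.s) * (5 * C.s + 1) = 115 * (C.s * C.s) + 23 * C.s := by ring
  omega

/-- The midpoints of the palindromes of length `L` in `S[1..y]` have been reported. -/
def Listed (C : Ctx) (out : List (ℕ × ℕ)) (y L : ℕ) : Prop :=
  ∀ m e, (m, e) ∈ out ↔ (1 ≤ m ∧ C.Pal m L ∧ m + L ≤ y) ∧ e = L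

theorem mem_succ {y L : ℕ} (hL : 2 * L ≤ y + 1) (m : ℕ) :
    (1 ≤ m ∧ C.Pal m L ∧ m + L ≤ y + 1) ↔
      (1 ≤ m ∧ C.Pal m L ∧ m + L ≤ y) ∨ m = y + 1 - L ∧ C.Pal (y + 1 - L) L := by
  constructor
  · rintro ⟨a, b, c⟩
    rcases c.eq_or_lt with c | c
    · obtain rfl : m = y + 1 - L := by omega
      exact .inr ⟨rfl, b⟩
    · exact .inl ⟨a, b, by omega⟩
  · rintro (⟨a, b, c⟩ | ⟨rfl, b⟩)
    · exact ⟨a, b, by omega⟩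
    · exact ⟨by omega, b, by omega⟩

/-- The midpoint of a palindrome that ends at `y + 1` is appended. -/
theorem ListOk.append {list : ℕ → ℕ} {cnt y L : ℕ} (h : C.ListOk list cnt y L)
    (hL : 2 * L ≤ y + 1) (hp : C.Pal (y + 1 - L) L) :
    C.ListOk (Function.update list cnt (y + 1 - L)) (cnt + 1) (y + 1) L where
  incr t u htu hu := by
    have ht : Function.update list cnt (y + 1 - L) t = list t := Function.update_of_ne
      (by omega) _ _
    rw [ht]
    rcases (Nat.lt_succ_iff.1 hu).eq_or_lt with rfl | hu
    · rw [Function.update_self]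
      have := (h.mem _).1 ⟨t, htu, rfl⟩
      omega
    · rw [Function.update_of_ne hu.ne]
      exact h.incr t u htu hu
  mem m := by
    rw [mem_succ hL, ← h.mem]
    constructor
    · rintro ⟨t, ht, rfl⟩
      rcases (Nat.lt_succ_iff.1 ht).eq_or_lt with rfl | ht
      · exact .inr ⟨by rw [Function.update_self], hp⟩
      · exact .inl ⟨t, ht, by rw [Function.update_of_ne ht.ne]⟩
    · rintro (⟨t, ht, rfl⟩ | ⟨rfl, -⟩)
      · exact ⟨t, by omega, by rw [Function.update_of_ne ht.ne]⟩
      · exact ⟨cnt, by omega, by rw [Function.update_self]⟩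

theorem mem_succ_of_not {y L : ℕ} (hp : ¬ (2 * L ≤ y + 1 ∧ C.Pal (y + 1 - L) L)) (m : ℕ) :
    (1 ≤ m ∧ C.Pal m L ∧ m + L ≤ y + 1) ↔ 1 ≤ m ∧ C.Pal m L ∧ m + L ≤ y := by
  constructor
  · rintro ⟨a, b, c⟩
    refine ⟨a, b, ?_⟩
    by_contra hcon
    have := b.1
    obtain rfl : m = y + 1 - L := by omega
    exact hp ⟨by omega, b⟩
  · rintro ⟨a, b, c⟩
    exact ⟨a, b, by omega⟩

theorem ListOk.succ {list : ℕ → ℕ} {cnt y L : ℕ} (h : C.ListOk list cnt y L)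
    (hp : ¬ (2 * L ≤ y + 1 ∧ C.Pal (y + 1 - L) L)) : C.ListOk list cnt (y + 1) L where
  incr := h.incr
  mem m := by rw [mem_succ_of_not hp, h.mem]

/-- The list is empty when the length `L` is increased. -/
theorem ListOk.grow {list : ℕ → ℕ} {y L : ℕ} (hg : C.Grown C.n y L) (hL : L < C.n) :
    C.ListOk list 0 y (L + 1) where
  incr t u _ hu := absurd hu (by omega)
  mem m := by
    constructor
    · rintro ⟨t, ht, -⟩
      omega
    · rintro ⟨-, b, c⟩
      have := hg.le m _ b c
      omega

theorem Listed.append {out : List (ℕ × ℕ)} {y L : ℕ} (h : C.Listed out y L)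
    (hL : 2 * L ≤ y + 1) (hp : C.Pal (y + 1 - L) L) :
    C.Listed (out ++ [(y + 1 - L, L)]) (y + 1) L := by
  intro m e
  rw [List.mem_append, h, mem_succ hL, List.mem_singleton, Prod.mk.injEq]
  tauto

theorem Listed.succ {out : List (ℕ × ℕ)} {y L : ℕ} (h : C.Listed out y L)
    (hp : ¬ (2 * L ≤ y + 1 ∧ C.Pal (y + 1 - L) L)) : C.Listed out (y + 1) L := fun m e => by
  rw [h, mem_succ_of_not hp]

end Ctx

/-- The outcome of the tests in `collect`. -/
theorem wp_collect (hC : C.Ok) {need : ℕ → Prop} [DecidablePred need] {κ : ℕ}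
    (hscan : C.ScanSt need κ σ) (hκ : blk C.s σ.y < κ) (hcnt : σ.cnt ≤ 48 * C.s)
    (h : ∀ x b sl o f₁ g₁ r₁ f₂ g₂ r₂ res cnt list out time, time ≤ σ.time + 25 →
      (C.Found need κ σ.y σ.L ∧ (σ.small ≠ 0 ∧ cnt = σ.cnt ∧ list = σ.list ∧
          out = σ.out ++ [(σ.y - σ.L, σ.L)] ∨
        σ.small = 0 ∧ σ.cnt < 48 * C.s ∧ cnt = σ.cnt + 1 ∧
          list = Function.update σ.list σ.cnt (σ.y - σ.L) ∧ out = σ.out ∨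
        σ.small = 0 ∧ 48 * C.s ≤ σ.cnt ∧ cnt = σ.cnt ∧ list = σ.list ∧ out = σ.out) ∨
      ¬ C.Found need κ σ.y σ.L ∧ cnt = σ.cnt ∧ list = σ.list ∧ out = σ.out) →
      P { σ with x, b, sl, o, f₁, g₁, r₁, f₂, g₂, r₂, res, cnt, list, out, time }) :
    wp C.env collect P σ := by
  have hX := hC.X_ge
  have hn := hC.n_le_mul
  have hsn := hC.s_le
  have hs1 := hC.s_pos
  have hy := hscan.2.2.1
  have es : σ.s = C.s := hscan.1.2.2.2.1
  have e₁ : C.env.X = C.X := rfl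
  have e₂ : C.env.N = 48 * C.s := rfl
  rw [collect, wp, wp]
  refine ⟨fun hc => ?_, fun hc => ?_⟩
  · simp only [Expr.eval_rules, St.get] at hc
    have hc := flag_ne.1 hc
    refine wp_curTest (σ := σ.tick) (l := σ.L) hC hscan rfl (by dsimp only [St.tick]; omega) hκ
      fun x b sl o f₁ g₁ r₁ f₂ g₂ r₂ res time ht hres => ?_
    simp only [wp, Expr.eval_rules, St.get, St.set, St.seta, St.tick, e₁, e₂] at ht hres ⊢
    refine ⟨fun h1 => ⟨fun h2 => ?_, fun h2 => ⟨fun h3 => ⟨?_, by omega, by omega, ?_⟩,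
      fun h3 => ?_⟩⟩, fun h1 => ?_⟩
    · exact h _ _ _ _ _ _ _ _ _ _ _ _ _ _ _ (by omega)
        (.inl ⟨hres.1 h1, .inl ⟨h2, rfl, rfl, rfl⟩⟩)
    · have := flag_ne.1 h3
      omega
    · have h3 := flag_ne.1 h3
      exact h _ _ _ _ _ _ _ _ _ _ _ _ _ _ _ (by omega)
        (.inl ⟨hres.1 h1, .inr (.inl ⟨h2, by omega, rfl, rfl, rfl⟩)⟩)
    · have h3 := flag_eq.1 h3
      exact h _ _ _ _ _ _ _ _ _ _ _ _ _ _ _ (by omega)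
        (.inl ⟨hres.1 h1, .inr (.inr ⟨h2, by omega, rfl, rfl, rfl⟩)⟩)
    · exact h _ _ _ _ _ _ _ _ _ _ _ _ _ _ _ (by omega)
        (.inr ⟨fun hcon => hres.2 hcon h1, rfl, rfl, rfl⟩)
  · simp only [Expr.eval_rules, St.get] at hc
    have hc := flag_eq.1 hc
    simp only [wp, Expr.eval_rules, St.get, St.set, St.tick, e₁]
    refine ⟨by omega, fun h1 => absurd rfl h1, fun h1 => ?_⟩
    refine h _ _ _ _ _ _ _ _ _ _ _ _ _ _ _ (by omega) (.inr ⟨?_, rfl, rfl, rfl⟩)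
    rintro ⟨h₁, -⟩
    omega

end

/-! ### The complete second pass -/

section
set_option linter.unusedSimpArgs false

variable {C : Ctx} {σ : St} {P : St → Prop}

namespace Ctx

/-- The invariant of the second pass, which starts with the length `L₀`. -/
structure SecondSt (C : Ctx) (L₀ sm E : ℕ) (best : ℕ → ℕ) (τ : St) : Prop where
  small : τ.small = sm
  lim : τ.lim = C.n
  E : τ.E = E
  best : τ.best = best
  cnt_le : τ.cnt ≤ 48 * C.s
  cnt_eq : sm ≠ 0 → τ.cnt = 0
  out_eq : sm = 0 → τ.out = []
  good : C.Good → C.Grown C.n τ.y τ.L ∧ L₀ ≤ τ.L ∧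
    (sm ≠ 0 → τ.L = L₀ ∧ C.Listed τ.out τ.y τ.L) ∧ (sm = 0 → C.ListOk τ.list τ.cnt τ.y τ.L)

/-- The second pass can be started with the length `L₀` and the needed blocks `need`. -/
structure Startable (C : Ctx) (L₀ sm : ℕ) (need : ℕ → Prop) [DecidablePred need] : Prop where
  max : sm ≠ 0 → ∀ m l, C.Pal m l → l ≤ L₀
  large : sm = 0 → 5 * C.s + 1 ≤ L₀
  valid : ∀ m l, C.Pal m l → L₀ ≤ l → C.Valid need (blk C.s (m + l) + 1) (m - l)
  pal : ∃ m, C.Pal m L₀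

theorem Startable.found_iff {L₀ sm : ℕ} {need : ℕ → Prop} [DecidablePred need]
    (h : C.Startable L₀ sm need) (hg : C.Good) {y l : ℕ} (hy : y ≤ C.n) (hl : L₀ ≤ l) :
    C.Found need (blk C.s y + 1) y l ↔ 2 * l ≤ y ∧ C.Pal (y - l) l := by
  constructor
  · intro hf
    exact ⟨hf.1, ((hg.found_iff hf.1 hy).1 hf).2⟩
  · rintro ⟨h₁, h₂⟩
    have := h.valid _ l h₂ hl
    rw [show y - l + l = y by omega, show y - l - l = y - 2 * l by omega] at this
    exact (hg.found_iff h₁ hy).2 ⟨this, h₂⟩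

theorem Grown.isExactReport (hC : C.Ok) {L : ℕ} (h : C.Grown C.n C.n L) {out : List (ℕ × ℕ)}
    (ho : C.Listed out C.n L) : IsExactReport C.n C.S out := by
  have hle : ∀ m l, C.Pal m l → l ≤ L := fun m l hp => by
    have h₁ := hp.2.1
    rcases h.le m l hp h₁ with h₂ | h₂ <;> omega
  have hmax : maxPalLength C.n C.S = L := by
    obtain ⟨m, hm⟩ := h.pal
    -- The midpoint `0` can only witness `L = 0`, and then the midpoint `1` serves as well.
    rcases Nat.eq_zero_or_pos m with rfl | hm0
    · have := hm.1
      obtain rfl : L = 0 := by omega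
      exact maxPalLength_eq le_rfl (hasPalindrome_zero (hC.s_pos.trans hC.s_le)) hle
    · exact maxPalLength_eq hm0 hm hle
  intro m l
  rw [ho, hmax]
  constructor
  · rintro ⟨⟨a, b, c⟩, rfl⟩
    have hmn : m ≤ C.n := by omega
    refine ⟨⟨a, hmn⟩, le_antisymm (hle m _ ((hasPalindrome_iff_le_palLength hmn).2 le_rfl))
      ((hasPalindrome_iff_le_palLength hmn).1 b), rfl⟩
  · rintro ⟨⟨a, b⟩, c, rfl⟩
    have := (hasPalindrome_iff_le_palLength b).2 c.ge
    exact ⟨⟨a, this, this.2.1⟩, rfl⟩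

end Ctx

/-- Since `grow` precedes `collect`, a palindrome that raises `L` resets the list and is then its
first entry. With `small` set, `L` is already maximal, so pairs can be written out at once and need
no revocation. -/
theorem wp_readStep_collect (hC : C.Ok) {L₀ sm E : ℕ} {best : ℕ → ℕ} {need : ℕ → Prop}
    [DecidablePred need] (hL : C.Good → C.Startable L₀ sm need) {κ : ℕ}
    (hσ : C.SecondSt L₀ sm E best σ) (hst : C.ScanSt need (κ + 1) σ) (hk : σ.k = κ) (hκ : κ ≤ C.K)
    (hy : σ.y < C.n) (hb : blk C.s (σ.y + 1) = κ) :
    wp C.env (.seq readStep collect) (fun τ => C.SecondSt L₀ sm E best τ ∧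
      C.ScanSt need (κ + 1) τ ∧ τ.k = κ ∧ τ.y = σ.y + 1 ∧ τ.t = σ.t ∧
      τ.time ≤ σ.time + 65) σ := by
  have hs1 := hC.s_pos
  obtain ⟨small, lim, hE, hbest, cnt_le, cnt_eq, out_eq, good⟩ := hσ
  refine wp_readStep hC hst hk hκ hy hb ?_
  intro y F G R c sl bufF bufG bufR pos x b o f₁ g₁ r₁ f₂ g₂ r₂ res L cnt time ht hy' hL' hst'
  subst hy'
  have hcnt : cnt ≤ 48 * C.s := by
    rcases hL' with ⟨-, -, rfl⟩ | ⟨-, -, rfl⟩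
    exacts [Nat.zero_le _, cnt_le]
  refine wp_collect hC hst' (by dsimp only; omega) hcnt ?_
  intro x b sl o f₁ g₁ r₁ f₂ g₂ r₂ res cnt' list' out' time' ht' hres
  dsimp only at ht' hres
  rw [small] at hres
  rw [lim] at hL'
  refine ⟨⟨small, lim, hE, hbest, ?_, fun h => ?_, fun h => ?_, fun hg => ?_⟩, hst', hk, rfl, rfl,
    by dsimp only; omega⟩
  · dsimp only
    omega
  · have := cnt_eq h
    dsimp only
    omega
  · have := out_eq h
    dsimp only
    rcases hres with ⟨-, ⟨h', -⟩ | ⟨-, -, -, -, h'⟩ | ⟨-, -, -, -, h'⟩⟩ | ⟨-, -, -, h'⟩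
    · exact absurd h h'
    all_goals rw [h', this]
  · dsimp only
    have hS := hL hg
    obtain ⟨g₁, g₂, g₃, g₄⟩ := good hg
    have hgr : C.Grown C.n (σ.y + 1) L := by
      refine g₁.step hg (need := need) (κ := κ + 1) hy (fun _ h₂ h₃ => ?_) ?_
      · have := (hS.found_iff hg hy (by omega)).2 ⟨h₂, h₃⟩
        rw [hb] at this
        exact this.2.1
      · rcases hL' with ⟨h, rfl, -⟩ | ⟨h, rfl, -⟩
        exacts [.inl ⟨h, rfl⟩, .inr ⟨h, rfl⟩]
    have hL₀ : L₀ ≤ L := by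
      rcases hL' with ⟨-, rfl, -⟩ | ⟨-, rfl, -⟩
      exacts [g₂.trans (Nat.le_succ _), g₂]
    have hfound := hS.found_iff hg hy hL₀
    rw [hb] at hfound
    rw [hfound] at hres
    have hgr' : C.Grown C.n σ.y L := ⟨hgr.pal, fun m l h₁ h₂ => hgr.le m l h₁ (by omega)⟩
    have hsm : sm ≠ 0 → L = L₀ ∧ C.Listed σ.out σ.y L := fun h => by
      obtain ⟨a₁, a₂⟩ := g₃ h
      obtain ⟨m, hm⟩ := hgr.pal
      have := hS.max h m L hm
      have : L = σ.L := by omega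
      rw [this]
      exact ⟨a₁, a₂⟩
    have hla : sm = 0 → C.ListOk σ.list cnt σ.y L := fun h => by
      rcases hL' with ⟨⟨h₁, h₂⟩, rfl, rfl⟩ | ⟨-, rfl, rfl⟩
      · exact .grow g₁ h₁
      · exact g₄ h
    refine ⟨hgr, hL₀, fun h => ⟨(hsm h).1, ?_⟩, fun h => ?_⟩
    · rcases hres with ⟨⟨h₁, h₂⟩, ⟨-, -, -, rfl⟩ | ⟨h', -⟩ | ⟨h', -⟩⟩ | ⟨h₁, -, -, rfl⟩
      · exact (hsm h).2.append h₁ h₂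
      · exact absurd h' h
      · exact absurd h' h
      · exact (hsm h).2.succ h₁
    · rcases hres with ⟨⟨h₁, h₂⟩, ⟨h', -⟩ | ⟨-, -, rfl, rfl, -⟩ | ⟨-, h', -⟩⟩ | ⟨h₁, rfl, rfl, -⟩
      · exact absurd h h'
      · exact (hla h).append h₁ h₂
      -- The list never overflows if the fingerprints are reliable; the guard in the program only
      -- protects the memory for the remaining `r`.
      · have := (hla h).cnt_lt hC hgr' hy.le ((hS.large h).trans hL₀)
        omega
      · exact (hla h).succ h₁

/-- The part of the second pass after the initialization of `L`. -/
theorem wp_secondScan (hC : C.Ok) {need : ℕ → Prop} [DecidablePred need]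
    (hL : C.Good → C.Startable σ.L σ.small need)
    (hneed : ∀ i, need i ↔ σ.small ≠ 0 ∨ σ.E < σ.best i + C.s)
    (hc : C.Const σ.n σ.r σ.Q σ.s σ.K) (hpos : σ.pos = 0) (hout : σ.out = [])
    (hlim : σ.lim = C.n) (hcnt : σ.cnt = 0)
    (h : ∀ τ, (C.Good → IsExactReport C.n C.S τ.out) →
      τ.time ≤ σ.time + C.K * (69 * C.s + 20) + 200 * C.s + 40 → P τ) :
    wp C.env (initScan ;;
      .loop ((§.k).lt §.K) (.k ≔ §.k + 1 ;; beginBlock ;; scanBlock collect) ;;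
      .t ≔ 0 ;;
      .loop ((§.t).lt §.cnt) (.aget .m .list §.t ;; .report §.m §.L ;; .t ≔ §.t + 1)) P σ := by
  have hX := hC.X_ge
  have hnn := hC.n_le_mul
  have hs1 := hC.s_pos
  have hsn := hC.s_le
  have hK := hC.K_le
  have e₁ : C.env.X = C.X := rfl
  have e₂ : C.env.N = 48 * C.s := rfl
  rw [wp]
  refine wp_initScan hC hc hpos (hneed 0) ?_
  intro F G R rank slot bst sl o bufF bufG bufR time ht hst
  rw [wp]
  refine wp_loop (fun τ => C.SecondSt σ.L σ.small σ.E σ.best τ ∧ C.ScanSt need (τ.k + 1) τ ∧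
    τ.k ≤ C.K ∧ τ.y = min (τ.k * C.s) C.n ∧
    τ.time ≤ σ.time + 20 + τ.k * (69 * C.s + 20)) (fun τ => C.K - τ.k) ?_ ?_ ?_
  · rintro τ ⟨h₁, h₂, h₃, h₄, h₅⟩ hz
    have hKτ : τ.K = C.K := h₂.1.2.2.2.2
    simp only [wp, Expr.eval_rules, St.get, St.set, St.tick, e₁] at hz ⊢
    have hz := flag_ne.1 hz
    refine ⟨by omega, ?_⟩
    refine wp_beginBlock hC (need := need) (κ := τ.k + 1) h₂.1.2.2.2.1 h₂.2.2.2 rfl (by omega) ?_ ?_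
    · dsimp only
      rw [hneed, h₁.small, h₁.E, h₁.best]
    intro bst rank slot time₁ ht₁ hscan
    dsimp only at ht₁
    refine wp_scanBlock hC (need := need) (κ := τ.k + 1) (c := 65)
      (C.SecondSt σ.L σ.small σ.E σ.best) (by omega) ⟨h₂.1, h₂.2.1, h₂.2.2.1, hscan⟩ rfl h₄
      ⟨h₁.small, h₁.lim, h₁.E, h₁.best, h₁.cnt_le, h₁.cnt_eq, h₁.out_eq, h₁.good⟩
      (fun τ' _ _ h => ⟨h.small, h.lim, h.E, h.best, h.cnt_le, h.cnt_eq, h.out_eq, h.good⟩)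
      (fun τ' a₁ a₂ a₃ a₄ a₅ => wp_readStep_collect hC hL a₁ a₂ a₃ (by omega) a₄ a₅) ?_
    intro τ' a₁ a₂ a₃ a₄ a₅
    dsimp only at a₅
    rw [a₃]
    have e₅ : (τ.k + 1) * (69 * C.s + 20) = τ.k * (69 * C.s + 20) + (69 * C.s + 20) := by ring
    exact ⟨⟨a₁, a₂, by omega, a₄, by rw [e₅]; omega⟩, by omega⟩
  · refine ⟨⟨rfl, hlim, rfl, rfl, ?_, fun _ => hcnt, fun _ => hout, fun hg => ⟨⟨(hL hg).pal, ?_⟩,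
      le_rfl, fun _ => ⟨rfl, ?_⟩, fun _ => ⟨?_, ?_⟩⟩⟩, hst, Nat.zero_le _, ?_, ?_⟩
    · dsimp only
      omega
    · intro m l _ h
      dsimp only at h ⊢
      omega
    · intro m e
      dsimp only
      rw [hout]
      simp only [List.not_mem_nil, false_iff]
      omega
    · intro t u _ hu
      dsimp only at hu
      omega
    · intro m
      dsimp only
      rw [hcnt]
      constructor
      · rintro ⟨t, ht, -⟩
        omega
      · rintro ⟨a, -, b⟩
        omega
    · simp
    · dsimp only
      omega
  · rintro τ ⟨h₁, h₂, h₃, h₄, h₅⟩ hz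
    have hKτ : τ.K = C.K := h₂.1.2.2.2.2
    simp only [Expr.eval_rules, St.get] at hz
    have hz := flag_eq.1 hz
    have hkK : τ.k = C.K := by omega
    have hn : τ.y = C.n := by
      have := hC.lt_K_mul
      have := Nat.mul_le_mul_right C.s (show C.K - 2 ≤ C.K by omega)
      rw [h₄, hkK]
      omega
    rw [hkK] at h₅
    simp only [wp, Expr.eval_rules, St.get, St.set, St.tick, e₁]
    refine ⟨by omega, ?_⟩
    have hcnt' := h₁.cnt_le
    refine wp_loop (fun τ' => τ'.t ≤ τ.cnt ∧ τ'.cnt = τ.cnt ∧ τ'.list = τ.list ∧ τ'.L = τ.L ∧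
      τ'.out = τ.out ++ (List.range τ'.t).map (fun u => (τ.list u, τ.L)) ∧
      τ'.time ≤ τ.time + 2 + 4 * τ'.t) (fun τ' => τ.cnt - τ'.t) ?_ ?_ ?_
    · rintro τ' ⟨a₁, a₂, a₃, a₄, a₅, a₆⟩ hz
      simp only [wp, Expr.eval_rules, St.get, St.set, St.geta, St.tick, e₁, e₂] at hz ⊢
      have hz := flag_ne.1 hz
      refine ⟨by omega, by omega, ⟨by omega, a₂, a₃, a₄, ?_, by omega⟩, by omega⟩
      rw [a₅, a₄, a₃, List.range_succ, List.map_append, List.append_assoc]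
      rfl
    · exact ⟨Nat.zero_le _, rfl, rfl, rfl, by simp, by dsimp only; omega⟩
    · rintro τ' ⟨a₁, a₂, a₃, a₄, a₅, a₆⟩ hz
      simp only [Expr.eval_rules, St.get] at hz
      have hz := flag_eq.1 hz
      have ht : τ'.t = τ.cnt := by omega
      refine h _ (fun hg => ?_) (by dsimp only [St.tick]; omega)
      obtain ⟨g₁, g₂, g₃, g₄⟩ := h₁.good hg
      rw [hn] at g₁ g₃ g₄
      refine g₁.isExactReport hC ?_
      dsimp only [St.tick]
      rw [a₅, ht]
      by_cases hsm : σ.small = 0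
      · intro m e
        rw [h₁.out_eq hsm, List.nil_append, List.mem_map, ← (g₄ hsm).mem]
        simp only [List.mem_range, Prod.mk.injEq]
        constructor
        · rintro ⟨u, hu, rfl, rfl⟩
          exact ⟨⟨u, hu, rfl⟩, rfl⟩
        · rintro ⟨⟨u, hu, rfl⟩, rfl⟩
          exact ⟨u, hu, rfl, rfl⟩
      · rw [h₁.cnt_eq hsm]
        simpa using (g₃ hsm).2

/-- If `L < 6 * s`, the cap was never reached and `L` is the exact maximum; all blocks are buffered.
Otherwise `E` is a length that certainly occurs and lies within `s` of the maximum, and only blocks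
with `best` close to `E` are buffered. -/
theorem wp_secondPass (hC : C.Ok) (hc : C.Const σ.n σ.r σ.Q σ.s σ.K) (hpos : σ.pos = 0)
    (hout : σ.out = []) (hB : C.BestOk σ.best σ.E)
    (hgrown : C.Good → C.Grown (6 * C.s) C.n σ.L)
    (hbest : C.Good → ∀ m l, C.Pal m l → C.s ≤ l → l + 1 ≤ σ.best (blk C.s (m - l)) + C.s)
    (h : ∀ τ, (C.Good → IsExactReport C.n C.S τ.out) →
      τ.time ≤ σ.time + C.K * (69 * C.s + 20) + 200 * C.s + 50 → P τ) :
    wp C.env secondPass P σ := by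
  have hX := hC.X_ge
  have hnn := hC.n_le_mul
  have hs1 := hC.s_pos
  have hE := hB.E_le
  have e₁ : C.env.X = C.X := rfl
  have en : σ.n = C.n := hc.1
  have es : σ.s = C.s := hc.2.2.2.1
  rw [secondPass, wp, wp, wp]
  simp only [Expr.eval_rules, St.get, St.set, St.tick, e₁]
  rw [es]
  refine ⟨by split_ifs <;> omega, fun h1 => ?_, fun h1 => ?_⟩
  · have h1 := flag_ne.1 h1
    rw [if_pos h1, wp, wp, wp, wp, wp]
    simp only [Expr.eval_rules, St.get, St.set, St.tick, e₁]
    refine ⟨by omega, by omega, ?_⟩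
    refine wp_secondScan hC (need := fun i => (1 : ℕ) ≠ 0 ∨ σ.E < σ.best i + C.s) (fun hg => ?_)
      (fun i => Iff.rfl) ⟨hc.1, hc.2.1, hc.2.2.1, rfl, hc.2.2.2.2⟩ hpos hout en rfl ?_
    · have hmax : ∀ m l, C.Pal m l → l ≤ σ.L := fun m l hp => by
        rcases (hgrown hg).le m l hp hp.2.1 with h | h <;> omega
      refine ⟨fun _ => hmax, fun h => absurd h one_ne_zero, fun m l hp hl => ?_, (hgrown hg).pal⟩
      have h₁ := hmax m l hp
      have h₂ := hp.1
      have := C.valid_of_forall (need := fun i => (1 : ℕ) ≠ 0 ∨ σ.E < σ.best i + C.s) hs1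
        (fun _ => .inl one_ne_zero) (y := m + l) (l := l) rfl (by omega)
      rwa [show m + l - 2 * l = m - l by omega] at this
    · intro τ hτ ht
      dsimp only at ht
      exact h τ hτ (by omega)
  · have h1 := flag_eq.1 h1
    rw [if_neg h1]
    rw [wp, wp, wp, wp, wp]
    simp only [Expr.eval_rules, St.get, St.set, St.tick, e₁]
    refine ⟨by omega, by omega, by omega, ?_⟩
    refine wp_secondScan hC (need := fun i => (0 : ℕ) ≠ 0 ∨ σ.E < σ.best i + C.s) (fun hg => ?_)
      (fun i => Iff.rfl) ⟨hc.1, hc.2.1, hc.2.2.1, rfl, hc.2.2.2.2⟩ hpos hout en rfl ?_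
    · obtain ⟨m, hm⟩ := (hgrown hg).pal
      -- A palindrome of length `L ≥ 6 * s` was found, and cutting it back to a checkpoint loses at
      -- most `s - 1`.
      have hE5 : 5 * C.s + 1 ≤ σ.E := by
        have a := hbest hg m _ hm (by omega)
        have b := hB.le (blk C.s (m - σ.L))
        omega
      exact ⟨fun h => absurd rfl h, fun _ => hE5, fun m l hp hl => C.valid_of_le hC (by simp) hE5
        hB.le (hB.sound hg) (hbest hg) hp hl, hB.attained hg⟩
    · intro τ hτ ht
      dsimp only at ht
      exact h τ hτ (by omega)

end

/-! ### The algorithm -/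

/-- The initial state. -/
def St.init (n p r : ℕ) : St where
  n := n
  p := p
  r := r
  s := 0
  Q := 0
  K := 0
  y := 0
  F := 0
  G := 0
  R := 0
  c := 0
  L := 0
  lim := 0
  E := 0
  rank := 0
  small := 0
  cnt := 0
  k := 0
  t := 0
  x := 0
  b := 0
  sl := 0
  o := 0
  f₁ := 0
  g₁ := 0
  r₁ := 0
  f₂ := 0
  g₂ := 0
  r₂ := 0
  res := 0
  j := 0
  ip := 0
  m := 0
  e := 0
  bst := 0
  af := 0
  ad := 0
  ac := 0
  go := 0
  chkF := 0
  chkG := 0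
  chkR := 0
  bufF := 0
  bufG := 0
  bufR := 0
  slot := 0
  best := 0
  afst := 0
  adif := 0
  acnt := 0
  list := 0
  pos := 0
  out := []
  time := 0

theorem sim_init {V : Env} {n p r : ℕ} (hn : n < V.X) (hp : p < V.X) (hr : r < V.X) :
    Sim V (initState n p r) (St.init n p r) where
  var v := by cases v <;> rfl
  arr f i _ := by
    have h : (St.init n p r).geta f i = 0 := by cases f <;> rfl
    rw [h]
    simp only [initState]
    rw [if_neg (by omega), if_neg (by omega), if_neg (by omega)]
  var_lt v := by
    have h0 : 0 < V.X := by omega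
    cases v <;> first | exact hn | exact hp | exact hr | exact h0
  arr_lt f i _ := by
    have h : (St.init n p r).geta f i = 0 := by cases f <;> rfl
    rw [h]
    omega
  pos := rfl
  out := rfl

/-- The registers are kept between the passes. -/
theorem Sim.rewind {V : Env} {μ : State} {σ : St} (h : Sim V μ σ) :
    Sim V { mem := μ.mem, pos := 0, out := [] } { σ with pos := 0, out := [], time := 0 } where
  var v := (h.var v).trans (by cases v <;> rfl)
  arr f i hi := (h.arr f i hi).trans (by cases f <;> rfl)
  var_lt v := lt_of_eq_of_lt (by cases v <;> rfl) (h.var_lt v)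
  arr_lt f i hi := lt_of_eq_of_lt (by cases f <;> rfl) (h.arr_lt f i hi)
  pos := rfl
  out := rfl

theorem Ctx.OutOk.isApproxSqrtReport {C : Ctx} (hC : C.Ok) (hs : C.s = (Nat.sqrt C.n + 1) / 2)
    {out : List (ℕ × ℕ)} (h : C.OutOk out fun _ => True) :
    IsApproxSqrtReport C.n C.S (1 / 2) out := by
  refine ⟨C.estimate, fun m _ hm => ?_, fun m l => ?_⟩
  · obtain ⟨h₁, h₂⟩ := estimate_spec (n := C.n) (S := C.S) hC.s_pos hm
    have h₃ := h₂ _ ((hasPalindrome_iff_le_palLength hm).2 le_rfl)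
    refine ⟨?_, (hasPalindrome_iff_le_palLength hm).1 h₁⟩
    have h₄ : (Nat.sqrt C.n : ℝ) ≤ √(C.n : ℝ) := Real.nat_sqrt_le_real_sqrt
    have h₅ : 2 * palLength C.n C.S m + 1 ≤ 2 * C.estimate m + Nat.sqrt C.n := by
      unfold Ctx.estimate
      omega
    have h₅ : 2 * (palLength C.n C.S m : ℝ) + 1 ≤ 2 * C.estimate m + Nat.sqrt C.n := by
      exact_mod_cast h₅
    linarith
  · rw [h m l]
    simp only [true_and, and_assoc]

/-- An execution of both passes. -/
theorem exists_runs {C : Ctx} (hC : C.Ok) {a p M W : ℕ} (hs : C.s = (Nat.sqrt C.n + 1) / 2)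
    (hQ : C.Q = p ^ (a + 1)) (hp : 1 ≤ p) (hpX : p < C.X) (hrX : C.r < C.X) (hQX : C.Q < C.X)
    (hF : Fits C.env M W) :
    ∃ out₁ out₂, (∃ t ≤ 100 * (20000 + a) * C.n,
      (TwoPassAlgorithm.mk (firstPass a).comp secondPass.comp).Runs M W C.n C.S p C.r t out₁ out₂) ∧
      (C.Good → IsApproxSqrtReport C.n C.S (1 / 2) out₁ ∧ IsExactReport C.n C.S out₂) := by
  have hX := hC.X_ge
  have hnn := hC.n_le_mul
  have hs1 := hC.s_pos
  have hsn := hC.s_le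
  obtain ⟨t₁, μ₁, σ₁, x₁, s₁, c₁, hk, hσ₁⟩ := Run.of_wp
    (wp_firstPass (σ := St.init C.n p C.r) (P := fun τ => τ.k = C.K ∧ C.FirstSt
      (0 + 3 * C.n + a + 60) τ) hC hs hQ hp hQX rfl rfl rfl rfl rfl rfl rfl rfl rfl rfl
      fun τ h₁ h₂ => ⟨h₁, h₂⟩)
    (firstPass_ok a) M W hF _ (sim_init (V := C.env) (show C.n < C.X by omega) hpX hrX)
  have hpass := hσ₁.pass
  have hdata := hσ₁.data
  have hgrown := hσ₁.grown
  have hcost := hσ₁.cost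
  rw [hk] at hpass hdata hcost
  obtain ⟨⟨hc, -, -, -⟩, -, -, hy, -, hB⟩ := hpass
  have hyn : σ₁.y = C.n := by
    have := hC.lt_K_mul
    have := Nat.mul_le_mul_right C.s (show C.K - 2 ≤ C.K by omega)
    omega
  rw [hyn] at hgrown
  obtain ⟨t₂, μ₂, σ₂, x₂, s₂, c₂, hσ₂, ht₂⟩ := Run.of_wp
    (wp_secondPass (σ := { σ₁ with pos := 0, out := [], time := 0 }) (P := fun τ =>
      (C.Good → IsExactReport C.n C.S τ.out) ∧
      τ.time ≤ 0 + C.K * (69 * C.s + 20) + 200 * C.s + 50) hC hc rfl rfl hB hgrown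
      (fun hg m l => (hdata hg).best_final hC) fun τ h₁ h₂ => ⟨h₁, h₂⟩)
    secondPass_ok M W hF _ s₁.rewind
  refine ⟨μ₁.out, μ₂.out, ⟨t₁ + t₂, ?_, μ₁, μ₂, t₁, t₂, x₁, x₂, rfl, rfl, rfl⟩, fun hg => ⟨?_, ?_⟩⟩
  · have h₁ := C.K_mul_le
    have h₂ := hC.K_le
    -- Both `K * K` and `K * s` are linear in `n`, because `K ≤ 4 * s + 7` and `K * s ≤ n + 3 * s`.
    have h₃ : C.K * C.K ≤ 11 * (C.K * C.s) := by
      have := Nat.mul_le_mul_left C.K (show C.K ≤ 11 * C.s by omega)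
      rw [Nat.mul_left_comm] at this
      exact this
    have h₄ : C.K ≤ C.K * C.s := Nat.le_mul_of_pos_right _ hs1
    have h₅ : a ≤ a * C.n := Nat.le_mul_of_pos_right _ (by omega)
    have e₁ : C.K * (250 * C.s + 130 * C.K + 70) =
        250 * (C.K * C.s) + 130 * (C.K * C.K) + 70 * C.K := by ring
    have e₂ : C.K * (69 * C.s + 20) = 69 * (C.K * C.s) + 20 * C.K := by ring
    have e₃ : 100 * (20000 + a) * C.n = 100 * (20000 * C.n + a * C.n) := by ring
    have h₆ : σ₁.time ≤ C.cost σ₁ := Nat.le_add_right _ _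
    dsimp only [St.init] at c₁ c₂
    omega
  · rw [s₁.out]
    exact ((hdata hg).out_final hC).isApproxSqrtReport hC hs
  · rw [s₂.out]
    exact hσ₂ hg

end StreamPal

theorem theorem2 (a : ℕ) :
    ∃ (A : StreamPal.TwoPassAlgorithm) (b C : ℕ),
      ∀ (n p : ℕ) (S : ℕ → ℕ), p.Prime → n ^ 4 ≤ p → p ≤ n ^ 5 →
        (∀ i, 1 ≤ i → i ≤ n → 1 ≤ S i ∧ S i ≤ n ^ a) →
        ∃ out₁ out₂ : ℕ → List (ℕ × ℕ),
          (∀ r, 1 ≤ r → r ≤ p →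
            ∃ t ≤ C * n, A.Runs (C * Nat.sqrt n) (n ^ b) n S p r t (out₁ r) (out₂ r)) ∧
          1 - 1 / (n : ℝ) ≤
            (ProbabilityTheory.uniformOn (Set.Icc 1 p)).real
              {r | StreamPal.IsApproxSqrtReport n S (1 / 2) (out₁ r) ∧
                StreamPal.IsExactReport n S (out₂ r)} := by
  -- The part `5 * (a + 1)` of the exponent accommodates the modulus `p ^ (a + 1)`, the summand 22
  -- absorbs the numerical constants, and the factor 12 is the largest number of leaves of an
  -- expression.
  refine ⟨⟨(StreamPal.firstPass a).comp, StreamPal.secondPass.comp⟩, (5 * (a + 1) + 22) * 12,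
    100 * (20000 + a), fun n p S hp hnp hpn hS => ?_⟩
  have hp2 := hp.two_le
  -- For `n ≤ 1` there is no prime `p ≤ n ^ 5`. From `n ≥ 2` on, powers of `n` can absorb constants.
  have hn : 2 ≤ n := by
    by_contra! hlt
    obtain rfl | rfl : n = 0 ∨ n = 1 := by omega
    · simp at hpn
      omega
    · simp at hpn
      omega
  set X := n ^ (5 * (a + 1) + 22) with hX
  have hpow : ∀ d e, d ≤ e → n ^ d ≤ n ^ e := fun d e h => Nat.pow_le_pow_right (by omega) h
  have hlt : ∀ d e, d < e → n ^ d < n ^ e := fun d e h => Nat.pow_lt_pow_right (by omega) h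
  have hQ : p ^ (a + 1) < X := by
    refine (Nat.pow_le_pow_left hpn (a + 1)).trans_lt ?_
    rw [← pow_mul]
    exact hlt _ _ (by omega)
  have hpX : p < X := hpn.trans_lt (hlt _ _ (by omega))
  have hX13 : 1000 * (n * n) + 1000 ≤ X := by
    have h₁ : 2 ^ 11 * n ^ 2 ≤ n ^ 11 * n ^ 2 :=
      Nat.mul_le_mul_right _ (Nat.pow_le_pow_left hn 11)
    rw [← pow_add] at h₁
    have h₂ := hpow (11 + 2) (5 * (a + 1) + 22) (by omega)
    have h₃ : n ^ 2 = n * n := sq n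
    have h₄ : 2 * 2 ≤ n * n := Nat.mul_le_mul hn hn
    omega
  have hnn : n ≤ n * n := Nat.le_mul_of_pos_left _ (by omega)
  have hsq := Nat.sqrt_le_self n
  have hsq1 : 1 ≤ Nat.sqrt n := Nat.sqrt_pos.2 (by omega)
  have hok : ∀ r, (StreamPal.Ctx.mk n r (p ^ (a + 1)) ((Nat.sqrt n + 1) / 2) X S).Ok := fun r =>
    { s_pos := by dsimp only; omega
      s_le := by dsimp only; omega
      n_le := by
        dsimp only
        have h₁ := Nat.sqrt_le_add n
        have h₂ := Nat.mul_le_mul (show Nat.sqrt n ≤ 2 * ((Nat.sqrt n + 1) / 2) by omega)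
          (show Nat.sqrt n ≤ 2 * ((Nat.sqrt n + 1) / 2) by omega)
        rw [show ∀ s : ℕ, 2 * s * (2 * s) = 4 * (s * s) from fun s => by ring] at h₂
        omega
      Q_gt := Nat.one_lt_pow (by omega) hp.one_lt
      Q_le := hQ.le
      X_ge := hX13
      sym := fun i h₁ h₂ => (hS i h₁ h₂).2.trans_lt (hlt _ _ (by omega)) }
  have hfits : ∀ r, StreamPal.Fits
      (StreamPal.Ctx.mk n r (p ^ (a + 1)) ((Nat.sqrt n + 1) / 2) X S).env
      (100 * (20000 + a) * Nat.sqrt n) (n ^ ((5 * (a + 1) + 22) * 12)) := fun r =>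
    { mem := by
        -- The registers number `64 + 16 * 48 * s`, and `832 = 64 + 16 * 48`.
        have := Nat.mul_le_mul_right (Nat.sqrt n) (show 832 ≤ 100 * (20000 + a) by omega)
        dsimp only [StreamPal.Ctx.env]
        omega
      addr := by
        have : X ≤ n ^ ((5 * (a + 1) + 22) * 12) := hpow _ _ (by omega)
        dsimp only [StreamPal.Ctx.env]
        omega
      hundred := by
        dsimp only [StreamPal.Ctx.env]
        omega
      word := by
        dsimp only [StreamPal.Ctx.env]
        rw [hX, ← pow_mul] }
  have key : ∀ r, ∃ out₁ out₂, (1 ≤ r → r ≤ p → ∃ t ≤ 100 * (20000 + a) * n,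
      (StreamPal.TwoPassAlgorithm.mk (StreamPal.firstPass a).comp StreamPal.secondPass.comp).Runs
        (100 * (20000 + a) * Nat.sqrt n) (n ^ ((5 * (a + 1) + 22) * 12)) n S p r t out₁ out₂) ∧
      (1 ≤ r → r ≤ p → StreamPal.Good S r (p ^ (a + 1)) n →
        StreamPal.IsApproxSqrtReport n S (1 / 2) out₁ ∧ StreamPal.IsExactReport n S out₂) := by
    intro r
    by_cases hr : r ≤ p
    · obtain ⟨o₁, o₂, h₁, h₂⟩ := StreamPal.exists_runs (hok r) (a := a) rfl rfl (by omega) hpX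
        (hr.trans_lt hpX) hQ (hfits r)
      exact ⟨o₁, o₂, fun _ _ => h₁, fun _ _ => h₂⟩
    -- Values `r > p` are never drawn; the empty outputs only make the choice functions total.
    · exact ⟨[], [], fun _ h => absurd h hr, fun _ h => absurd h hr⟩
  choose out₁ out₂ h₁ h₂ using key
  exact ⟨out₁, out₂, h₁, StreamPal.one_sub_le_uniformOn_good (by omega) hp hnp hS h₂⟩
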